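/- **Setup.** Let $y_1,y_2,\dots$ be i.i.d. random vectors in $\mathbb R^p$ with density $f(\cdot\mid\theta_0)$ with respect to a $\sigma$-finite measure $\nu$ (e.g. Lebesgue or counting measure), where $\{f(\cdot\mid\theta)\}_{\theta\in\mathcal T}$, $\mathcal T\subset\mathbb R^d$, is a family of probability densities and $\theta_0$ is an interior point of $\mathcal T$; write $P_{\theta_0}$, $\mathbb E_{\theta_0}$ for probability and expectation under $\theta_0$. Let $\eta\in\mathbb R^{d_\eta}$ (tiles) and $\zeta\in\mathbb R^{d_\zeta}$ (knots) be non-overlapping sub-vectors of $\theta$, with true values $\eta_0,\zeta_0$, and let the parameter spaces of $\zeta$ and of $(\eta,\zeta)$ be the corresponding projections of $\mathcal T$. Let $f_1(y\mid\zeta)\ge 0$ and $f_2(y\mid\eta,\zeta)\ge 0$ be measurable functions (pseudo densities, not necessarily integrating to one), $\ell_1=\log f_1$, $\ell_2=\log f_2$, $Q_n(\zeta)=\sum_{i\le n}\ell_1(\zeta,y_i)$, $L_n(\eta,\zeta)=\sum_{i\le n}\ell_2(\eta,\zeta,y_i)$, and let $\tilde\zeta_n$ and $(\hat\eta_n,\hat\zeta_n)$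 be (measurable) maximizers of $Q_n$ and $L_n$ over the parameter spaces, which exist almost surely for all large $n$. **Regularity conditions**, for $f_1$ with parameter $z=\zeta$, $z_0=\zeta_0$ (and likewise for $f_2$ with $z=(\eta,\zeta)$, $z_0=(\eta_0,\zeta_0)$), with $\ell$ the log-density and $S_n$ the log-likelihood: 1. the set $\{y: f_1(y\mid z)>0\}$ is the same for all $z$; 2. on some ball $B(z_0,\delta)$ in the parameter space, for $P_{\theta_0}$-almost every $y$, $\ell(\cdot,y)$ is finite and three times differentiable; $\mathbb E_{\theta_0}\nabla\ell(z,y)$ and $\mathbb E_{\theta_0}\nabla^2\ell(z,y)$ are finite for $z\in B(z_0,\delta)$; and for each third order partial derivative $\partial^\alpha$, $\sup_{z\in B(z_0,\delta)}|\partial^\alpha\ell(z,y)|\le M_\alpha(y)$ with $\mathbb E_{\theta_0}M_\alpha(y)<\infty$; 3. at $z=z_0$: $\mathbb E_{\theta_0}\nabla\ell=0$, $\mathbb E_{\theta_0}\nabla^2\ell=-\mathbb E_{\theta_0}[\nabla\ell][\nabla\ell]^{\top}$, and $-\mathbb E_{\theta_0}\nabla^2\ell$ is positive definite; 4. for every $\delta>0$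 there is $\epsilon>0$ such that, with probability one, $\sup_{z\notin B(z_0,\delta)}\frac1n[S_n(z)-S_n(z_0)]<-\epsilon$ for all sufficiently large $n$; 5. the maximizer of $S_n$ converges to $z_0$ with probability one. Let $\tilde I_0=-\mathbb E_{\theta_0}\nabla^2_\zeta\ell_1(\zeta_0,y)$, $I_0=-\mathbb E_{\theta_0}\nabla^2_{\eta,\zeta}\ell_2(\eta_0,\zeta_0,y)=\begin{pmatrix}I_0^{11}&I_0^{12}\\I_0^{21}&I_0^{22}\end{pmatrix}$ and $\mu_n=\sqrt n(\tilde\zeta_n-\hat\zeta_n)$. **Posteriors.** Let $\pi(\zeta)$ be a prior density that is continuous and positive at $\zeta_0$, and, for each $\zeta$, let $\pi(\eta\mid\zeta)$ be a conditional prior density, jointly measurable, and continuous (jointly) and positive at $(\eta_0,\zeta_0)$; both priors are supported on the parameter spaces. Put $$\kappa_n(\zeta)\propto e^{Q_n(\zeta)}\pi(\zeta),\qquad \tau_n(\eta\mid\zeta)\propto e^{L_n(\eta,\zeta)}\pi(\eta\mid\zeta),\qquad \zeta_n^*=\int\zeta\,\kappa_n(\zeta)\,d\zeta,$$ each normalized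 to integrate to one. With $t=\sqrt n(\eta-\hat\eta_n)$ and $r=\sqrt n(\zeta-\hat\zeta_n)$, let $\pi^*_{n,3}(t)=n^{-d_\eta/2}\,\tau_n(\hat\eta_n+t/\sqrt n\mid\zeta_n^*)$ be the rescaled plug-in tile posterior, and let $\pi_n^*(t,r)=n^{-(d_\eta+d_\zeta)/2}\,\tau_n(\hat\eta_n+t/\sqrt n\mid\hat\zeta_n+r/\sqrt n)\,\kappa_n(\hat\zeta_n+r/\sqrt n)$ be the rescaled exact mosaic posterior. Write $\phi(\cdot\mid m,\Sigma)$ for the density of $N(m,\Sigma)$. **Theorem.** Suppose that conditions 1–5 hold for $f_1$ and for $f_2$, that the priors are as above, and that $\pi(\zeta)$ has a finite expectation. Then $$\int\Big|\pi^*_{n,3}(t)-\phi\big(t\,\big|\,-(I_0^{11})^{-1}I_0^{12}\mu_n,\ (I_0^{11})^{-1}\big)\Big|\,dt\ \longrightarrow\ 0\quad\text{in }P_{\theta_0}\text{-probability}.$$ Compared with the exact mosaic this underestimates the variance: with the positive semi-definite matrix $\Lambda_0=(I_0^{11})^{-1}I_0^{12}\tilde I_0^{-1}I_0^{21}(I_0^{11})^{-1}$,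 $$\int\Big|\int\pi_n^*(t,r)\,dr-\phi\big(t\,\big|\,-(I_0^{11})^{-1}I_0^{12}\mu_n,\ (I_0^{11})^{-1}+\Lambda_0\big)\Big|\,dt\ \longrightarrow\ 0\quad\text{in }P_{\theta_0}\text{-probability}.$$ -/

import Mathlib

open MeasureTheory ProbabilityTheory Filter Topology

namespace BayesMosaic

noncomputable section

/-- The sub-vector of `θ` whose `i`-th coordinate is the coordinate `s i` of `θ`. -/
def subvec {ι κ : Type*} (s : κ → ι) (θ : EuclideanSpace ℝ ι) : EuclideanSpace ℝ κ :=
  WithLp.toLp 2 (fun i => θ (s i))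

/-- The stacked vector with blocks `η` and `ζ`. -/
def join {ι κ : Type*} (η : EuclideanSpace ℝ ι) (ζ : EuclideanSpace ℝ κ) :
    EuclideanSpace ℝ (ι ⊕ κ) :=
  WithLp.toLp 2 (Sum.elim (fun i => η i) (fun j => ζ j))

/-- `f θ`, for `θ ∈ T`, are probability densities with respect to `ν`
(for instance Lebesgue measure, or a counting measure for discrete data). -/
structure IsDensityFamily {Θ Y : Type*} [MeasurableSpace Y] (ν : Measure Y) (T : Set Θ)
    (f : Θ → Y → ℝ) : Prop where
  measurable : ∀ θ ∈ T, Measurable (f θ)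
  nonneg : ∀ θ ∈ T, ∀ y, 0 ≤ f θ y
  lintegral_eq_one : ∀ θ ∈ T, ∫⁻ y, ENNReal.ofReal (f θ y) ∂ν = 1

/-- The probability distribution with density `g` with respect to `ν`. -/
def lawOf {Y : Type*} [MeasurableSpace Y] (ν : Measure Y) (g : Y → ℝ) : Measure Y :=
  ν.withDensity (fun y => ENNReal.ofReal (g y))

section Likelihood

variable {E Y : Type*}

/-- The log-likelihood of the first `n` observations. -/
def logLik (f : E → Y → ℝ) (x : ℕ → Y) (n : ℕ) (z : E) : ℝ :=
  ∑ i ∈ Finset.range n, Real.log (f z (x i))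

/-- The likelihood of the first `n` observations, that is, the exponential of the
log-likelihood with the convention `exp (log 0) = 0`. -/
def lik (f : E → Y → ℝ) (x : ℕ → Y) (n : ℕ) (z : E) : ℝ :=
  ∏ i ∈ Finset.range n, f z (x i)

end Likelihood

section Derivatives

variable {ι : Type*} [Fintype ι] [DecidableEq ι]

/-- The partial derivative of `g` in the `i`-th coordinate. -/
def pderiv (i : ι) (g : EuclideanSpace ℝ ι → ℝ) : EuclideanSpace ℝ ι → ℝ :=
  fun z => fderiv ℝ g z (EuclideanSpace.single i 1)

/-- `g` is three times (Fréchet) differentiable on the set `B`, which will be open. -/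
def ThriceDifferentiableOn (g : EuclideanSpace ℝ ι → ℝ) (B : Set (EuclideanSpace ℝ ι)) : Prop :=
  DifferentiableOn ℝ g B ∧ DifferentiableOn ℝ (fderiv ℝ g) B ∧
    DifferentiableOn ℝ (fderiv ℝ (fderiv ℝ g)) B

/-- The information matrix: minus the expected Hessian of the log-density at `z₀`. -/
def infoMatrix {Y : Type*} [MeasurableSpace Y] (P : Measure Y)
    (f : EuclideanSpace ℝ ι → Y → ℝ) (z₀ : EuclideanSpace ℝ ι) : Matrix ι ι ℝ :=
  Matrix.of fun i j => - ∫ y, pderiv i (pderiv j (fun z => Real.log (f z y))) z₀ ∂P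

/-- Regularity conditions on a (pseudo) density `f z y` with parameter `z` in the parameter
space `Θ`: `P` is the true distribution of one observation, `x` the sequence of observations
on the probability space `(Ω, Pr)`, `z₀` the true value, and `est n` the maximizer of the
log-likelihood of the first `n` observations. -/
structure Regular {Ω Y : Type*} [MeasurableSpace Ω] [MeasurableSpace Y]
    (Pr : Measure Ω) (P : Measure Y) (x : ℕ → Ω → Y) (Θ : Set (EuclideanSpace ℝ ι))
    (f : EuclideanSpace ℝ ι → Y → ℝ) (z₀ : EuclideanSpace ℝ ι)
    (est : ℕ → Ω → EuclideanSpace ℝ ι) : Prop where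
  measurable : Measurable (Function.uncurry f)
  nonneg : ∀ z ∈ Θ, ∀ y, 0 ≤ f z y
  /-- The support does not depend on the parameter. -/
  common_support : ∀ z ∈ Θ, ∀ z' ∈ Θ, {y | 0 < f z y} = {y | 0 < f z' y}
  /-- Near `z₀` the log-density is finite and three times differentiable, its first and second
  derivatives have finite expectations, and its third order partial derivatives are dominated
  by integrable functions of the observation. -/
  smooth : ∃ δ > 0, Metric.ball z₀ δ ⊆ Θ ∧
    (∀ᵐ y ∂P, (∀ z ∈ Metric.ball z₀ δ, 0 < f z y) ∧
      ThriceDifferentiableOn (fun z => Real.log (f z y)) (Metric.ball z₀ δ)) ∧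
    (∀ z ∈ Metric.ball z₀ δ, ∀ i,
      Integrable (fun y => pderiv i (fun z => Real.log (f z y)) z) P) ∧
    (∀ z ∈ Metric.ball z₀ δ, ∀ i j,
      Integrable (fun y => pderiv i (pderiv j (fun z => Real.log (f z y))) z) P) ∧
    ∀ i j k, ∃ M : Y → ℝ, Integrable M P ∧ ∀ᵐ y ∂P, ∀ z ∈ Metric.ball z₀ δ,
      |pderiv i (pderiv j (pderiv k (fun z => Real.log (f z y)))) z| ≤ M y
  /-- The expected score vanishes at the true value. -/
  score : ∀ i, ∫ y, pderiv i (fun z => Real.log (f z y)) z₀ ∂P = 0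
  /-- The information equality. -/
  information : ∀ i j,
    Integrable (fun y => pderiv i (fun z => Real.log (f z y)) z₀ *
      pderiv j (fun z => Real.log (f z y)) z₀) P ∧
    ∫ y, pderiv i (pderiv j (fun z => Real.log (f z y))) z₀ ∂P =
      - ∫ y, pderiv i (fun z => Real.log (f z y)) z₀ *
        pderiv j (fun z => Real.log (f z y)) z₀ ∂P
  information_posDef : (infoMatrix P f z₀).PosDef
  /-- Away from the true value the log-likelihood is uniformly smaller. -/
  separation : ∀ δ > 0, ∃ ε > 0, ∀ᵐ ω ∂Pr, ∀ᶠ n : ℕ in atTop, ∀ z ∈ Θ \ Metric.ball z₀ δ,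
    (1 / (n : ℝ)) * (logLik f (fun i => x i ω) n z - logLik f (fun i => x i ω) n z₀) < -ε
  est_measurable : ∀ n, Measurable (est n)
  /-- `est n` maximizes the log-likelihood over the parameter space. -/
  est_argmax : ∀ᵐ ω ∂Pr, ∀ᶠ n : ℕ in atTop, est n ω ∈ Θ ∧
    ∀ z ∈ Θ, logLik f (fun i => x i ω) n z ≤ logLik f (fun i => x i ω) n (est n ω)
  /-- The maximizer is strongly consistent. -/
  est_consistent : ∀ᵐ ω ∂Pr, Tendsto (fun n => est n ω) atTop (𝓝 z₀)

/-- The density of the Gaussian distribution with mean `m` and covariance matrix `S`. -/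
def gaussianDensity (m : EuclideanSpace ℝ ι) (S : Matrix ι ι ℝ) (x : EuclideanSpace ℝ ι) : ℝ :=
  (Real.sqrt ((2 * Real.pi) • S).det)⁻¹ *
    Real.exp (-((dotProduct (x - m).ofLp ((S⁻¹).mulVec (x - m).ofLp)) / 2))

/-- `π` is a probability density (with respect to Lebesgue measure) that vanishes outside `Θ`
and is continuous and positive at `z₀`. -/
structure IsPrior (Θ : Set (EuclideanSpace ℝ ι)) (z₀ : EuclideanSpace ℝ ι)
    (π : EuclideanSpace ℝ ι → ℝ) : Prop where
  measurable : Measurable π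
  nonneg : ∀ z, 0 ≤ π z
  eq_zero_of_notMem : ∀ z ∉ Θ, π z = 0
  integral_eq_one : ∫ z, π z = 1
  continuousAt : ContinuousAt π z₀
  pos : 0 < π z₀

end Derivatives

section Mosaic

variable {ι κ : Type*} [Fintype ι] [Fintype κ] {Y : Type*}

/-- `π (join η ζ)` is, for every `ζ` in the parameter space `Θ₁`, a probability density in `η`
(the prior of `η` given `ζ`), it vanishes outside the parameter space `Θ₂` of the pair,
and it is jointly continuous and positive at `z₀`. -/
structure IsConditionalPrior (Θ₁ : Set (EuclideanSpace ℝ κ)) (Θ₂ : Set (EuclideanSpace ℝ (ι ⊕ κ)))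
    (z₀ : EuclideanSpace ℝ (ι ⊕ κ)) (π : EuclideanSpace ℝ (ι ⊕ κ) → ℝ) : Prop where
  measurable : Measurable π
  nonneg : ∀ z, 0 ≤ π z
  eq_zero_of_notMem : ∀ z ∉ Θ₂, π z = 0
  integral_eq_one : ∀ ζ ∈ Θ₁, ∫ η : EuclideanSpace ℝ ι, π (join η ζ) = 1
  continuousAt : ContinuousAt π z₀
  pos : 0 < π z₀

/-- The posterior density of the knots `ζ`. -/
def knotPosterior (f₁ : EuclideanSpace ℝ κ → Y → ℝ) (π₁ : EuclideanSpace ℝ κ → ℝ)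
    (x : ℕ → Y) (n : ℕ) (ζ : EuclideanSpace ℝ κ) : ℝ :=
  lik f₁ x n ζ * π₁ ζ / ∫ ζ' : EuclideanSpace ℝ κ, lik f₁ x n ζ' * π₁ ζ'

/-- The posterior mean of the knots. -/
def knotPosteriorMean (f₁ : EuclideanSpace ℝ κ → Y → ℝ) (π₁ : EuclideanSpace ℝ κ → ℝ)
    (x : ℕ → Y) (n : ℕ) : EuclideanSpace ℝ κ :=
  ∫ ζ : EuclideanSpace ℝ κ, knotPosterior f₁ π₁ x n ζ • ζ

/-- The conditional posterior density of the tiles `η` given the knots `ζ`. -/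
def tileConditional (f₂ : EuclideanSpace ℝ (ι ⊕ κ) → Y → ℝ) (π₂ : EuclideanSpace ℝ (ι ⊕ κ) → ℝ)
    (x : ℕ → Y) (n : ℕ) (η : EuclideanSpace ℝ ι) (ζ : EuclideanSpace ℝ κ) : ℝ :=
  lik f₂ x n (join η ζ) * π₂ (join η ζ) /
    ∫ η' : EuclideanSpace ℝ ι, lik f₂ x n (join η' ζ) * π₂ (join η' ζ)

/-- The density of `t = √n (z - c)` when `z` has density `g`. -/
def rescaled (n : ℕ) (c : EuclideanSpace ℝ ι) (g : EuclideanSpace ℝ ι → ℝ)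
    (t : EuclideanSpace ℝ ι) : ℝ :=
  (Real.sqrt n ^ Fintype.card ι)⁻¹ * g (c + (Real.sqrt n)⁻¹ • t)

/-- The density of `t = √n (η - η̂ₙ)` under the tile conditional with the posterior mean of the
knots plugged in; `zhat` is the stacked vector of `η̂ₙ` and `ζ̂ₙ`. -/
def plugInTile (f₁ : EuclideanSpace ℝ κ → Y → ℝ) (π₁ : EuclideanSpace ℝ κ → ℝ)
    (f₂ : EuclideanSpace ℝ (ι ⊕ κ) → Y → ℝ) (π₂ : EuclideanSpace ℝ (ι ⊕ κ) → ℝ)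
    (x : ℕ → Y) (n : ℕ) (zhat : EuclideanSpace ℝ (ι ⊕ κ)) : EuclideanSpace ℝ ι → ℝ :=
  rescaled n (subvec Sum.inl zhat)
    (fun η => tileConditional f₂ π₂ x n η (knotPosteriorMean f₁ π₁ x n))

/-- The marginal density of `t = √n (η - η̂ₙ)` under the exact mosaic posterior, whose joint
density is `tileConditional η ζ * knotPosterior ζ`: the joint density of `t` and
`r = √n (ζ - ζ̂ₙ)`, integrated over `r`. -/
def exactTile (f₁ : EuclideanSpace ℝ κ → Y → ℝ) (π₁ : EuclideanSpace ℝ κ → ℝ)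
    (f₂ : EuclideanSpace ℝ (ι ⊕ κ) → Y → ℝ) (π₂ : EuclideanSpace ℝ (ι ⊕ κ) → ℝ)
    (x : ℕ → Y) (n : ℕ) (zhat : EuclideanSpace ℝ (ι ⊕ κ)) (t : EuclideanSpace ℝ ι) : ℝ :=
  ∫ r : EuclideanSpace ℝ κ,
    rescaled n (subvec Sum.inl zhat)
      (fun η => tileConditional f₂ π₂ x n η
        (subvec Sum.inr zhat + (Real.sqrt n)⁻¹ • r)) t *
    rescaled n (subvec Sum.inr zhat) (knotPosterior f₁ π₁ x n) r

/-- The `L¹` distance of two functions, with respect to Lebesgue measure. -/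
def l1Dist (g h : EuclideanSpace ℝ ι → ℝ) : ENNReal := ∫⁻ t, ‖g t - h t‖ₑ

/-- The mean `-(I¹¹)⁻¹ I¹² μ`, where `I¹¹`, `I¹²` are blocks of the information matrix `J`. -/
def tileMean [DecidableEq ι] (J : Matrix (ι ⊕ κ) (ι ⊕ κ) ℝ) (μ : EuclideanSpace ℝ κ) :
    EuclideanSpace ℝ ι :=
  WithLp.toLp 2 (-((J.toBlocks₁₁)⁻¹ * J.toBlocks₁₂).mulVec μ.ofLp)

/-- The covariance inflation `(I¹¹)⁻¹ I¹² Ĩ⁻¹ I²¹ (I¹¹)⁻¹` due to the uncertainty of the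
knots, where `K` is the information matrix `Ĩ` of the knots. -/
def covInflation [DecidableEq ι] [DecidableEq κ] (J : Matrix (ι ⊕ κ) (ι ⊕ κ) ℝ)
    (K : Matrix κ κ ℝ) : Matrix ι ι ℝ :=
  (J.toBlocks₁₁)⁻¹ * J.toBlocks₁₂ * K⁻¹ * J.toBlocks₂₁ * (J.toBlocks₁₁)⁻¹

end Mosaic

end

end BayesMosaic

open BayesMosaic

open scoped ENNReal

namespace BayesMosaic

noncomputable section

set_option linter.unusedSectionVars false

/-! Along almost every sample everything is deterministic. The strong law, applied to the averaged
Hessians at the true value and to the integrable bounds on third derivatives, gives a quadratic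
expansion of the log-likelihood, uniform on a fixed ball. Its linear term vanishes at the maximizer,
and the separation condition makes the likelihood exponentially small off any ball. These facts are
collected in `IsLocallyQuadratic` and proved almost surely in `Regular.ae_isLocallyQuadratic`.

The analytic core is `IsLocallyQuadratic.tendsto_posterior`, a Bernstein–von Mises theorem along
affine slices of the rescaled parameter space, in total variation with a weight of at most `1 +
‖t‖`. Near the true value a Gaussian envelope allows dominated convergence; elsewhere an
exponentially small likelihood meets a weighted prior mass of polynomial growth. It is used twice.
(a) On slices with constant rescaled knots `r`, completing the square in the joint Gaussian shows
that the tiles given the knots are asymptotically normal with mean `tileMean J r` and precision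
`J.toBlocks₁₁`. (b) On the whole knot space with weight `1 + ‖h‖`, it gives the normal limit of the
knot posterior, and also its first moment: the posterior mean differs from the maximizer by
`o(n^(-1/2))`.

The plug-in tile posterior is therefore the slice at `r = μₙ + o(1)`, which ignores the spread of
the knots. The exact mosaic averages the slices over `r`, asymptotically `N(μₙ, K⁻¹)` with `K` the
knot information; averaging the Gaussian regression gives the same mean and adds `covInflation` to
the covariance.

Almost sure convergence cannot be claimed in this way, because `μₙ` need not stay bounded along a
sample. What the argument yields is that, for every `M`, the distance is eventually small at those
`n` for which `μₙ` is bounded by a constant depending on `M`. The maximizers are controlled by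
normalized scores, whose second moments are bounded, so Markov's inequality makes the other `n`
improbable (`tendstoInMeasure_of_eventually_le`). -/

/-! ### Convergence in weighted `L¹` -/

section L1

variable {α : Type*} [MeasurableSpace α] {m : Measure α}

/-- If `u n - w n → 0` pointwise, with a common dominating function on sets `S n` that exhaust the
space, and if the mass of `u n` off `S n` vanishes, then `u n - w n → 0` in `L¹`. -/
theorem tendsto_lintegral_enorm_sub_of_dominated_on {u w : ℕ → α → ℝ} {S : ℕ → Set α}
    {G : α → ℝ≥0∞} (hu : ∀ n, Measurable (u n)) (hw : ∀ n, Measurable (w n))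
    (hS : ∀ n, MeasurableSet (S n)) (hSx : ∀ x, ∀ᶠ n in atTop, x ∈ S n)
    (hG : ∫⁻ x, G x ∂m ≠ ∞)
    (hub : ∀ᶠ n in atTop, ∀ x ∈ S n, ‖u n x‖ₑ ≤ G x) (hwb : ∀ n x, ‖w n x‖ₑ ≤ G x)
    (hlim : ∀ x, Tendsto (fun n => u n x - w n x) atTop (𝓝 0))
    (htail : Tendsto (fun n => ∫⁻ x in (S n)ᶜ, ‖u n x‖ₑ ∂m) atTop (𝓝 0)) :
    Tendsto (fun n => ∫⁻ x, ‖u n x - w n x‖ₑ ∂m) atTop (𝓝 0) := by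
  -- On `S n` both functions are below `G`, so `2 * G` dominates the difference.
  have h1 : Tendsto (fun n => ∫⁻ x, (S n).indicator (fun x => ‖u n x - w n x‖ₑ) x ∂m) atTop
      (𝓝 0) := by
    have := tendsto_lintegral_filter_of_dominated_convergence (μ := m) (l := atTop)
      (F := fun n x => (S n).indicator (fun x => ‖u n x - w n x‖ₑ) x) (f := fun _ => 0)
      (fun x => 2 * G x)
      (Eventually.of_forall fun n => (((hu n).sub (hw n)).enorm).indicator (hS n))
      (by
        filter_upwards [hub] with n hn
        refine Eventually.of_forall fun x => ?_
        by_cases hx : x ∈ S n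
        · simp only [Set.indicator_of_mem hx]
          calc ‖u n x - w n x‖ₑ ≤ ‖u n x‖ₑ + ‖w n x‖ₑ := enorm_sub_le
            _ ≤ G x + G x := add_le_add (hn x hx) (hwb n x)
            _ = 2 * G x := (two_mul _).symm
        · simp [Set.indicator_of_notMem hx])
      (by
        rw [lintegral_const_mul' _ _ (by simp)]
        exact ENNReal.mul_ne_top (by simp) hG)
      (Eventually.of_forall fun x => by
        have h0 : Tendsto (fun n => ‖u n x - w n x‖ₑ) atTop (𝓝 0) := by
          simpa using (hlim x).enorm
        refine tendsto_of_tendsto_of_tendsto_of_le_of_le tendsto_const_nhds h0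
          (fun n => zero_le) (fun n => Set.indicator_le_self _ _ _))
    simpa using this
  -- Every point eventually lies in `S n`, so the mass of `w n` off `S n` vanishes by domination
  -- alone; for `u n` it is the hypothesis `htail`.
  have h2 : Tendsto (fun n => ∫⁻ x, ((S n)ᶜ).indicator (fun x => ‖w n x‖ₑ) x ∂m) atTop
      (𝓝 0) := by
    have := tendsto_lintegral_filter_of_dominated_convergence (μ := m) (l := atTop)
      (F := fun n x => ((S n)ᶜ).indicator (fun x => ‖w n x‖ₑ) x) (f := fun _ => 0) G
      (Eventually.of_forall fun n => (((hw n)).enorm).indicator (hS n).compl)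
      (Eventually.of_forall fun n => Eventually.of_forall fun x =>
        (Set.indicator_le_self _ _ _).trans (hwb n x)) hG
      (Eventually.of_forall fun x => by
        refine tendsto_const_nhds.congr' ?_
        filter_upwards [hSx x] with n hn
        simp [hn])
    simpa using this
  have h3 := (h1.add htail).add h2
  simp only [add_zero] at h3
  refine tendsto_of_tendsto_of_tendsto_of_le_of_le tendsto_const_nhds h3 (fun n => zero_le)
    (fun n => ?_)
  simp only
  rw [lintegral_indicator (hS n), lintegral_indicator (hS n).compl,
    ← lintegral_add_compl _ (hS n), add_assoc]
  gcongr
  rw [← lintegral_add_left (hu n).enorm]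
  exact lintegral_mono fun x => enorm_sub_le

/-- Normalizing two nonnegative functions keeps them close in weighted `L¹`. -/
theorem lintegral_mul_enorm_div_integral_sub_le {ρ : α → ℝ≥0∞} {u w : α → ℝ} {c : ℝ} {C : ℝ≥0∞}
    (hρm : Measurable ρ)
    (hρ : ∀ x, 1 ≤ ρ x) (hu : Measurable u) (hw : Measurable w)
    (hwi : Integrable w m) (hc : 0 < c)
    (hcw : c ≤ ∫ x, w x ∂m) (hC : ∫⁻ x, ρ x * ‖w x‖ₑ ∂m ≤ C)
    (hD : ∫⁻ x, ρ x * ‖u x - w x‖ₑ ∂m ≤ ENNReal.ofReal (c / 2)) :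
    ∫⁻ x, ρ x * ‖u x / (∫ x, u x ∂m) - w x / (∫ x, w x ∂m)‖ₑ ∂m ≤
      (ENNReal.ofReal (2 / c) + ENNReal.ofReal (2 / c ^ 2) * C) *
        ∫⁻ x, ρ x * ‖u x - w x‖ₑ ∂m := by
  set D := ∫⁻ x, ρ x * ‖u x - w x‖ₑ ∂m with hDdef
  have hle : ∫⁻ x, ‖u x - w x‖ₑ ∂m ≤ D :=
    lintegral_mono fun x => le_mul_of_one_le_left' (hρ x)
  have hfin : ∫⁻ x, ‖u x - w x‖ₑ ∂m < ∞ := (hle.trans hD).trans_lt ENNReal.ofReal_lt_top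
  have hdi : Integrable (fun x => u x - w x) m :=
    ⟨(hu.sub hw).aestronglyMeasurable, hfin⟩
  have hui : Integrable u m := by
    have := hdi.add hwi
    refine this.congr (Eventually.of_forall fun x => by simp)
  set a := ∫ x, u x ∂m
  set b := ∫ x, w x ∂m
  have hab : ‖a - b‖ₑ ≤ D := by
    rw [← integral_sub hui hwi]
    exact (enorm_integral_le_lintegral_enorm _).trans hle
  -- An error of at most `c / 2` keeps the normalizer `a` above `c / 2`; the factors `2 / c` and `2
  -- / c ^ 2` come from here.
  have hab' : |a - b| ≤ c / 2 := by
    have := hab.trans hD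
    rw [← ofReal_norm, ENNReal.ofReal_le_ofReal_iff (by positivity)] at this
    simpa using this
  have ha : c / 2 ≤ a := by
    have := (abs_le.1 hab').1
    linarith
  have ha0 : 0 < a := by linarith
  have hb0 : 0 < b := by linarith
  have key : ∀ x, ‖u x / a - w x / b‖ₑ ≤
      ENNReal.ofReal (2 / c) * ‖u x - w x‖ₑ + ENNReal.ofReal (2 / c ^ 2) * ‖a - b‖ₑ * ‖w x‖ₑ := by
    intro x
    have hreal : ‖u x / a - w x / b‖ ≤ 2 / c * ‖u x - w x‖ + 2 / c ^ 2 * ‖a - b‖ * ‖w x‖ := by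
      have : u x / a - w x / b = a⁻¹ * (u x - w x) + (-(a⁻¹ * b⁻¹) * (a - b)) * w x := by
        field_simp; ring
      rw [this]
      refine (norm_add_le _ _).trans ?_
      simp only [norm_mul, norm_neg, norm_inv]
      have h1 : ‖a‖⁻¹ ≤ 2 / c := by
        rw [Real.norm_of_nonneg ha0.le, show (2 / c) = (c / 2)⁻¹ by field_simp]
        exact inv_anti₀ (by positivity) ha
      have h2 : ‖b‖⁻¹ ≤ 1 / c := by
        rw [Real.norm_of_nonneg hb0.le, one_div]
        exact inv_anti₀ hc hcw
      have h3 : ‖a‖⁻¹ * ‖b‖⁻¹ ≤ 2 / c ^ 2 := by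
        calc ‖a‖⁻¹ * ‖b‖⁻¹ ≤ 2 / c * (1 / c) := by gcongr
          _ = 2 / c ^ 2 := by field_simp
      gcongr
    rw [← ofReal_norm, ← ofReal_norm (u x - w x), ← ofReal_norm (a - b),
      ← ofReal_norm (w x), ← ENNReal.ofReal_mul (by positivity),
      ← ENNReal.ofReal_mul (by positivity), ← ENNReal.ofReal_mul (by positivity),
      ← ENNReal.ofReal_add (by positivity) (by positivity)]
    exact ENNReal.ofReal_le_ofReal hreal
  calc ∫⁻ x, ρ x * ‖u x / a - w x / b‖ₑ ∂m
      ≤ ∫⁻ x, (ENNReal.ofReal (2 / c) * (ρ x * ‖u x - w x‖ₑ) +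
          (ENNReal.ofReal (2 / c ^ 2) * ‖a - b‖ₑ) * (ρ x * ‖w x‖ₑ)) ∂m := by
        refine lintegral_mono fun x => ?_
        refine (mul_le_mul_right (key x) (ρ x)).trans (le_of_eq ?_)
        ring
    _ = ENNReal.ofReal (2 / c) * D +
          (ENNReal.ofReal (2 / c ^ 2) * ‖a - b‖ₑ) * ∫⁻ x, ρ x * ‖w x‖ₑ ∂m := by
        rw [lintegral_add_left, lintegral_const_mul, lintegral_const_mul]
        · exact hρm.mul hw.enorm
        · exact hρm.mul (hu.sub hw).enorm
        · exact (hρm.mul (hu.sub hw).enorm).const_mul _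
    _ ≤ ENNReal.ofReal (2 / c) * D + (ENNReal.ofReal (2 / c ^ 2) * D) * C := by gcongr
    _ = _ := by ring

theorem tendsto_lintegral_mul_enorm_div_integral_sub {ρ : α → ℝ≥0∞} {u w : ℕ → α → ℝ} {c : ℝ}
    {C : ℝ≥0∞} (hρm : Measurable ρ)
    (hρ : ∀ x, 1 ≤ ρ x) (hu : ∀ n, Measurable (u n)) (hw : ∀ n, Measurable (w n))
    (hwi : ∀ n, Integrable (w n) m) (hc : 0 < c)
    (hcw : ∀ n, c ≤ ∫ x, w n x ∂m) (hC : ∀ n, ∫⁻ x, ρ x * ‖w n x‖ₑ ∂m ≤ C) (hCt : C ≠ ∞)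
    (hD : Tendsto (fun n => ∫⁻ x, ρ x * ‖u n x - w n x‖ₑ ∂m) atTop (𝓝 0)) :
    Tendsto (fun n => ∫⁻ x, ρ x * ‖u n x / (∫ x, u n x ∂m) - w n x / (∫ x, w n x ∂m)‖ₑ ∂m)
      atTop (𝓝 0) := by
  have h : Tendsto (fun n => (ENNReal.ofReal (2 / c) + ENNReal.ofReal (2 / c ^ 2) * C) *
        ∫⁻ x, ρ x * ‖u n x - w n x‖ₑ ∂m) atTop (𝓝 0) := by
    have := ENNReal.Tendsto.const_mul (a := ENNReal.ofReal (2 / c) + ENNReal.ofReal (2 / c ^ 2) * C)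
      hD (Or.inr (by finiteness))
    simpa using this
  refine tendsto_of_tendsto_of_tendsto_of_le_of_le' tendsto_const_nhds h
    (Eventually.of_forall fun n => zero_le) ?_
  filter_upwards [hD.eventually_le_const (u := ENNReal.ofReal (c / 2)) (by simpa using hc)]
    with n hn
  exact lintegral_mul_enorm_div_integral_sub_le hρm hρ (hu n) (hw n) (hwi n) hc (hcw n)
    (hC n) hn

theorem lintegral_enorm_div_integral_le_one {g : α → ℝ} (hg0 : 0 ≤ g) :
    ∫⁻ x, ‖g x / ∫ x, g x ∂m‖ₑ ∂m ≤ 1 := by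
  -- A zero integral, which is also the default value for a non-integrable `g`, makes every quotient
  -- zero. This is why the bound is `≤ 1` and integrability is not assumed.
  by_cases h0 : ∫ x, g x ∂m = 0
  · simp [h0]
  have hgi : Integrable g m := by
    by_contra h; exact h0 (integral_undef h)
  have hpos : 0 < ∫ x, g x ∂m := lt_of_le_of_ne (integral_nonneg hg0) (Ne.symm h0)
  rw [← ofReal_integral_norm_eq_lintegral_enorm (hgi.div_const _)]
  have : (fun x => ‖g x / ∫ x, g x ∂m‖) = fun x => g x / ∫ x, g x ∂m := by
    ext x; exact Real.norm_of_nonneg (div_nonneg (hg0 x) hpos.le)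
  rw [this, integral_div, div_self h0]; simp

end L1

/-! ### Affine changes of variables -/

section Affine

variable {ι : Type*} [Fintype ι]

theorem lintegral_comp_add_inv_smul (g : EuclideanSpace ℝ ι → ℝ≥0∞) (c : EuclideanSpace ℝ ι)
    {s : ℝ} (hs : 0 < s) :
    ∫⁻ t, g (c + s⁻¹ • t) = ENNReal.ofReal (s ^ Fintype.card ι) * ∫⁻ z, g z := by
  have h1 : ∫⁻ z, g z = ∫⁻ z, g (c + z) := (lintegral_add_left_eq_self _ c).symm
  rw [h1]
  let e : EuclideanSpace ℝ ι ≃ᵐ EuclideanSpace ℝ ι :=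
    (Homeomorph.smul (isUnit_iff_ne_zero.2 (inv_ne_zero hs.ne')).unit).toMeasurableEquiv
  have he : ∀ t, e t = s⁻¹ • t := fun t => rfl
  have := lintegral_map_equiv (μ := (volume : Measure (EuclideanSpace ℝ ι)))
    (fun z => g (c + z)) e
  have hmap : Measure.map (e : EuclideanSpace ℝ ι → EuclideanSpace ℝ ι) volume =
      ENNReal.ofReal (s ^ Fintype.card ι) • volume := by
    have h := Measure.map_addHaar_smul (volume : Measure (EuclideanSpace ℝ ι))
      (inv_ne_zero hs.ne')
    rw [show (e : EuclideanSpace ℝ ι → EuclideanSpace ℝ ι) = fun t => s⁻¹ • t from rfl, h]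
    simp [abs_of_pos hs]
  rw [hmap, lintegral_smul_measure] at this
  simp only [he] at this
  rw [← this, smul_eq_mul]

theorem integral_comp_add_inv_smul {F : Type*} [NormedAddCommGroup F] [NormedSpace ℝ F]
    (g : EuclideanSpace ℝ ι → F) (c : EuclideanSpace ℝ ι) {s : ℝ} (hs : 0 < s) :
    ∫ t, g (c + s⁻¹ • t) = s ^ Fintype.card ι • ∫ z, g z := by
  have h := Measure.integral_comp_inv_smul_of_nonneg
    (volume : Measure (EuclideanSpace ℝ ι)) (fun z => g (c + z)) hs.le
  rw [h, finrank_euclideanSpace, integral_add_left_eq_self]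

end Affine

/-! ### Gaussian kernels -/

section Gaussian

variable {ι κ : Type*} [Fintype ι] [Fintype κ]

/-- The quadratic form of the matrix `S`. -/
def quadForm (S : Matrix ι ι ℝ) (h : EuclideanSpace ℝ ι) : ℝ :=
  dotProduct h.ofLp (S.mulVec h.ofLp)

/-- The unnormalized Gaussian density with precision matrix `S`. -/
def gaussianKernel (S : Matrix ι ι ℝ) (h : EuclideanSpace ℝ ι) : ℝ :=
  Real.exp (-(quadForm S h / 2))

theorem continuous_quadForm (S : Matrix ι ι ℝ) : Continuous (quadForm S) := by
  unfold quadForm dotProduct Matrix.mulVec dotProduct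
  fun_prop

theorem continuous_gaussianKernel (S : Matrix ι ι ℝ) : Continuous (gaussianKernel S) := by
  have := continuous_quadForm S
  unfold gaussianKernel
  fun_prop

theorem gaussianKernel_pos (S : Matrix ι ι ℝ) (h : EuclideanSpace ℝ ι) : 0 < gaussianKernel S h :=
  Real.exp_pos _

theorem quadForm_neg (S : Matrix ι ι ℝ) (h : EuclideanSpace ℝ ι) :
    quadForm S (-h) = quadForm S h := by
  simp [quadForm, Matrix.mulVec_neg]

theorem quadForm_smul (S : Matrix ι ι ℝ) (a : ℝ) (h : EuclideanSpace ℝ ι) :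
    quadForm S (a • h) = a ^ 2 * quadForm S h := by
  simp [quadForm, Matrix.mulVec_smul]; ring

theorem gaussianKernel_neg (S : Matrix ι ι ℝ) (h : EuclideanSpace ℝ ι) :
    gaussianKernel S (-h) = gaussianKernel S h := by
  simp [gaussianKernel, quadForm_neg]

theorem integrable_exp_neg_mul_sq_norm {c : ℝ} (hc : 0 < c) :
    Integrable (fun h : EuclideanSpace ℝ ι => Real.exp (-c * ‖h‖ ^ 2)) := by
  apply Integrable.of_integral_ne_zero
  rw [GaussianFourier.integral_rexp_neg_mul_sq_norm hc]
  positivity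

variable [DecidableEq ι]

theorem tileMean_add (J : Matrix (ι ⊕ κ) (ι ⊕ κ) ℝ) (r r' : EuclideanSpace ℝ κ) :
    tileMean J (r + r') = tileMean J r + tileMean J r' := by
  ext i; simp [tileMean, Matrix.mulVec_add, add_comm]

theorem continuous_tileMean (J : Matrix (ι ⊕ κ) (ι ⊕ κ) ℝ) : Continuous (tileMean J) := by
  unfold tileMean Matrix.mulVec dotProduct
  fun_prop

variable [DecidableEq κ]

-- A factorization `S = Bᵀ B` reduces coercivity and Gaussian integrals to the Euclidean norm.
open scoped MatrixOrder ComplexOrder in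
theorem exists_linearMap_quadForm_eq {S : Matrix ι ι ℝ} (hS : S.PosDef) :
    ∃ B : Matrix ι ι ℝ, B.det ^ 2 = S.det ∧
      ∀ h, quadForm S h = ‖B.toEuclideanLin h‖ ^ 2 := by
  obtain ⟨B, rfl⟩ := CStarAlgebra.nonneg_iff_eq_star_mul_self.mp hS.posSemidef.nonneg
  refine ⟨B, ?_, fun h => ?_⟩
  · rw [Matrix.det_mul, Matrix.star_eq_conjTranspose, Matrix.det_conjTranspose]
    simp [sq]
  · rw [EuclideanSpace.norm_sq_eq]
    simp only [quadForm, ← Matrix.mulVec_mulVec, Matrix.star_eq_conjTranspose]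
    rw [Matrix.dotProduct_mulVec, Matrix.vecMul_conjTranspose]
    simp [dotProduct, sq, Matrix.toLpLin_apply]

theorem exists_pos_mul_sq_norm_le_quadForm {S : Matrix ι ι ℝ} (hS : S.PosDef) :
    ∃ c > 0, ∀ h, c * ‖h‖ ^ 2 ≤ quadForm S h := by
  obtain ⟨B, hB, hq⟩ := exists_linearMap_quadForm_eq hS
  have hdet : B.det ≠ 0 := by
    intro h0
    have := hS.det_pos
    rw [← hB, h0] at this
    simp at this
  let T := (B⁻¹.toEuclideanLin).toContinuousLinearMap
  -- The `+ 1` covers the empty index type, where `T = 0`.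
  refine ⟨(‖T‖ ^ 2 + 1)⁻¹, by positivity, fun h => ?_⟩
  have h1 : T (B.toEuclideanLin h) = h := by
    simp [T, Matrix.toLpLin_apply, Matrix.mulVec_mulVec,
      Matrix.nonsing_inv_mul B (isUnit_iff_ne_zero.2 hdet)]
  have h2 : ‖h‖ ≤ ‖T‖ * ‖B.toEuclideanLin h‖ := by
    conv_lhs => rw [← h1]
    exact T.le_opNorm _
  rw [hq, inv_mul_le_iff₀ (by positivity)]
  calc ‖h‖ ^ 2 ≤ (‖T‖ * ‖B.toEuclideanLin h‖) ^ 2 := by gcongr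
    _ ≤ _ := by nlinarith [sq_nonneg ‖B.toEuclideanLin h‖]

theorem integral_gaussianKernel {S : Matrix ι ι ℝ} (hS : S.PosDef) :
    ∫ h, gaussianKernel S h = Real.sqrt ((2 * Real.pi) ^ Fintype.card ι / S.det) := by
  obtain ⟨B, hB, hq⟩ := exists_linearMap_quadForm_eq hS
  have hSd := hS.det_pos
  have hdet : B.det ≠ 0 := by
    intro h0
    rw [← hB, h0] at hSd
    simp at hSd
  have hdet' : LinearMap.det (B.toEuclideanLin : EuclideanSpace ℝ ι →ₗ[ℝ] _) ≠ 0 := by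
    rwa [LinearMap.det_toLpLin]
  have hmap := Measure.map_linearMap_addHaar_eq_smul_addHaar
    (volume : Measure (EuclideanSpace ℝ ι)) hdet'
  have hemb : MeasurableEmbedding (B.toEuclideanLin : EuclideanSpace ℝ ι → _) :=
    ((B.toEuclideanLin).equivOfDetNeZero
      hdet').toContinuousLinearEquiv.toHomeomorph.measurableEmbedding
  have h1 := hemb.integral_map (μ := volume)
    (fun h : EuclideanSpace ℝ ι => Real.exp (-(1 / 2) * ‖h‖ ^ 2))
  rw [hmap, integral_smul_measure,
    GaussianFourier.integral_rexp_neg_mul_sq_norm (by norm_num)] at h1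
  have h2 : ∀ h, gaussianKernel S h = Real.exp (-(1 / 2) * ‖B.toEuclideanLin h‖ ^ 2) := by
    intro h; rw [gaussianKernel, hq]; congr 1; ring
  simp only [h2]
  rw [← h1, LinearMap.det_toLpLin, ENNReal.toReal_ofReal (abs_nonneg _), ← hB, Real.sqrt_div
    (by positivity), Real.sqrt_sq_eq_abs, finrank_euclideanSpace, abs_inv, smul_eq_mul,
    Real.sqrt_eq_rpow, ← Real.rpow_natCast, ← Real.rpow_mul (by positivity)]
  rw [show Real.pi / (1 / 2) = 2 * Real.pi by ring, div_eq_inv_mul]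
  ring_nf

theorem integrable_gaussianKernel {S : Matrix ι ι ℝ} (hS : S.PosDef) :
    Integrable (gaussianKernel S) := by
  apply Integrable.of_integral_ne_zero
  rw [integral_gaussianKernel hS]
  have := hS.det_pos
  positivity

theorem integral_gaussianKernel_pos {S : Matrix ι ι ℝ} (hS : S.PosDef) :
    0 < ∫ h, gaussianKernel S h := by
  rw [integral_gaussianKernel hS]
  have := hS.det_pos
  positivity

/-- Posteriors have the shape `u / ∫ u`. Writing the limit in the same shape lets unnormalized
functions be compared and spares the asymptotics any determinant. -/
theorem gaussianDensity_inv_eq {S : Matrix ι ι ℝ} (hS : S.PosDef) (m x : EuclideanSpace ℝ ι) :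
    gaussianDensity m S⁻¹ x = gaussianKernel S (x - m) / ∫ h, gaussianKernel S h := by
  rw [gaussianDensity, integral_gaussianKernel hS, Matrix.nonsing_inv_nonsing_inv _
    (isUnit_iff_ne_zero.2 hS.det_pos.ne'), Matrix.det_smul, Matrix.det_nonsing_inv,
    Ring.inverse_eq_inv', ← div_eq_mul_inv, mul_comm, ← div_eq_mul_inv]
  rfl

theorem integral_gaussianKernel_sub (S : Matrix ι ι ℝ) (m : EuclideanSpace ℝ ι) :
    ∫ h, gaussianKernel S (h - m) = ∫ h, gaussianKernel S h :=
  integral_sub_right_eq_self _ _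

/-- The integrand is odd. -/
theorem integral_gaussianKernel_smul_self (S : Matrix ι ι ℝ) :
    ∫ h, gaussianKernel S h • h = 0 := by
  have h := integral_neg_eq_self (fun h => gaussianKernel S h • h)
    (volume : Measure (EuclideanSpace ℝ ι))
  simp only [gaussianKernel_neg, smul_neg, integral_neg] at h
  have h2 : (2 : ℝ) • ∫ h, gaussianKernel S h • h = 0 := by
    rw [two_smul]
    nth_rw 1 [← h]
    exact neg_add_cancel _
  simpa using h2

theorem posDef_toBlocks₁₁ {J : Matrix (ι ⊕ κ) (ι ⊕ κ) ℝ} (hJ : J.PosDef) :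
    J.toBlocks₁₁.PosDef := by
  have := hJ.submatrix (e := Sum.inl) Sum.inl_injective
  exact this

theorem toBlocks₂₁_eq {J : Matrix (ι ⊕ κ) (ι ⊕ κ) ℝ} (hJ : J.IsHermitian) :
    J.toBlocks₂₁ = J.toBlocks₁₂.conjTranspose := by
  ext i j
  have := hJ.apply (Sum.inr i) (Sum.inl j)
  simpa [Matrix.toBlocks₂₁, Matrix.toBlocks₁₂] using this.symm

/-- Completing the square in the first block. -/
theorem quadForm_join {J : Matrix (ι ⊕ κ) (ι ⊕ κ) ℝ} (hJ : J.PosDef)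
    (t : EuclideanSpace ℝ ι) (r : EuclideanSpace ℝ κ) :
    quadForm J (join t r) = quadForm J.toBlocks₁₁ (t - tileMean J r) +
      quadForm (J.toBlocks₂₂ - J.toBlocks₂₁ * J.toBlocks₁₁⁻¹ * J.toBlocks₁₂) r := by
  have h11 := posDef_toBlocks₁₁ hJ
  let := h11.isUnit.invertible
  have h := Matrix.schur_complement_eq₁₁ J.toBlocks₁₂ J.toBlocks₂₂ t.ofLp r.ofLp
    h11.isHermitian
  rw [← toBlocks₂₁_eq hJ.isHermitian, Matrix.fromBlocks_toBlocks] at h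
  have h2 : (t - tileMean J r).ofLp = t.ofLp + (J.toBlocks₁₁⁻¹ * J.toBlocks₁₂).mulVec r.ofLp := by
    simp [tileMean]
  have h3 : (join t r).ofLp = Sum.elim t.ofLp r.ofLp := rfl
  simp only [quadForm, h2, h3, Matrix.dotProduct_mulVec]
  simpa only [star_trivial] using h

/-- For fixed `r` the second factor does not involve `t`, so it cancels when the slice is
normalized. -/
theorem gaussianKernel_join {J : Matrix (ι ⊕ κ) (ι ⊕ κ) ℝ} (hJ : J.PosDef)
    (t : EuclideanSpace ℝ ι) (r : EuclideanSpace ℝ κ) :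
    gaussianKernel J (join t r) = gaussianKernel J.toBlocks₁₁ (t - tileMean J r) *
      gaussianKernel (J.toBlocks₂₂ - J.toBlocks₂₁ * J.toBlocks₁₁⁻¹ * J.toBlocks₁₂) r := by
  rw [gaussianKernel, quadForm_join hJ, gaussianKernel, gaussianKernel, ← Real.exp_add]
  congr 1; ring

/-- The form `A K⁻¹ Aᵀ` with `A = J₁₁⁻¹ J₁₂` exhibits positivity and is the covariance of `A u` when
`u` has covariance `K⁻¹`. -/
theorem covInflation_eq {J : Matrix (ι ⊕ κ) (ι ⊕ κ) ℝ} (hJ : J.PosDef) (K : Matrix κ κ ℝ) :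
    covInflation J K = (J.toBlocks₁₁⁻¹ * J.toBlocks₁₂) * K⁻¹ *
      (J.toBlocks₁₁⁻¹ * J.toBlocks₁₂).conjTranspose := by
  rw [covInflation, toBlocks₂₁_eq hJ.isHermitian, Matrix.conjTranspose_mul,
    Matrix.conjTranspose_nonsing_inv, (posDef_toBlocks₁₁ hJ).isHermitian.eq, ← Matrix.mul_assoc]

theorem posSemidef_covInflation {J : Matrix (ι ⊕ κ) (ι ⊕ κ) ℝ} (hJ : J.PosDef)
    {K : Matrix κ κ ℝ} (hK : K.PosDef) : (covInflation J K).PosSemidef := by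
  rw [covInflation_eq hJ]
  exact hK.inv.posSemidef.mul_mul_conjTranspose_same _

/-- Integrating a Gaussian regression kernel against a Gaussian kernel. -/
theorem integral_gaussianKernel_add_mulVec_mul {B : Matrix ι ι ℝ} (hB : B.PosDef)
    {K : Matrix κ κ ℝ} (hK : K.PosDef) (A : Matrix ι κ ℝ) (s : EuclideanSpace ℝ ι) :
    ((B⁻¹ + A * K⁻¹ * A.conjTranspose)⁻¹).PosDef ∧
    (∫ u : EuclideanSpace ℝ κ, gaussianKernel B (s + WithLp.toLp 2 (A.mulVec u.ofLp)) *
        gaussianKernel K u) / ((∫ h, gaussianKernel B h) * ∫ h, gaussianKernel K h) =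
      gaussianKernel (B⁻¹ + A * K⁻¹ * A.conjTranspose)⁻¹ s /
        ∫ h, gaussianKernel (B⁻¹ + A * K⁻¹ * A.conjTranspose)⁻¹ h := by
  set V := B⁻¹ + A * K⁻¹ * A.conjTranspose with hV
  have hVp : V.PosDef := hB.inv.add_posSemidef (hK.inv.posSemidef.mul_mul_conjTranspose_same _)
  -- `M` is the precision of `u` given `s`; the Woodbury identity rewrites `V⁻¹` in terms of it.
  set M := K + A.conjTranspose * B * A with hM
  have hMp : M.PosDef := hK.add_posSemidef (hB.posSemidef.conjTranspose_mul_mul_same _)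
  have hKi : K⁻¹⁻¹ = K := Matrix.nonsing_inv_nonsing_inv _ (isUnit_iff_ne_zero.2 hK.det_pos.ne')
  have hBi : B⁻¹⁻¹ = B := Matrix.nonsing_inv_nonsing_inv _ (isUnit_iff_ne_zero.2 hB.det_pos.ne')
  have hwood : V⁻¹ = B - (B * A) * M⁻¹ * (B * A).conjTranspose := by
    have := Matrix.add_mul_mul_inv_eq_sub B⁻¹ A K⁻¹ A.conjTranspose hB.inv.isUnit hK.inv.isUnit
      (by rw [hKi, hBi]; exact hMp.isUnit)
    rw [hV, this, hKi, hBi, Matrix.conjTranspose_mul, hB.isHermitian.eq]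
    simp only [Matrix.mul_assoc, hM]
  refine ⟨hVp.inv, ?_⟩
  let iB := hB.isUnit.invertible
  let iM := hMp.isUnit.invertible
  -- `N` is the joint precision of `s` and `u`. Its Schur complements are `K` (eliminating `B`) and
  -- `V⁻¹` (eliminating `M`). Evaluating determinant and quadratic form both ways matches the
  -- normalizing constants and the exponents.
  set N := Matrix.fromBlocks B (B * A) (B * A).conjTranspose M with hN
  have hS1 : M - (B * A).conjTranspose * B⁻¹ * (B * A) = K := by
    have : (B * A).conjTranspose * B⁻¹ * (B * A) = A.conjTranspose * B * A := by
      rw [Matrix.conjTranspose_mul, hB.isHermitian.eq, Matrix.mul_assoc, Matrix.mul_assoc,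
        ← Matrix.mul_assoc B⁻¹, Matrix.nonsing_inv_mul _ (isUnit_iff_ne_zero.2 hB.det_pos.ne'),
        Matrix.one_mul, ← Matrix.mul_assoc]
    rw [this, hM]; abel
  have hBA : B⁻¹ * (B * A) = A := by
    rw [← Matrix.mul_assoc, Matrix.nonsing_inv_mul _ (isUnit_iff_ne_zero.2 hB.det_pos.ne'),
        Matrix.one_mul]
  have hdet : B.det * K.det = M.det * (V⁻¹).det := by
    have h1 := Matrix.det_fromBlocks₁₁ B (B * A) (B * A).conjTranspose M
    have h2 := Matrix.det_fromBlocks₂₂ B (B * A) (B * A).conjTranspose M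
    rw [Matrix.invOf_eq_nonsing_inv, hS1] at h1
    rw [Matrix.invOf_eq_nonsing_inv, ← hwood] at h2
    rw [← h1, ← h2]
  have hprod : ∀ u : EuclideanSpace ℝ κ,
      gaussianKernel B (s + WithLp.toLp 2 (A.mulVec u.ofLp)) * gaussianKernel K u =
      gaussianKernel V⁻¹ s *
        gaussianKernel M (u - WithLp.toLp 2 (-(M⁻¹ * (B * A).conjTranspose).mulVec s.ofLp)) := by
    intro u
    have h1 := Matrix.schur_complement_eq₁₁ (B * A) M s.ofLp u.ofLp hB.isHermitian
    have h2 := Matrix.schur_complement_eq₂₂ B (B * A) s.ofLp u.ofLp hMp.isHermitian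
    rw [hS1, hBA] at h1
    rw [← hwood] at h2
    have h3 := h1.symm.trans h2
    simp only [gaussianKernel, ← Real.exp_add]
    congr 1
    simp only [quadForm, Matrix.dotProduct_mulVec]
    have h4 : (u - WithLp.toLp 2 (-(M⁻¹ * (B * A).conjTranspose).mulVec s.ofLp)).ofLp =
      (M⁻¹ * (B * A).conjTranspose).mulVec s.ofLp + u.ofLp := by
      simp [add_comm]
    rw [h4]
    simp only [star_trivial] at h3
    simp only [WithLp.ofLp_add]
    linarith
  simp only [hprod]
  rw [integral_const_mul, integral_gaussianKernel_sub, integral_gaussianKernel hMp,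
    integral_gaussianKernel hB, integral_gaussianKernel hK, integral_gaussianKernel hVp.inv]
  have hd1 := hB.det_pos
  have hd2 := hK.det_pos
  have hd3 := hMp.det_pos
  have hd4 := hVp.inv.det_pos
  rw [mul_div_assoc, div_eq_mul_inv (gaussianKernel _ _) (√_)]
  congr 1
  rw [div_eq_iff (by positivity), inv_mul_eq_div, eq_div_iff (by positivity),
    ← Real.sqrt_mul (by positivity), ← Real.sqrt_mul (by positivity)]
  congr 1
  rw [div_mul_div_comm, div_mul_div_comm, hdet]
  ring

/-- A Gaussian mixture of Gaussian regression densities is Gaussian. -/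
theorem integral_gaussianDensity_tileMean_mul {J : Matrix (ι ⊕ κ) (ι ⊕ κ) ℝ} (hJ : J.PosDef)
    {K : Matrix κ κ ℝ} (hK : K.PosDef) (μ : EuclideanSpace ℝ κ) (t : EuclideanSpace ℝ ι) :
    ∫ r, gaussianDensity (tileMean J r) J.toBlocks₁₁⁻¹ t * gaussianDensity μ K⁻¹ r =
      gaussianDensity (tileMean J μ) (J.toBlocks₁₁⁻¹ + covInflation J K) t := by
  have hB := posDef_toBlocks₁₁ hJ
  obtain ⟨hp, h⟩ := integral_gaussianKernel_add_mulVec_mul hB hK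
    (J.toBlocks₁₁⁻¹ * J.toBlocks₁₂) (t - tileMean J μ)
  rw [← covInflation_eq hJ] at hp h
  have hV := Matrix.PosDef.inv hp
  have hd : IsUnit (J.toBlocks₁₁⁻¹ + covInflation J K).det := isUnit_iff_ne_zero.2
    (hB.inv.add_posSemidef (posSemidef_covInflation hJ hK)).det_pos.ne'
  have h1 := gaussianDensity_inv_eq hp (tileMean J μ) t
  rw [Matrix.nonsing_inv_nonsing_inv _ hd, ← h] at h1
  rw [h1, ← integral_add_right_eq_self _ μ, ← integral_div]
  congr 1
  ext u
  rw [gaussianDensity_inv_eq hB, gaussianDensity_inv_eq hK, tileMean_add, add_sub_cancel_right,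
    div_mul_div_comm]
  congr 3
  ext i
  simp [tileMean]
  ring

end Gaussian

/-! ### Taylor expansion of the log-likelihood -/

section Taylor

variable {ι : Type*} [Fintype ι] [DecidableEq ι]

theorem fderiv_apply_eq_sum_pderiv (G : EuclideanSpace ℝ ι → ℝ) (z h : EuclideanSpace ℝ ι) :
    fderiv ℝ G z h = ∑ i, h i * pderiv i G z := by
  have hh : h = ∑ i, h i • EuclideanSpace.single i (1 : ℝ) := by
    ext j
    simp [Finset.sum_apply, Pi.single_apply]
  conv_lhs => rw [hh]
  simp [pderiv]

theorem hasDerivAt_comp_line {G : EuclideanSpace ℝ ι → ℝ} {z h : EuclideanSpace ℝ ι} {s : ℝ}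
    (hG : DifferentiableAt ℝ G (z + s • h)) :
    HasDerivAt (fun s : ℝ => G (z + s • h)) (∑ i, h i * pderiv i G (z + s • h)) s := by
  rw [← fderiv_apply_eq_sum_pderiv]
  have h1 : HasDerivAt (fun s : ℝ => z + s • h) h s := by
    simpa using ((hasDerivAt_id s).smul_const h).const_add z
  exact hG.hasFDerivAt.comp_hasDerivAt s h1

theorem add_smul_sub_mem_ball {z₀ z z' : EuclideanSpace ℝ ι} {δ s : ℝ}
    (hz : z ∈ Metric.ball z₀ δ) (hz' : z' ∈ Metric.ball z₀ δ) (hs : s ∈ Set.Icc (0 : ℝ) 1) :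
    z' + s • (z - z') ∈ Metric.ball z₀ δ :=
  (convex_ball z₀ δ).add_smul_sub_mem hz' hz hs

theorem abs_apply_le_norm (h : EuclideanSpace ℝ ι) (i : ι) : |h i| ≤ ‖h‖ := by
  simpa using PiLp.norm_apply_le h i

theorem abs_sub_le_of_abs_pderiv_le {G : EuclideanSpace ℝ ι → ℝ} {z₀ z z' : EuclideanSpace ℝ ι}
    {δ : ℝ} {M : ι → ℝ} (hG : ∀ w ∈ Metric.ball z₀ δ, DifferentiableAt ℝ G w)
    (hM : ∀ i, ∀ w ∈ Metric.ball z₀ δ, |pderiv i G w| ≤ M i)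
    (hz : z ∈ Metric.ball z₀ δ) (hz' : z' ∈ Metric.ball z₀ δ) :
    |G z - G z'| ≤ ‖z - z'‖ * ∑ i, M i := by
  have h := norm_image_sub_le_of_norm_deriv_le_segment_01'
    (f := fun s : ℝ => G (z' + s • (z - z'))) (C := ‖z - z'‖ * ∑ i, M i)
    (fun s hs => (hasDerivAt_comp_line
      (hG _ (add_smul_sub_mem_ball hz hz' hs))).hasDerivWithinAt)
    (fun s hs => by
      have hw := add_smul_sub_mem_ball hz hz' ⟨hs.1, hs.2.le⟩
      rw [Finset.mul_sum]
      refine (norm_sum_le _ _).trans (Finset.sum_le_sum fun i _ => ?_)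
      rw [norm_mul]
      exact mul_le_mul (abs_apply_le_norm _ i) (hM i _ hw) (norm_nonneg _) (norm_nonneg _))
  simpa using h

namespace ThriceDifferentiableOn

variable {g : EuclideanSpace ℝ ι → ℝ} {z₀ : EuclideanSpace ℝ ι} {δ : ℝ}

theorem differentiableAt (hg : ThriceDifferentiableOn g (Metric.ball z₀ δ))
    {w : EuclideanSpace ℝ ι} (hw : w ∈ Metric.ball z₀ δ) : DifferentiableAt ℝ g w :=
  hg.1.differentiableAt (Metric.isOpen_ball.mem_nhds hw)

theorem differentiableAt_pderiv (hg : ThriceDifferentiableOn g (Metric.ball z₀ δ))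
    {w : EuclideanSpace ℝ ι} (hw : w ∈ Metric.ball z₀ δ) (i : ι) :
    DifferentiableAt ℝ (pderiv i g) w := by
  have := hg.2.1.differentiableAt (Metric.isOpen_ball.mem_nhds hw)
  exact this.clm_apply (differentiableAt_const _)

theorem differentiableAt_pderiv_pderiv (hg : ThriceDifferentiableOn g (Metric.ball z₀ δ))
    {w : EuclideanSpace ℝ ι} (hw : w ∈ Metric.ball z₀ δ) (i j : ι) :
    DifferentiableAt ℝ (pderiv i (pderiv j g)) w := by
  have h1 := hg.2.2.differentiableAt (Metric.isOpen_ball.mem_nhds hw)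
  have h2 : DifferentiableAt ℝ (fun v => fderiv ℝ (fderiv ℝ g) v (EuclideanSpace.single i 1)
      (EuclideanSpace.single j 1)) w :=
    (h1.clm_apply (differentiableAt_const _)).clm_apply (differentiableAt_const _)
  -- Near `w` the iterated partial derivative is an entry of the second Fréchet derivative, whose
  -- differentiability is assumed.
  refine h2.congr_of_eventuallyEq ?_
  filter_upwards [Metric.isOpen_ball.mem_nhds hw] with v hv
  have h3 := hg.2.1.differentiableAt (Metric.isOpen_ball.mem_nhds hv)
  have h4 := h3.hasFDerivAt.clm_apply
    (hasFDerivAt_const (EuclideanSpace.single j (1 : ℝ)) v)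
  change fderiv ℝ (fun z => fderiv ℝ g z (EuclideanSpace.single j 1)) v _ = _
  rw [h4.fderiv]
  simp

/-- Second order Taylor expansion with the Hessian taken at the centre of the ball. -/
theorem abs_taylor_le (hg : ThriceDifferentiableOn g (Metric.ball z₀ δ)) {M : ι → ι → ι → ℝ}
    (hM : ∀ i j k, ∀ w ∈ Metric.ball z₀ δ, |pderiv i (pderiv j (pderiv k g)) w| ≤ M i j k)
    {z z' : EuclideanSpace ℝ ι} (hz : z ∈ Metric.ball z₀ δ) (hz' : z' ∈ Metric.ball z₀ δ) :
    |g z - g z' - ∑ k, (z - z') k * pderiv k g z' -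
      (∑ k, (z - z') k * ∑ j, (z - z') j * pderiv j (pderiv k g) z₀) / 2| ≤
      ‖z - z'‖ ^ 2 * (‖z - z'‖ + ‖z' - z₀‖) * ∑ k, ∑ j, ∑ i, M i j k := by
  set h := z - z' with hh
  have hz₀ : z₀ ∈ Metric.ball z₀ δ := Metric.mem_ball_self
    ((dist_nonneg).trans_lt (Metric.mem_ball.1 hz))
  set H := ∑ k, h k * ∑ j, h j * pderiv j (pderiv k g) z₀ with hH
  set C := ‖h‖ ^ 2 * (‖h‖ + ‖z' - z₀‖) * ∑ k, ∑ j, ∑ i, M i j k with hC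
  have hmem : ∀ s ∈ Set.Icc (0 : ℝ) 1, z' + s • h ∈ Metric.ball z₀ δ := fun s hs =>
    add_smul_sub_mem_ball hz hz' hs
  -- The Hessian is frozen at `z₀` rather than at the base point `z'`, since that is where the
  -- strong law controls its average. The price is the extra distance `‖z' - z₀‖`.
  have hpd2 : ∀ s ∈ Set.Icc (0 : ℝ) 1, ∀ j k,
      |pderiv j (pderiv k g) (z' + s • h) - pderiv j (pderiv k g) z₀| ≤
        (‖h‖ + ‖z' - z₀‖) * ∑ i, M i j k := by
    intro s hs j k
    have h1 := abs_sub_le_of_abs_pderiv_le (M := fun i => M i j k)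
      (fun w hw => hg.differentiableAt_pderiv_pderiv hw j k) (fun i w hw => hM i j k w hw)
      (hmem s hs) hz₀
    refine h1.trans ?_
    have h0 : 0 ≤ ∑ i, M i j k :=
      Finset.sum_nonneg fun i _ => (abs_nonneg _).trans (hM i j k z₀ hz₀)
    gcongr
    calc ‖z' + s • h - z₀‖ = ‖s • h + (z' - z₀)‖ := by congr 1; abel
      _ ≤ ‖s • h‖ + ‖z' - z₀‖ := norm_add_le _ _
      _ ≤ ‖h‖ + ‖z' - z₀‖ := by
        rw [norm_smul, Real.norm_of_nonneg hs.1]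
        gcongr
        exact mul_le_of_le_one_left (norm_nonneg _) hs.2
  have hφ2 : ∀ s ∈ Set.Icc (0 : ℝ) 1,
      |∑ k, h k * ∑ j, h j * pderiv j (pderiv k g) (z' + s • h) - H| ≤ C := by
    intro s hs
    have : ∑ k, h k * ∑ j, h j * pderiv j (pderiv k g) (z' + s • h) - H =
        ∑ k, ∑ j, h k * h j *
          (pderiv j (pderiv k g) (z' + s • h) - pderiv j (pderiv k g) z₀) := by
      rw [hH, ← Finset.sum_sub_distrib]
      refine Finset.sum_congr rfl fun k _ => ?_
      rw [← mul_sub, ← Finset.sum_sub_distrib, Finset.mul_sum]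
      exact Finset.sum_congr rfl fun j _ => by ring
    rw [this, hC, Finset.mul_sum]
    refine (Finset.abs_sum_le_sum_abs _ _).trans (Finset.sum_le_sum fun k _ => ?_)
    rw [Finset.mul_sum]
    refine (Finset.abs_sum_le_sum_abs _ _).trans (Finset.sum_le_sum fun j _ => ?_)
    rw [abs_mul, abs_mul, mul_assoc, sq, mul_assoc, mul_assoc]
    have a1 := abs_apply_le_norm h k
    have a2 := abs_apply_le_norm h j
    have a3 := hpd2 s hs j k
    gcongr
  -- Two applications of the mean value inequality on the segment recover first the derivative and
  -- then the function from the bound on the second derivative. The numerical factors of Taylor's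
  -- formula are given away.
  have hφ1 : ∀ s ∈ Set.Icc (0 : ℝ) 1,
      |∑ k, h k * pderiv k g (z' + s • h) - ∑ k, h k * pderiv k g z' - s * H| ≤ C := by
    intro s hs
    have hC0 : 0 ≤ C := (abs_nonneg _).trans (hφ2 0 (by simp))
    have := norm_image_sub_le_of_norm_deriv_le_segment'
      (f := fun s : ℝ => ∑ k, h k * pderiv k g (z' + s • h) - s * H) (a := 0) (b := 1) (C := C)
      (f' := fun s => ∑ k, h k * ∑ j, h j * pderiv j (pderiv k g) (z' + s • h) - H)
      (fun s hs => by
        refine HasDerivAt.hasDerivWithinAt ?_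
        refine HasDerivAt.sub (HasDerivAt.fun_sum fun k _ => ?_) ?_
        · exact (hasDerivAt_comp_line (hg.differentiableAt_pderiv (hmem s hs) k)).const_mul _
        · simpa using (hasDerivAt_id s).mul_const H)
      (fun s hs => hφ2 s ⟨hs.1, hs.2.le⟩) s hs
    simp only [zero_smul, add_zero, zero_mul, sub_zero, Real.norm_eq_abs] at this
    rw [sub_right_comm]
    exact this.trans (mul_le_of_le_one_right hC0 hs.2)
  have := norm_image_sub_le_of_norm_deriv_le_segment_01'
    (f := fun s : ℝ => g (z' + s • h) - s * ∑ k, h k * pderiv k g z' - s ^ 2 / 2 * H) (C := C)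
    (f' := fun s => ∑ k, h k * pderiv k g (z' + s • h) - ∑ k, h k * pderiv k g z' - s * H)
    (fun s hs => by
      refine HasDerivAt.hasDerivWithinAt ?_
      refine HasDerivAt.sub (HasDerivAt.sub ?_ ?_) ?_
      · exact hasDerivAt_comp_line (hg.differentiableAt (hmem s hs))
      · simpa using (hasDerivAt_id s).mul_const (∑ k, h k * pderiv k g z')
      · have := ((hasDerivAt_pow 2 s).div_const 2).mul_const H
        refine this.congr_deriv ?_
        simp)
    (fun s hs => hφ1 s ⟨hs.1, hs.2.le⟩)
  simp only [one_smul, zero_smul, add_zero, zero_mul, sub_zero, Real.norm_eq_abs, one_mul,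
    one_pow, ne_eq, OfNat.ofNat_ne_zero, not_false_eq_true, zero_pow, zero_div] at this
  have hzz : z' + h = z := by rw [hh]; abel
  rw [hzz] at this
  convert this using 2
  ring

end ThriceDifferentiableOn

variable {Y : Type*}

/-- Uniform quadratic expansion of the log-likelihood near `z₀`, for a sample whose averaged
Hessians converge to `-J` and whose averaged third order bounds converge. -/
theorem exists_logLik_expansion {f : EuclideanSpace ℝ ι → Y → ℝ} {x : ℕ → Y}
    {z₀ : EuclideanSpace ℝ ι} {δ : ℝ} {J : Matrix ι ι ℝ} {M : ι → ι → ι → Y → ℝ}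
    {m : ι → ι → ι → ℝ}
    (hg : ∀ n, ThriceDifferentiableOn (fun z => Real.log (f z (x n))) (Metric.ball z₀ δ))
    (hM : ∀ i j k n, ∀ w ∈ Metric.ball z₀ δ,
      |pderiv i (pderiv j (pderiv k (fun z => Real.log (f z (x n))))) w| ≤ M i j k (x n))
    (hH : ∀ i j, Tendsto (fun n : ℕ => (∑ l ∈ Finset.range n,
      pderiv i (pderiv j (fun z => Real.log (f z (x l)))) z₀) / n) atTop (𝓝 (-J i j)))
    (hMl : ∀ i j k, Tendsto (fun n : ℕ => (∑ l ∈ Finset.range n, M i j k (x l)) / n) atTop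
      (𝓝 (m i j k))) :
    ∃ a : ℕ → ℝ, Tendsto a atTop (𝓝 0) ∧ ∃ C, 0 ≤ C ∧ ∀ᶠ n : ℕ in atTop,
      ∀ z ∈ Metric.ball z₀ δ, ∀ z' ∈ Metric.ball z₀ δ,
      |logLik f x n z - logLik f x n z' -
        ∑ k, (z - z') k * ∑ l ∈ Finset.range n, pderiv k (fun z => Real.log (f z (x l))) z' +
        n * (quadForm J (z - z') / 2)| ≤
      n * (‖z - z'‖ ^ 2 * (a n + C * (‖z - z'‖ + ‖z' - z₀‖))) := by
  set Hs : ℕ → ι → ι → ℝ := fun n i j => (∑ l ∈ Finset.range n,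
      pderiv i (pderiv j (fun z => Real.log (f z (x l)))) z₀) / n with hHs
  set Ms : ℕ → ℝ := fun n => ∑ k, ∑ j, ∑ i, (∑ l ∈ Finset.range n, M i j k (x l)) / n with hMs
  have hMlim : Tendsto Ms atTop (𝓝 (∑ k, ∑ j, ∑ i, m i j k)) :=
    tendsto_finsetSum _ fun k _ => tendsto_finsetSum _ fun j _ => tendsto_finsetSum _ fun i _ =>
      hMl i j k
  -- `a n` measures how far the averaged Hessian is from `-J`; `C` exceeds the limit of the averaged
  -- third order bounds, hence bounds them for large `n`.
  refine ⟨fun n => ∑ j, ∑ k, |Hs n j k + J j k|, ?_, |∑ k, ∑ j, ∑ i, m i j k| + 1,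
    by positivity, ?_⟩
  · have : Tendsto (fun n => ∑ j, ∑ k, |Hs n j k + J j k|) atTop
        (𝓝 (∑ j : ι, ∑ k : ι, |(-J j k + J j k)|)) :=
      tendsto_finsetSum _ fun j _ => tendsto_finsetSum _ fun k _ =>
        ((hH j k).add_const _).abs
    simpa using this
  filter_upwards [hMlim.eventually_le_const (u := |∑ k, ∑ j, ∑ i, m i j k| + 1)
    ((le_abs_self _).trans_lt (lt_add_one _)), eventually_gt_atTop 0] with n hn hn0 z hz z' hz'
  have hn0' : (0 : ℝ) < n := by exact_mod_cast hn0
  set h := z - z' with hh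
  set G : ℕ → EuclideanSpace ℝ ι → ℝ := fun l z => Real.log (f z (x l)) with hG
  have hsum : |∑ l ∈ Finset.range n, (G l z - G l z' - ∑ k, h k * pderiv k (G l) z' -
      (∑ k, h k * ∑ j, h j * pderiv j (pderiv k (G l)) z₀) / 2)| ≤
      n * (‖h‖ ^ 2 * (‖h‖ + ‖z' - z₀‖) * Ms n) := by
    refine (Finset.abs_sum_le_sum_abs _ _).trans
      ((Finset.sum_le_sum fun l _ => (hg l).abs_taylor_le (fun i j k => hM i j k l) hz hz').trans
        (le_of_eq ?_))
    rw [← Finset.mul_sum, mul_left_comm]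
    congr 1
    rw [hMs]
    simp only [← Finset.sum_div]
    rw [mul_div_cancel₀ _ hn0'.ne', Finset.sum_comm]
    refine Finset.sum_congr rfl fun k _ => ?_
    rw [Finset.sum_comm]
    refine Finset.sum_congr rfl fun j _ => ?_
    rw [Finset.sum_comm]
  have hquad : ∑ l ∈ Finset.range n, (∑ k, h k * ∑ j, h j * pderiv j (pderiv k (G l)) z₀) / 2 =
      n * ((∑ j, ∑ k, h j * h k * Hs n j k) / 2) := by
    rw [← Finset.sum_div, mul_div_assoc']
    congr 1
    simp only [Finset.mul_sum]
    rw [Finset.sum_comm]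
    rw [Finset.sum_comm (s := (Finset.univ : Finset ι)) (t := (Finset.univ : Finset ι))]
    refine Finset.sum_congr rfl fun k _ => ?_
    rw [Finset.sum_comm]
    refine Finset.sum_congr rfl fun j _ => ?_
    rw [hHs]
    simp only [← Finset.mul_sum]
    field_simp
    rfl
  have hqJ : quadForm J h = ∑ j, ∑ k, h j * h k * J j k := by
    simp only [quadForm, dotProduct, Matrix.mulVec, Finset.mul_sum]
    exact Finset.sum_congr rfl fun j _ => Finset.sum_congr rfl fun k _ => by ring
  have hdiff : |(∑ j, ∑ k, h j * h k * Hs n j k) / 2 + quadForm J h / 2| ≤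
      ‖h‖ ^ 2 * ∑ j, ∑ k, |Hs n j k + J j k| := by
    have : (∑ j, ∑ k, h j * h k * Hs n j k) / 2 + quadForm J h / 2 =
        2⁻¹ * ∑ j, ∑ k, h j * h k * (Hs n j k + J j k) := by
      rw [hqJ, ← add_div, ← Finset.sum_add_distrib, div_eq_inv_mul]
      congr 1
      refine Finset.sum_congr rfl fun j _ => ?_
      rw [← Finset.sum_add_distrib]
      exact Finset.sum_congr rfl fun k _ => by ring
    rw [this, abs_mul]
    refine (mul_le_of_le_one_left (abs_nonneg _) (by rw [abs_of_pos] <;> norm_num)).trans ?_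
    rw [Finset.mul_sum]
    refine (Finset.abs_sum_le_sum_abs _ _).trans (Finset.sum_le_sum fun j _ => ?_)
    rw [Finset.mul_sum]
    refine (Finset.abs_sum_le_sum_abs _ _).trans (Finset.sum_le_sum fun k _ => ?_)
    rw [abs_mul, abs_mul, sq]
    have a1 := abs_apply_le_norm h k
    have a2 := abs_apply_le_norm h j
    gcongr
  have hlin : ∑ l ∈ Finset.range n, ∑ k, h k * pderiv k (G l) z' =
      ∑ k, h k * ∑ l ∈ Finset.range n, pderiv k (G l) z' := by
    rw [Finset.sum_comm]
    exact Finset.sum_congr rfl fun k _ => by rw [Finset.mul_sum]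
  rw [Finset.sum_sub_distrib, Finset.sum_sub_distrib, Finset.sum_sub_distrib, hquad, hlin] at hsum
  have hsplit : logLik f x n z - logLik f x n z' -
        ∑ k, h k * ∑ l ∈ Finset.range n, pderiv k (G l) z' + n * (quadForm J h / 2) =
      (∑ l ∈ Finset.range n, G l z - ∑ l ∈ Finset.range n, G l z' -
        ∑ k, h k * ∑ l ∈ Finset.range n, pderiv k (G l) z' -
        n * ((∑ j, ∑ k, h j * h k * Hs n j k) / 2)) +
      n * ((∑ j, ∑ k, h j * h k * Hs n j k) / 2 + quadForm J h / 2) := by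
    simp only [logLik, hG]; ring
  rw [hsplit]
  refine (abs_add_le _ _).trans ?_
  rw [abs_mul, abs_of_pos hn0']
  have hb : ‖h‖ ^ 2 * (‖h‖ + ‖z' - z₀‖) * Ms n ≤
      ‖h‖ ^ 2 * (‖h‖ + ‖z' - z₀‖) * (|∑ k, ∑ j, ∑ i, m i j k| + 1) := by gcongr
  calc _ ≤ n * (‖h‖ ^ 2 * (‖h‖ + ‖z' - z₀‖) * (|∑ k, ∑ j, ∑ i, m i j k| + 1)) +
        n * (‖h‖ ^ 2 * ∑ j, ∑ k, |Hs n j k + J j k|) :=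
      add_le_add (hsum.trans (by gcongr)) (by gcongr)
    _ = _ := by ring

end Taylor

/-! ### Almost sure behaviour of the likelihood -/

section Sample

variable {Ω Y : Type*} [MeasurableSpace Ω] [MeasurableSpace Y]

/-- The `x i` are independent observations with distribution `P`. -/
structure IsIIDSample (Pr : Measure Ω) (P : Measure Y) (x : ℕ → Ω → Y) : Prop where
  measurable : ∀ i, Measurable (x i)
  indep : iIndepFun x Pr
  law : ∀ i, Measure.map (x i) Pr = P

namespace IsIIDSample

variable {Pr : Measure Ω} [IsProbabilityMeasure Pr] {P : Measure Y} {x : ℕ → Ω → Y}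

theorem ae_forall (h : IsIIDSample Pr P x) {p : Y → Prop} (hp : ∀ᵐ y ∂P, p y) :
    ∀ᵐ ω ∂Pr, ∀ i, p (x i ω) := by
  rw [ae_all_iff]
  intro i
  refine ae_of_ae_map (h.measurable i).aemeasurable ?_
  rwa [h.law i]

theorem aemeasurable_comp (h : IsIIDSample Pr P x) {g : Y → ℝ} (hg : AEMeasurable g P) (i : ℕ) :
    AEMeasurable (fun ω => g (x i ω)) Pr := by
  rw [← h.law i] at hg
  exact hg.comp_measurable (h.measurable i)

theorem identDistrib_comp (h : IsIIDSample Pr P x) {g : Y → ℝ} (hg : AEMeasurable g P) (i : ℕ) :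
    IdentDistrib (fun ω => g (x i ω)) (fun ω => g (x 0 ω)) Pr Pr := by
  have : IdentDistrib (x i) (x 0) Pr Pr :=
    ⟨(h.measurable i).aemeasurable, (h.measurable 0).aemeasurable, by rw [h.law, h.law]⟩
  exact this.comp_of_aemeasurable (by rwa [h.law])

theorem indepFun_comp (h : IsIIDSample Pr P x) {g : Y → ℝ} (hg : AEMeasurable g P) {i j : ℕ}
    (hij : i ≠ j) : (fun ω => g (x i ω)) ⟂ᵢ[Pr] (fun ω => g (x j ω)) :=
  (h.indep.comp₀ (fun _ => g) (fun i => (h.measurable i).aemeasurable)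
    (fun i => by rwa [h.law i])).indepFun hij

theorem integral_comp (h : IsIIDSample Pr P x) {g : Y → ℝ} (hg : AEStronglyMeasurable g P)
    (i : ℕ) : ∫ ω, g (x i ω) ∂Pr = ∫ y, g y ∂P := by
  rw [← h.law i] at hg ⊢
  exact (integral_map (h.measurable i).aemeasurable hg).symm

theorem integrable_comp (h : IsIIDSample Pr P x) {g : Y → ℝ} (hg : Integrable g P)
    (i : ℕ) : Integrable (fun ω => g (x i ω)) Pr := by
  rw [← h.law i] at hg
  exact hg.comp_measurable (h.measurable i)

theorem strong_law (h : IsIIDSample Pr P x) {g : Y → ℝ} (hg : Integrable g P) :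
    ∀ᵐ ω ∂Pr, Tendsto (fun n : ℕ => (∑ l ∈ Finset.range n, g (x l ω)) / n) atTop
      (𝓝 (∫ y, g y ∂P)) := by
  have hm := hg.1.aemeasurable
  have := strong_law_ae_real (fun i ω => g (x i ω)) (h.integrable_comp hg 0)
    (fun i j hij => h.indepFun_comp hm hij) (h.identDistrib_comp hm)
  rwa [h.integral_comp hg.1] at this

/-- Independence and the zero mean remove the cross terms. Growth linear in `n` is what makes the
normalized score bounded in mean square. -/
theorem integral_sq_sum (h : IsIIDSample Pr P x) {g : Y → ℝ} (hg : Integrable g P)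
    (hg2 : Integrable (fun y => g y * g y) P) (hg0 : ∫ y, g y ∂P = 0) (n : ℕ) :
    Integrable (fun ω => (∑ l ∈ Finset.range n, g (x l ω)) ^ 2) Pr ∧
    ∫ ω, (∑ l ∈ Finset.range n, g (x l ω)) ^ 2 ∂Pr = n * ∫ y, g y * g y ∂P := by
  have hm := hg.1.aemeasurable
  have hL : ∀ l, MemLp (fun ω => g (x l ω)) 2 Pr := fun l => by
    rw [memLp_two_iff_integrable_sq (h.integrable_comp hg l).1]
    simpa only [sq] using h.integrable_comp hg2 l
  have hLs : MemLp (∑ l ∈ Finset.range n, fun ω => g (x l ω)) 2 Pr :=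
    memLp_finsetSum' _ fun l _ => hL l
  have hfun : (∑ l ∈ Finset.range n, fun ω => g (x l ω)) =
      fun ω => ∑ l ∈ Finset.range n, g (x l ω) := by
    ext ω; simp
  have hv := IndepFun.variance_sum (s := Finset.range n) (fun l _ => hL l)
    (fun i _ j _ hij => h.indepFun_comp hm hij)
  have h0 : ∀ l, ∫ ω, g (x l ω) ∂Pr = 0 := fun l => by rw [h.integral_comp hg.1, hg0]
  have hv1 : ∀ l, variance (fun ω => g (x l ω)) Pr = ∫ y, g y * g y ∂P := fun l => by
    rw [variance_of_integral_eq_zero (h.aemeasurable_comp hm l) (h0 l)]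
    simp only [sq]
    exact h.integral_comp (g := fun y => g y * g y) hg2.1 l
  rw [hfun] at hv hLs
  refine ⟨hLs.integrable_sq, ?_⟩
  rw [variance_of_integral_eq_zero hLs.1.aemeasurable (by
    rw [integral_finsetSum _ fun l _ => h.integrable_comp hg l]
    simp [h0])] at hv
  rw [hv]
  simp [hv1]

end IsIIDSample

end Sample

section Score

variable {ι Y : Type*} [Fintype ι] [DecidableEq ι]

/-- The squared norm of the normalized score `n^(-1/2) ∇ log-likelihood` at `z₀`. -/
def scoreSq (f : EuclideanSpace ℝ ι → Y → ℝ) (z₀ : EuclideanSpace ℝ ι) (x : ℕ → Y) (n : ℕ) : ℝ :=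
  (∑ k, (∑ l ∈ Finset.range n, pderiv k (fun z => Real.log (f z (x l))) z₀) ^ 2) / n

/-- A likelihood `ℓ n` with parameter space `Θ` that has a uniform quadratic expansion, with
information matrix `J`, around its maximizers `zhat n`, which converge to `z₀`, and that is
exponentially small away from `z₀`. -/
structure IsLocallyQuadratic (Θ : Set (EuclideanSpace ℝ ι)) (z₀ : EuclideanSpace ℝ ι)
    (J : Matrix ι ι ℝ) (ℓ : ℕ → EuclideanSpace ℝ ι → ℝ) (zhat : ℕ → EuclideanSpace ℝ ι) :
    Prop where
  posDef : J.PosDef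
  measurable : ∀ n, Measurable (ℓ n)
  tendsto : Tendsto zhat atTop (𝓝 z₀)
  nonneg : ∀ n, ∀ z ∈ Θ, 0 ≤ ℓ n z
  pos : ∀ᶠ n in atTop, 0 < ℓ n (zhat n)
  le_max : ∀ᶠ n in atTop, ∀ z ∈ Θ, ℓ n z ≤ ℓ n (zhat n)
  expansion : ∃ δ > 0, Metric.ball z₀ δ ⊆ Θ ∧ ∃ C, 0 ≤ C ∧ ∃ a : ℕ → ℝ, Tendsto a atTop (𝓝 0) ∧
    ∀ᶠ n : ℕ in atTop, ∀ z ∈ Metric.ball z₀ δ, ∃ e,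
      |e| ≤ ‖z - zhat n‖ ^ 2 * (a n + C * ‖z - zhat n‖) ∧
      ℓ n z = ℓ n (zhat n) * Real.exp (n * (e - quadForm J (z - zhat n) / 2))
  separation : ∀ δ > 0, ∃ ε > 0, ∀ᶠ n : ℕ in atTop, ∀ z ∈ Θ \ Metric.ball z₀ δ,
    ℓ n z ≤ ℓ n (zhat n) * Real.exp (-(n * ε))

end Score

/-! ### Consequences of the regularity conditions for maximizers and scores -/

namespace Regular

variable {Ω Y ι : Type*} [MeasurableSpace Ω] [MeasurableSpace Y] [Fintype ι] [DecidableEq ι]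
  {Pr : Measure Ω} [IsProbabilityMeasure Pr] {P : Measure Y} {x : ℕ → Ω → Y}
  {Θ : Set (EuclideanSpace ℝ ι)} {f : EuclideanSpace ℝ ι → Y → ℝ} {z₀ : EuclideanSpace ℝ ι}
  {est : ℕ → Ω → EuclideanSpace ℝ ι}

theorem integrable_score (h : Regular Pr P x Θ f z₀ est) (i : ι) :
    Integrable (fun y => pderiv i (fun z => Real.log (f z y)) z₀) P := by
  obtain ⟨δ, hδ, -, -, h1, -⟩ := h.smooth
  exact h1 z₀ (Metric.mem_ball_self hδ) i

theorem aemeasurable_scoreSq (h : Regular Pr P x Θ f z₀ est) (hx : IsIIDSample Pr P x) (n : ℕ) :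
    AEMeasurable (fun ω => scoreSq f z₀ (fun i => x i ω) n) Pr := by
  refine AEMeasurable.div_const ?_ _
  refine Finset.aemeasurable_fun_sum _ fun k _ => AEMeasurable.pow_const ?_ _
  exact Finset.aemeasurable_fun_sum _ fun l _ =>
    hx.aemeasurable_comp (h.integrable_score k).1.aemeasurable l

/-- The score is centred with finite second moments, so the mean of `scoreSq` does not grow with
`n`. All the tightness in the theorem comes from this bound. -/
theorem exists_lintegral_scoreSq_le (h : Regular Pr P x Θ f z₀ est) (hx : IsIIDSample Pr P x) :
    ∃ V : ℝ≥0∞, V ≠ ∞ ∧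
      ∀ n, ∫⁻ ω, ENNReal.ofReal (scoreSq f z₀ (fun i => x i ω) n) ∂Pr ≤ V := by
  set v : ι → ℝ := fun k => ∫ y, pderiv k (fun z => Real.log (f z y)) z₀ *
    pderiv k (fun z => Real.log (f z y)) z₀ ∂P with hv
  refine ⟨ENNReal.ofReal (∑ k, v k), ENNReal.ofReal_ne_top, fun n => ?_⟩
  have hs := fun k => hx.integral_sq_sum (h.integrable_score k) (h.information k k).1 (h.score k) n
  have hint : Integrable (fun ω => scoreSq f z₀ (fun i => x i ω) n) Pr :=
    (integrable_finsetSum _ fun k _ => (hs k).1).div_const _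
  have hv0 : ∀ k, 0 ≤ v k := fun k => integral_nonneg fun y => mul_self_nonneg _
  rw [← ofReal_integral_eq_lintegral_ofReal hint (Eventually.of_forall fun ω => by
    simp only [scoreSq]; positivity)]
  refine ENNReal.ofReal_le_ofReal ?_
  simp only [scoreSq]
  rw [integral_div, integral_finsetSum _ fun k _ => (hs k).1]
  simp only [fun k => (hs k).2]
  rw [← Finset.mul_sum]
  rcases Nat.eq_zero_or_pos n with rfl | hn
  · simpa using Finset.sum_nonneg fun k _ => hv0 k
  · have : (n : ℝ) ≠ 0 := by positivity
    rw [mul_div_cancel_left₀ _ this]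

/-- Only finitely many averages occur, the Hessian entries at `z₀` and the dominating functions, so
a single null set serves all `n`, `z` and `z'`. -/
theorem exists_expansion (h : Regular Pr P x Θ f z₀ est) (hx : IsIIDSample Pr P x) :
    ∃ δ > 0, Metric.ball z₀ δ ⊆ Θ ∧ ∀ᵐ ω ∂Pr,
      (∀ l, ∀ z ∈ Metric.ball z₀ δ, 0 < f z (x l ω)) ∧
      (∀ l, ThriceDifferentiableOn (fun z => Real.log (f z (x l ω))) (Metric.ball z₀ δ)) ∧
      ∃ a : ℕ → ℝ, Tendsto a atTop (𝓝 0) ∧ ∃ C, 0 ≤ C ∧ ∀ᶠ n : ℕ in atTop,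
      ∀ z ∈ Metric.ball z₀ δ, ∀ z' ∈ Metric.ball z₀ δ,
      |logLik f (fun i => x i ω) n z - logLik f (fun i => x i ω) n z' -
        ∑ k, (z - z') k * ∑ l ∈ Finset.range n, pderiv k (fun z => Real.log (f z (x l ω))) z' +
        n * (quadForm (infoMatrix P f z₀) (z - z') / 2)| ≤
      n * (‖z - z'‖ ^ 2 * (a n + C * (‖z - z'‖ + ‖z' - z₀‖))) := by
  obtain ⟨δ, hδ, hΘ, hdiff, -, hhess, hthird⟩ := h.smooth
  choose M hMi hMb using hthird
  refine ⟨δ, hδ, hΘ, ?_⟩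
  have hz₀ := Metric.mem_ball_self hδ (x := z₀)
  have e1 : ∀ᵐ ω ∂Pr, ∀ i j, Tendsto (fun n : ℕ => (∑ l ∈ Finset.range n,
      pderiv i (pderiv j (fun z => Real.log (f z (x l ω)))) z₀) / n) atTop
      (𝓝 (-infoMatrix P f z₀ i j)) := by
    rw [ae_all_iff]; intro i
    rw [ae_all_iff]; intro j
    have := hx.strong_law (hhess z₀ hz₀ i j)
    simpa [infoMatrix] using this
  have e2 : ∀ᵐ ω ∂Pr, ∀ i j k, Tendsto (fun n : ℕ => (∑ l ∈ Finset.range n,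
      M i j k (x l ω)) / n) atTop (𝓝 (∫ y, M i j k y ∂P)) := by
    rw [ae_all_iff]; intro i
    rw [ae_all_iff]; intro j
    rw [ae_all_iff]; intro k
    exact hx.strong_law (hMi i j k)
  have e3 : ∀ᵐ ω ∂Pr, ∀ i j k l, ∀ w ∈ Metric.ball z₀ δ,
      |pderiv i (pderiv j (pderiv k (fun z => Real.log (f z (x l ω))))) w| ≤
        M i j k (x l ω) := by
    rw [ae_all_iff]; intro i
    rw [ae_all_iff]; intro j
    rw [ae_all_iff]; intro k
    exact hx.ae_forall (hMb i j k)
  filter_upwards [e1, e2, e3, hx.ae_forall hdiff] with ω h1 h2 h3 h4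
  exact ⟨fun l => (h4 l).1, fun l => (h4 l).2,
    exists_logLik_expansion (fun l => (h4 l).2) h3 h1 h2⟩

/-- The maximizer is eventually an interior local maximum, so the gradient there is zero and the
expansion around it is purely quadratic. -/
theorem ae_isLocallyQuadratic (h : Regular Pr P x Θ f z₀ est) (hx : IsIIDSample Pr P x) :
    ∀ᵐ ω ∂Pr, IsLocallyQuadratic Θ z₀ (infoMatrix P f z₀)
      (lik f (fun i => x i ω)) (fun n => est n ω) := by
  obtain ⟨δ, hδ, hΘ, hexp⟩ := h.exists_expansion hx
  have hz₀ := Metric.mem_ball_self hδ (x := z₀)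
  -- The separation condition has one null set for each radius; the radii `1 / (m + 1)` leave
  -- countably many.
  have hsep : ∀ᵐ ω ∂Pr, ∀ m : ℕ, ∃ ε > 0, ∀ᶠ n : ℕ in atTop,
      ∀ z ∈ Θ \ Metric.ball z₀ (1 / (m + 1 : ℝ)),
      (1 / (n : ℝ)) * (logLik f (fun i => x i ω) n z - logLik f (fun i => x i ω) n z₀) < -ε := by
    rw [ae_all_iff]
    intro m
    obtain ⟨ε, hε, he⟩ := h.separation (1 / (m + 1 : ℝ)) (by positivity)
    filter_upwards [he] with ω hω
    exact ⟨ε, hε, hω⟩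
  filter_upwards [hexp, hsep, h.est_argmax, h.est_consistent] with ω h1 h2 h3 h4
  obtain ⟨hpos, hdiff, a, ha, C, hC, hbound⟩ := h1
  have hposΘ : ∀ l, ∀ z ∈ Θ, 0 < f z (x l ω) := by
    intro l z hz
    have h5 : x l ω ∈ {y | 0 < f z₀ y} := hpos l z₀ hz₀
    rw [h.common_support z₀ (hΘ hz₀) z hz] at h5
    exact h5
  have hlik : ∀ n, ∀ z ∈ Θ, lik f (fun i => x i ω) n z =
      Real.exp (logLik f (fun i => x i ω) n z) := by
    intro n z hz
    rw [lik, logLik, Real.exp_sum]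
    exact Finset.prod_congr rfl fun l _ => (Real.exp_log (hposΘ l z hz)).symm
  have hball : ∀ᶠ n in atTop, est n ω ∈ Metric.ball z₀ δ :=
    h4.eventually (Metric.isOpen_ball.mem_nhds hz₀)
  have hgrad : ∀ᶠ n in atTop, ∀ k, ∑ l ∈ Finset.range n,
      pderiv k (fun z => Real.log (f z (x l ω))) (est n ω) = 0 := by
    filter_upwards [hball, h3] with n hn hmax k
    have hloc : IsLocalMax (fun z => logLik f (fun i => x i ω) n z) (est n ω) := by
      filter_upwards [Metric.isOpen_ball.mem_nhds hn] with z hz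
      exact hmax.2 z (hΘ hz)
    have h6 := hloc.fderiv_eq_zero
    simp only [logLik] at h6
    rw [fderiv_fun_sum fun l _ => (hdiff l).differentiableAt hn] at h6
    have := DFunLike.congr_fun h6 (EuclideanSpace.single k (1 : ℝ))
    simpa [pderiv] using this
  refine ⟨h.information_posDef, fun n => ?_, h4, fun n z hz => ?_, ?_, ?_, ?_, ?_⟩
  · exact Finset.measurable_fun_prod _ fun l _ =>
      h.measurable.comp (measurable_id.prodMk measurable_const)
  · rw [hlik n z hz]; positivity
  · filter_upwards [h3] with n hn
    rw [hlik n _ hn.1]; positivity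
  · filter_upwards [h3] with n hn z hz
    rw [hlik n _ hn.1, hlik n z hz]
    exact Real.exp_le_exp.2 (hn.2 z hz)
  -- The cost of freezing the Hessian at `z₀` tends to zero by consistency and is absorbed into `a`.
  · refine ⟨δ, hδ, hΘ, C, hC, fun n => a n + C * ‖est n ω - z₀‖, ?_, ?_⟩
    · have h7 : Tendsto (fun n => ‖est n ω - z₀‖) atTop (𝓝 0) :=
        tendsto_iff_norm_sub_tendsto_zero.1 h4
      simpa using ha.add (h7.const_mul C)
    · filter_upwards [hbound, hball, hgrad, eventually_gt_atTop 0] with n hb hn hg hn0 z hz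
      have hn0' : (0 : ℝ) < n := by exact_mod_cast hn0
      have hb' := hb z hz _ hn
      simp only [hg, mul_zero, Finset.sum_const_zero, sub_zero] at hb'
      refine ⟨(logLik f (fun i => x i ω) n z - logLik f (fun i => x i ω) n (est n ω) +
        n * (quadForm (infoMatrix P f z₀) (z - est n ω) / 2)) / n, ?_, ?_⟩
      · rw [abs_div, abs_of_pos hn0', div_le_iff₀ hn0']
        refine hb'.trans (le_of_eq ?_)
        ring
      · rw [hlik n _ (hΘ hn), hlik n z (hΘ hz), ← Real.exp_add]
        congr 1
        field_simp
        ring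
  · intro ρ hρ
    obtain ⟨m, hm⟩ := exists_nat_one_div_lt hρ
    obtain ⟨ε, hε, he⟩ := h2 m
    refine ⟨ε, hε, ?_⟩
    filter_upwards [he, h3, eventually_gt_atTop 0] with n hn hmax hn0 z hz
    have hn0' : (0 : ℝ) < n := by exact_mod_cast hn0
    have h8 := hn z ⟨hz.1, fun hz' => hz.2 (Metric.ball_subset_ball hm.le hz')⟩
    have h9 := hmax.2 z₀ (hΘ hz₀)
    rw [hlik n _ hmax.1, hlik n z hz.1, ← Real.exp_add, Real.exp_le_exp]
    rw [one_div, inv_mul_lt_iff₀ hn0'] at h8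
    linarith

/-- The maximizer of the likelihood is within `O(n^(-1/2))` of the true value, in terms of the
normalized score. -/
theorem ae_sq_norm_sub_le (h : Regular Pr P x Θ f z₀ est) (hx : IsIIDSample Pr P x) :
    ∃ D, 0 ≤ D ∧ ∀ᵐ ω ∂Pr, ∀ᶠ n : ℕ in atTop,
      n * ‖est n ω - z₀‖ ^ 2 ≤ D * scoreSq f z₀ (fun i => x i ω) n := by
  obtain ⟨c, hc, hq⟩ := exists_pos_mul_sq_norm_le_quadForm h.information_posDef
  obtain ⟨δ, hδ, hΘ, hexp⟩ := h.exists_expansion hx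
  have hz₀ := Metric.mem_ball_self hδ (x := z₀)
  refine ⟨(4 / c) ^ 2, by positivity, ?_⟩
  filter_upwards [hexp, h.est_argmax, h.est_consistent] with ω h1 h3 h4
  obtain ⟨-, -, a, ha, C, hC, hbound⟩ := h1
  have h7 : Tendsto (fun n => ‖est n ω - z₀‖) atTop (𝓝 0) :=
    tendsto_iff_norm_sub_tendsto_zero.1 h4
  have h8 : Tendsto (fun n => a n + C * ‖est n ω - z₀‖) atTop (𝓝 0) := by
    simpa using ha.add (h7.const_mul C)
  filter_upwards [hbound, h3, h4.eventually (Metric.isOpen_ball.mem_nhds hz₀),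
    h8.eventually_le_const (u := c / 4) (by positivity), eventually_gt_atTop 0]
    with n hb hmax hball hsmall hn0
  have hn0' : (0 : ℝ) < n := by exact_mod_cast hn0
  have hb' := hb _ hball z₀ hz₀
  have hmax' := hmax.2 z₀ (hΘ hz₀)
  set u := est n ω - z₀ with hu
  simp only [sub_self, norm_zero, add_zero] at hb'
  set S : ι → ℝ := fun k => ∑ l ∈ Finset.range n, pderiv k (fun z => Real.log (f z (x l ω))) z₀
  have hqu := hq u
  have hcs : (∑ k, u k * S k) ^ 2 ≤ ‖u‖ ^ 2 * ∑ k, S k ^ 2 := by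
    rw [EuclideanSpace.norm_sq_eq]
    simpa using Finset.sum_mul_sq_le_sq_mul_sq Finset.univ (fun k => u k) S
  -- The increment from `z₀` to the maximizer is nonnegative. Hence the linear term is at least the
  -- quadratic term `n c ‖u‖² / 2` minus a remainder of at most `n c ‖u‖² / 4`. With Cauchy–Schwarz
  -- this gives the factor `(4 / c) ^ 2`.
  have hlow : n * (c / 4) * ‖u‖ ^ 2 ≤ ∑ k, u k * S k := by
    have h9 := (abs_le.1 hb').2
    have h10 : n * (‖u‖ ^ 2 * (a n + C * ‖u‖)) ≤ n * (‖u‖ ^ 2 * (c / 4)) := by gcongr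
    have h11 : n * (c * ‖u‖ ^ 2 / 2) ≤ n * (quadForm (infoMatrix P f z₀) u / 2) := by gcongr
    linarith
  rcases eq_or_ne u 0 with hu0 | hu0
  · rw [hu0]
    simp only [norm_zero, ne_eq, OfNat.ofNat_ne_zero, not_false_eq_true, zero_pow, mul_zero]
    unfold scoreSq
    positivity
  have hu1 : 0 < ‖u‖ := norm_pos_iff.2 hu0
  have h12 : (n * (c / 4) * ‖u‖ ^ 2) ^ 2 ≤ ‖u‖ ^ 2 * ∑ k, S k ^ 2 :=
    (pow_le_pow_left₀ (by positivity) hlow 2).trans hcs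
  have h13 : n ^ 2 * (c / 4) ^ 2 * ‖u‖ ^ 2 ≤ ∑ k, S k ^ 2 := by
    have : 0 < ‖u‖ ^ 2 := by positivity
    refine le_of_mul_le_mul_left ?_ this
    calc _ = (n * (c / 4) * ‖u‖ ^ 2) ^ 2 := by ring
      _ ≤ _ := h12
  unfold scoreSq
  rw [mul_div_assoc', le_div_iff₀ hn0']
  calc n * ‖u‖ ^ 2 * n = (4 / c) ^ 2 * (n ^ 2 * (c / 4) ^ 2 * ‖u‖ ^ 2) := by
        field_simp
    _ ≤ _ := by gcongr

end Regular

/-! ### A Bernstein–von Mises theorem for locally quadratic likelihoods -/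

/-- Uniform continuity on a ball replaces continuity at a limit: the centres `μₙ` move and need not
converge, so only differences can tend to zero. -/
theorem tendsto_sub_of_continuous_of_bounded {E : Type*} [NormedAddCommGroup E] [ProperSpace E]
    {F : E → ℝ} (hF : Continuous F) {g h : ℕ → E} {B : ℝ} (hg : ∀ n, ‖g n‖ ≤ B)
    (hh : ∀ n, ‖h n‖ ≤ B) (hgh : Tendsto (fun n => h n - g n) atTop (𝓝 0)) :
    Tendsto (fun n => F (h n) - F (g n)) atTop (𝓝 0) := by
  have huc := (isCompact_closedBall (0 : E) B).uniformContinuousOn_of_continuous hF.continuousOn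
  rw [Metric.uniformContinuousOn_iff] at huc
  rw [Metric.tendsto_atTop] at hgh ⊢
  intro ε hε
  obtain ⟨δ, hδ, h1⟩ := huc ε hε
  obtain ⟨N, hN⟩ := hgh δ hδ
  refine ⟨N, fun n hn => ?_⟩
  have h2 := h1 (h n) (by simpa using hh n) (g n) (by simpa using hg n)
    (by simpa [dist_eq_norm] using hN n hn)
  simpa [dist_eq_norm] using h2

/-- Rescaling inflates the weighted prior mass by powers of `√n`; the separation bound beats them.
-/
theorem tendsto_sqrt_pow_mul_exp_neg (k : ℕ) {ε : ℝ} (hε : 0 < ε) :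
    Tendsto (fun n : ℕ => (1 + Real.sqrt n) ^ k * Real.exp (-(n * ε))) atTop (𝓝 0) := by
  have h1 : Tendsto (fun x : ℝ => x ^ k * Real.exp (-ε * x)) atTop (𝓝 0) := by
    have := tendsto_rpow_mul_exp_neg_mul_atTop_nhds_zero k ε hε
    simpa using this
  have h2 := (h1.comp (tendsto_atTop_add_const_left _ (1 : ℝ)
    tendsto_natCast_atTop_atTop)).mul_const (Real.exp ε)
  simp only [zero_mul] at h2
  refine tendsto_of_tendsto_of_tendsto_of_le_of_le tendsto_const_nhds h2
    (fun n => by positivity) (fun n => ?_)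
  simp only [Function.comp_apply]
  rw [mul_assoc, ← Real.exp_add]
  rcases Nat.eq_zero_or_pos n with rfl | hn
  · simp
  have hs : Real.sqrt n ≤ n := by
    rw [Real.sqrt_le_left (by positivity)]
    have : (1 : ℝ) ≤ n := by exact_mod_cast hn
    nlinarith
  refine mul_le_mul (by gcongr) (le_of_eq ?_) (by positivity) (by positivity)
  congr 1; ring

namespace IsLocallyQuadratic

variable {τ : Type*} [Fintype τ] [DecidableEq τ] {Θ : Set (EuclideanSpace ℝ τ)}
  {z₀ : EuclideanSpace ℝ τ} {J : Matrix τ τ ℝ} {ℓ : ℕ → EuclideanSpace ℝ τ → ℝ}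
  {zhat : ℕ → EuclideanSpace ℝ τ}

/-- On a small fixed ball the remainder uses up at most half of the quadratic form. What is left is
a Gaussian envelope for the likelihood ratio, independent of `n`. -/
theorem exists_le_exp (hQ : IsLocallyQuadratic Θ z₀ J ℓ zhat) :
    ∃ c > 0, (∀ h, gaussianKernel J h ≤ Real.exp (-c * ‖h‖ ^ 2)) ∧ ∃ δ₀ > 0,
      ∀ᶠ n : ℕ in atTop, ∀ h, zhat n + (Real.sqrt n)⁻¹ • h ∈ Metric.ball z₀ δ₀ →
        ℓ n (zhat n + (Real.sqrt n)⁻¹ • h) / ℓ n (zhat n) ≤ Real.exp (-c * ‖h‖ ^ 2) := by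
  obtain ⟨c, hc, hq⟩ := exists_pos_mul_sq_norm_le_quadForm hQ.posDef
  obtain ⟨δ, hδ, -, C, hC, a, ha, hexp⟩ := hQ.expansion
  -- If `z` and `zhat n` are both within `c / (16 * (C + 1))` of `z₀`, then `C * ‖u‖ ≤ c / 8`. With
  -- `a n ≤ c / 8` the remainder is at most `c / 4 * ‖u‖ ^ 2`, against `c / 2 * ‖u‖ ^ 2` from the
  -- quadratic form.
  refine ⟨c / 4, by positivity, fun h => ?_, min δ (c / (16 * (C + 1))), by positivity, ?_⟩
  · refine Real.exp_le_exp.2 ?_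
    have h1 := hq h
    nlinarith [sq_nonneg ‖h‖, mul_nonneg hc.le (sq_nonneg ‖h‖)]
  have hb : ∀ᶠ n in atTop, zhat n ∈ Metric.ball z₀ (c / (16 * (C + 1))) :=
    hQ.tendsto.eventually (Metric.isOpen_ball.mem_nhds (Metric.mem_ball_self (by positivity)))
  filter_upwards [hexp, hb, ha.eventually_le_const (u := c / 8) (by positivity), hQ.pos,
    eventually_gt_atTop 0] with n hn hbn han hpos hn0 h hh
  have hn0' : (0 : ℝ) < n := by exact_mod_cast hn0
  have hsq : Real.sqrt n ^ 2 = n := Real.sq_sqrt hn0'.le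
  obtain ⟨e, he, hl⟩ := hn _ (Metric.ball_subset_ball (min_le_left _ _) hh)
  have hh' := Metric.ball_subset_ball (min_le_right _ _) hh
  rw [hl, mul_div_cancel_left₀ _ hpos.ne']
  refine Real.exp_le_exp.2 ?_
  set u := zhat n + (Real.sqrt n)⁻¹ • h - zhat n with hu
  have hu' : u = (Real.sqrt n)⁻¹ • h := by rw [hu]; abel
  have hun : ‖u‖ ≤ c / (8 * (C + 1)) := by
    rw [hu, ← dist_eq_norm]
    have := (dist_triangle_right (zhat n + (Real.sqrt n)⁻¹ • h) (zhat n) z₀).trans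
      (add_le_add (Metric.mem_ball.1 hh').le (Metric.mem_ball.1 hbn).le)
    refine this.trans (le_of_eq ?_)
    field_simp; norm_num
  have hCu : C * ‖u‖ ≤ c / 8 := by
    calc C * ‖u‖ ≤ (C + 1) * (c / (8 * (C + 1))) := by gcongr; linarith
      _ = c / 8 := by field_simp
  have hnu : n * ‖u‖ ^ 2 = ‖h‖ ^ 2 := by
    rw [hu', norm_smul, mul_pow, norm_inv, inv_pow, Real.norm_of_nonneg (Real.sqrt_nonneg _), hsq]
    field_simp
  have h1 : e ≤ ‖u‖ ^ 2 * (c / 4) :=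
    (le_abs_self e).trans (he.trans (by gcongr; linarith))
  have h2 := hq u
  calc n * (e - quadForm J u / 2) ≤ n * (‖u‖ ^ 2 * (c / 4) - c * ‖u‖ ^ 2 / 2) := by gcongr
    _ = -(c / 4) * (n * ‖u‖ ^ 2) := by ring
    _ = _ := by rw [hnu]

/-- For bounded `h n` the total error `n * e` in the exponent is at most `B² (|a n| + C B / √n)`.
Uniform continuity of the kernel then moves `h n` to `g n`. -/
theorem tendsto_ratio_sub (hQ : IsLocallyQuadratic Θ z₀ J ℓ zhat)
    {g h : ℕ → EuclideanSpace ℝ τ} {B : ℝ} (hg : ∀ n, ‖g n‖ ≤ B)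
    (hh : ∀ n, ‖h n‖ ≤ B) (hgh : Tendsto (fun n => h n - g n) atTop (𝓝 0)) :
    Tendsto (fun n : ℕ => ℓ n (zhat n + (Real.sqrt n)⁻¹ • h n) / ℓ n (zhat n) -
      gaussianKernel J (g n)) atTop (𝓝 0) ∧
    Tendsto (fun n : ℕ => zhat n + (Real.sqrt n)⁻¹ • h n) atTop (𝓝 z₀) := by
  have hB : 0 ≤ B := (norm_nonneg _).trans (hg 0)
  have hs : Tendsto (fun n : ℕ => (Real.sqrt n)⁻¹) atTop (𝓝 0) :=
    tendsto_inv_atTop_zero.comp (Real.tendsto_sqrt_atTop.comp tendsto_natCast_atTop_atTop)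
  have hsB : Tendsto (fun n : ℕ => (Real.sqrt n)⁻¹ * B) atTop (𝓝 0) := by
    simpa using hs.mul_const B
  have hz : Tendsto (fun n : ℕ => zhat n + (Real.sqrt n)⁻¹ • h n) atTop (𝓝 z₀) := by
    have : Tendsto (fun n : ℕ => (Real.sqrt n)⁻¹ • h n) atTop (𝓝 0) := by
      refine squeeze_zero_norm (fun n => ?_) hsB
      rw [norm_smul, Real.norm_of_nonneg (by positivity)]
      have := hh n
      gcongr
    simpa using hQ.tendsto.add this
  refine ⟨?_, hz⟩
  obtain ⟨c, hc, hker, -⟩ := hQ.exists_le_exp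
  obtain ⟨δ, hδ, -, C, hC, a, ha, hexp⟩ := hQ.expansion
  have hcont := tendsto_sub_of_continuous_of_bounded (continuous_gaussianKernel J) hg hh hgh
  have hη : Tendsto (fun n : ℕ => Real.exp (B ^ 2 * (|a n| + C * ((Real.sqrt n)⁻¹ * B))) - 1)
      atTop (𝓝 0) := by
    have h1 : Tendsto (fun n : ℕ => B ^ 2 * (|a n| + C * ((Real.sqrt n)⁻¹ * B))) atTop (𝓝 0) := by
      simpa using (ha.abs.add (hsB.const_mul C)).const_mul (B ^ 2)
    have := (Real.continuous_exp.tendsto 0).comp h1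
    simpa using this.sub_const 1
  have hmain : Tendsto (fun n : ℕ => ℓ n (zhat n + (Real.sqrt n)⁻¹ • h n) / ℓ n (zhat n) -
      gaussianKernel J (h n)) atTop (𝓝 0) := by
    refine squeeze_zero_norm' ?_ hη
    filter_upwards [hexp, hz.eventually (Metric.isOpen_ball.mem_nhds (Metric.mem_ball_self hδ)),
      hQ.pos, eventually_gt_atTop 0] with n hn hzn hpos hn0
    have hn0' : (0 : ℝ) < n := by exact_mod_cast hn0
    have hsq : Real.sqrt n ^ 2 = n := Real.sq_sqrt hn0'.le
    obtain ⟨e, he, hl⟩ := hn _ hzn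
    rw [hl, mul_div_cancel_left₀ _ hpos.ne']
    rw [add_sub_cancel_left] at he ⊢
    have hq : n * (e - quadForm J ((Real.sqrt n)⁻¹ • h n) / 2) =
        n * e + -(quadForm J (h n) / 2) := by
      rw [quadForm_smul, inv_pow, hsq]; field_simp; ring
    have hne : |n * e| ≤ B ^ 2 * (|a n| + C * ((Real.sqrt n)⁻¹ * B)) := by
      rw [abs_mul, abs_of_pos hn0']
      have hhn := hh n
      rw [norm_smul, norm_inv, Real.norm_of_nonneg (Real.sqrt_nonneg _), mul_pow, inv_pow,
        hsq] at he
      calc n * |e| ≤ n * ((n : ℝ)⁻¹ * ‖h n‖ ^ 2 * (a n + C * ((Real.sqrt n)⁻¹ * ‖h n‖))) := by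
            gcongr
        _ = ‖h n‖ ^ 2 * (a n + C * ((Real.sqrt n)⁻¹ * ‖h n‖)) := by field_simp
        _ ≤ ‖h n‖ ^ 2 * (|a n| + C * ((Real.sqrt n)⁻¹ * B)) := by
            gcongr
            exact le_abs_self _
        _ ≤ _ := by gcongr
    have hk1 : gaussianKernel J (h n) ≤ 1 :=
      (hker _).trans (Real.exp_le_one_iff.2 (by nlinarith [sq_nonneg ‖h n‖]))
    rw [hq, Real.exp_add]
    change ‖Real.exp (n * e) * gaussianKernel J (h n) - gaussianKernel J (h n)‖ ≤ _
    rw [← sub_one_mul, norm_mul, Real.norm_of_nonneg (gaussianKernel_pos _ _).le]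
    refine (mul_le_of_le_one_right (norm_nonneg _) hk1).trans ?_
    rw [Real.norm_eq_abs, abs_le]
    obtain ⟨h3, h4⟩ := abs_le.1 hne
    set w := B ^ 2 * (|a n| + C * ((Real.sqrt n)⁻¹ * B))
    have h5 := Real.exp_le_exp.2 h3
    have h6 := Real.exp_le_exp.2 h4
    refine ⟨?_, by linarith⟩
    -- The lower side needs `exp (-w) ≥ 2 - exp w`, the sum of these two inequalities.
    have h7 := Real.add_one_le_exp w
    have h8 := Real.add_one_le_exp (-w)
    linarith
  simpa using hmain.add hcont

variable {ι : Type*} [Fintype ι]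

set_option maxHeartbeats 1000000 in
/-- Bernstein–von Mises in weighted total variation along affine slices `t ↦ p n t` of the
rescaled parameter space, with Gaussian limits evaluated along nearby slices `g n`. -/
theorem tendsto_posterior (hQ : IsLocallyQuadratic Θ z₀ J ℓ zhat)
    {π : EuclideanSpace ℝ τ → ℝ} (hπm : Measurable π) (hπ0 : ∀ z, 0 ≤ π z)
    (hπΘ : ∀ z ∉ Θ, π z = 0) (hπc : ContinuousAt π z₀) (hπp : 0 < π z₀)
    {p g : ℕ → EuclideanSpace ℝ ι → EuclideanSpace ℝ τ} (hpm : ∀ n, Measurable (p n))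
    (hgm : ∀ n, Measurable (g n)) (hpn : ∀ n t, ‖t‖ ≤ ‖p n t‖) (hgn : ∀ n t, ‖t‖ ≤ ‖g n t‖)
    (hpb : ∀ t, ∃ B, ∀ n, ‖p n t‖ ≤ B ∧ ‖g n t‖ ≤ B)
    (hpg : ∀ t, Tendsto (fun n => p n t - g n t) atTop (𝓝 0))
    {ρ : EuclideanSpace ℝ ι → ℝ} (hρm : Measurable ρ) (hρ1 : ∀ t, 1 ≤ ρ t)
    (hρ : ∀ t, ρ t ≤ 1 + ‖t‖) {c₀ : ℝ} (hc₀ : 0 < c₀)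
    (hW : ∀ n, c₀ ≤ ∫ t, gaussianKernel J (g n t))
    {k : ℕ} {D : ℝ} (htail : ∀ᶠ n : ℕ in atTop,
      ∫⁻ t, ENNReal.ofReal (ρ t * π (zhat n + (Real.sqrt n)⁻¹ • p n t)) ≤
        ENNReal.ofReal (D * (1 + Real.sqrt n) ^ k)) :
    Tendsto (fun n : ℕ => ∫⁻ t, ENNReal.ofReal (ρ t) *
      ‖ℓ n (zhat n + (Real.sqrt n)⁻¹ • p n t) * π (zhat n + (Real.sqrt n)⁻¹ • p n t) /
          (∫ t, ℓ n (zhat n + (Real.sqrt n)⁻¹ • p n t) * π (zhat n + (Real.sqrt n)⁻¹ • p n t)) -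
        gaussianKernel J (g n t) / ∫ t, gaussianKernel J (g n t)‖ₑ) atTop (𝓝 0) := by
  obtain ⟨c, hc, hker, δ₀, hδ₀, hlocal⟩ := hQ.exists_le_exp
  obtain ⟨δ₁, hδ₁, hball⟩ := Metric.eventually_nhds_iff_ball.1
    (hπc.eventually (Iio_mem_nhds (show π z₀ < 2 * π z₀ by linarith)))
  set δ := min δ₀ δ₁ with hδ
  have hδ0 : 0 < δ := lt_min hδ₀ hδ₁
  obtain ⟨ε, hε, hsep⟩ := hQ.separation δ hδ0
  set z : ℕ → EuclideanSpace ℝ ι → EuclideanSpace ℝ τ :=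
    fun n t => zhat n + (Real.sqrt n)⁻¹ • p n t with hz
  have hzm : ∀ n, Measurable (z n) := fun n => by
    have := hpm n
    fun_prop
  set u : ℕ → EuclideanSpace ℝ ι → ℝ := fun n t => ℓ n (z n t) / ℓ n (zhat n) * π (z n t) with hu
  set w : ℕ → EuclideanSpace ℝ ι → ℝ := fun n t => π z₀ * gaussianKernel J (g n t) with hw
  have hum : ∀ n, Measurable (u n) := fun n =>
    (((hQ.measurable n).comp (hzm n)).div_const _).mul (hπm.comp (hzm n))
  have hwm : ∀ n, Measurable (w n) := fun n =>
    ((continuous_gaussianKernel J).measurable.comp (hgm n)).const_mul _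
  have hρ0 : ∀ t, 0 ≤ ρ t := fun t => zero_le_one.trans (hρ1 t)
  set G : EuclideanSpace ℝ ι → ℝ :=
    fun t => 2 * π z₀ * Real.exp (1 / (2 * c)) * Real.exp (-(c / 2) * ‖t‖ ^ 2) with hG
  have hGi : Integrable G := (integrable_exp_neg_mul_sq_norm (by positivity)).const_mul _
  have hGfin : ∫⁻ t, ENNReal.ofReal (G t) ≠ ∞ :=
    hGi.lintegral_lt_top.ne
  -- The weight is absorbed through `1 + t ≤ exp t` and completing the square, which costs half of
  -- the Gaussian exponent.
  have hGb : ∀ t s : ℝ, 0 ≤ t → t ≤ s → (1 + t) * Real.exp (-c * s ^ 2) ≤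
      Real.exp (1 / (2 * c)) * Real.exp (-(c / 2) * t ^ 2) := by
    intro t s ht hts
    have h1 : 1 + t ≤ Real.exp t := by linarith [Real.add_one_le_exp t]
    have h2 : Real.exp (-c * s ^ 2) ≤ Real.exp (-c * t ^ 2) :=
      Real.exp_le_exp.2 (by
        have : t ^ 2 ≤ s ^ 2 := by gcongr
        nlinarith)
    calc (1 + t) * Real.exp (-c * s ^ 2) ≤ Real.exp t * Real.exp (-c * t ^ 2) := by gcongr
      _ = Real.exp (t + -c * t ^ 2) := (Real.exp_add _ _).symm
      _ ≤ Real.exp (1 / (2 * c) + -(c / 2) * t ^ 2) := by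
          refine Real.exp_le_exp.2 ?_
          have : 1 / (2 * c) + -(c / 2) * t ^ 2 - (t + -c * t ^ 2) =
              (c * t - 1) ^ 2 / (2 * c) := by field_simp; ring
          have h3 : 0 ≤ (c * t - 1) ^ 2 / (2 * c) := by positivity
          linarith
      _ = _ := Real.exp_add _ _
  have hρw : ∀ n t, ρ t * w n t ≤ G t := by
    intro n t
    have h1 := hGb ‖t‖ ‖g n t‖ (norm_nonneg _) (hgn n t)
    calc ρ t * w n t ≤ (1 + ‖t‖) * (2 * π z₀ * Real.exp (-c * ‖g n t‖ ^ 2)) := by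
          have := hker (g n t)
          have := hρ t
          have := (gaussianKernel_pos J (g n t)).le
          simp only [hw]
          gcongr
          linarith
      _ = 2 * π z₀ * ((1 + ‖t‖) * Real.exp (-c * ‖g n t‖ ^ 2)) := by ring
      _ ≤ 2 * π z₀ * (Real.exp (1 / (2 * c)) * Real.exp (-(c / 2) * ‖t‖ ^ 2)) := by gcongr
      _ = G t := by simp only [hG]; ring
  have hw0 : ∀ n t, 0 ≤ w n t := fun n t => mul_nonneg hπp.le (gaussianKernel_pos _ _).le
  have hrat : ∀ᶠ n in atTop, ∀ y ∈ Θ, 0 ≤ ℓ n y / ℓ n (zhat n) := by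
    filter_upwards [hQ.pos] with n hn y hy
    exact div_nonneg (hQ.nonneg n y hy) hn.le
  have hu0 : ∀ᶠ n in atTop, ∀ t, 0 ≤ u n t := by
    filter_upwards [hrat] with n hn t
    by_cases h : z n t ∈ Θ
    · exact mul_nonneg (hn _ h) (hπ0 _)
    · simp [hu, hπΘ _ h]
  have hconv : Tendsto (fun n => ∫⁻ t, ‖ρ t * u n t - ρ t * w n t‖ₑ) atTop (𝓝 0) := by
    refine tendsto_lintegral_enorm_sub_of_dominated_on
      (S := fun n => (z n) ⁻¹' Metric.ball z₀ δ) (G := fun t => ENNReal.ofReal (G t))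
      (fun n => hρm.mul (hum n)) (fun n => hρm.mul (hwm n))
      (fun n => hzm n measurableSet_ball) ?_ hGfin ?_ ?_ ?_ ?_
    · intro t
      obtain ⟨B, hB⟩ := hpb t
      have := (hQ.tendsto_ratio_sub (fun n => (hB n).2) (fun n => (hB n).1) (hpg t)).2
      exact this.eventually (Metric.isOpen_ball.mem_nhds (Metric.mem_ball_self hδ0))
    · filter_upwards [hlocal, hu0] with n hn hu0n t ht
      rw [Real.enorm_eq_ofReal (mul_nonneg (hρ0 t) (hu0n t))]
      refine ENNReal.ofReal_le_ofReal ?_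
      have h1 := hGb ‖t‖ ‖p n t‖ (norm_nonneg _) (hpn n t)
      have h2 := hn (p n t) (Metric.ball_subset_ball (min_le_left _ _) ht)
      have h3 : π (z n t) ≤ 2 * π z₀ :=
        (hball _ (Metric.ball_subset_ball (min_le_right _ _) ht)).le
      calc ρ t * u n t ≤ (1 + ‖t‖) * (Real.exp (-c * ‖p n t‖ ^ 2) * (2 * π z₀)) := by
            have h4 := hρ t
            have h5 := hπ0 (z n t)
            have h6 := hu0n t
            have h7 : u n t ≤ Real.exp (-c * ‖p n t‖ ^ 2) * (2 * π z₀) :=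
              mul_le_mul h2 h3 h5 (Real.exp_pos _).le
            gcongr
        _ = 2 * π z₀ * ((1 + ‖t‖) * Real.exp (-c * ‖p n t‖ ^ 2)) := by ring
        _ ≤ 2 * π z₀ * (Real.exp (1 / (2 * c)) * Real.exp (-(c / 2) * ‖t‖ ^ 2)) := by gcongr
        _ = G t := by simp only [hG]; ring
    · intro n t
      rw [Real.enorm_eq_ofReal (mul_nonneg (hρ0 t) (hw0 n t))]
      exact ENNReal.ofReal_le_ofReal (hρw n t)
    · intro t
      obtain ⟨B, hB⟩ := hpb t
      obtain ⟨h1, h2⟩ := hQ.tendsto_ratio_sub (fun n => (hB n).2) (fun n => (hB n).1) (hpg t)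
      have h3 : Tendsto (fun n => π (z n t)) atTop (𝓝 (π z₀)) := hπc.tendsto.comp h2
      -- The prior is continuous at `z₀` and the kernel is at most one, so the prior may be frozen
      -- at `π z₀`.
      have h4 : Tendsto (fun n => gaussianKernel J (g n t) * (π (z n t) - π z₀)) atTop (𝓝 0) := by
        have h5 : Tendsto (fun n => π (z n t) - π z₀) atTop (𝓝 0) := by
          simpa using h3.sub_const (π z₀)
        refine squeeze_zero_norm (fun n => ?_) (by simpa using h5.norm)
        rw [norm_mul, Real.norm_of_nonneg (gaussianKernel_pos _ _).le]
        refine mul_le_of_le_one_left (norm_nonneg _) ((hker _).trans ?_)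
        exact Real.exp_le_one_iff.2 (by nlinarith [sq_nonneg ‖g n t‖])
      have h6 := ((h1.mul h3).add h4).const_mul (ρ t)
      simp only [zero_mul, add_zero, mul_zero] at h6
      refine h6.congr fun n => ?_
      simp only [hu, hw, hz]
      ring
    -- Off the ball the likelihood ratio is at most `exp (-(n * ε))`, while the weighted prior mass
    -- is polynomial in `√n` by `htail`.
    · have hlim : Tendsto (fun n : ℕ => ENNReal.ofReal
          (D * ((1 + Real.sqrt n) ^ k * Real.exp (-(n * ε))))) atTop (𝓝 0) := by
        have := ENNReal.tendsto_ofReal ((tendsto_sqrt_pow_mul_exp_neg k hε).const_mul D)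
        simpa using this
      refine tendsto_of_tendsto_of_tendsto_of_le_of_le' tendsto_const_nhds hlim
        (Eventually.of_forall fun n => zero_le) ?_
      filter_upwards [htail, hsep, hu0, hQ.pos] with n htn hsn hu0n hpos
      calc ∫⁻ t in ((z n) ⁻¹' Metric.ball z₀ δ)ᶜ, ‖ρ t * u n t‖ₑ
          ≤ ∫⁻ t in ((z n) ⁻¹' Metric.ball z₀ δ)ᶜ,
            ENNReal.ofReal (Real.exp (-(n * ε))) * ENNReal.ofReal (ρ t * π (z n t)) := by
            refine setLIntegral_mono_ae' (hzm n measurableSet_ball).compl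
              (Eventually.of_forall fun t ht => ?_)
            rw [Real.enorm_eq_ofReal (mul_nonneg (hρ0 t) (hu0n t)),
              ← ENNReal.ofReal_mul (Real.exp_pos _).le]
            refine ENNReal.ofReal_le_ofReal ?_
            by_cases h : z n t ∈ Θ
            · have h1 : ℓ n (z n t) / ℓ n (zhat n) ≤ Real.exp (-(n * ε)) := by
                rw [div_le_iff₀ hpos, mul_comm]
                exact hsn _ ⟨h, ht⟩
              have h2 := hπ0 (z n t)
              have h3 := hρ0 t
              calc ρ t * u n t ≤ ρ t * (Real.exp (-(n * ε)) * π (z n t)) := by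
                    simp only [hu]; gcongr
                _ = _ := by ring
            · simp [hu, hπΘ _ h]
        _ ≤ ∫⁻ t, ENNReal.ofReal (Real.exp (-(n * ε))) * ENNReal.ofReal (ρ t * π (z n t)) :=
            setLIntegral_le_lintegral _ _
        _ = ENNReal.ofReal (Real.exp (-(n * ε))) * ∫⁻ t, ENNReal.ofReal (ρ t * π (z n t)) :=
            lintegral_const_mul' _ _ ENNReal.ofReal_ne_top
        _ ≤ ENNReal.ofReal (Real.exp (-(n * ε))) * ENNReal.ofReal (D * (1 + Real.sqrt n) ^ k) := by
            gcongr
        _ = _ := by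
            rw [← ENNReal.ofReal_mul (Real.exp_pos _).le]
            congr 1; ring
  have hconv' : Tendsto (fun n => ∫⁻ t, ENNReal.ofReal (ρ t) * ‖u n t - w n t‖ₑ) atTop (𝓝 0) := by
    refine hconv.congr fun n => lintegral_congr fun t => ?_
    rw [← mul_sub, enorm_mul, Real.enorm_eq_ofReal (hρ0 t)]
  have hwi : ∀ n, Integrable (w n) := fun n => by
    refine hGi.mono' (hwm n).aestronglyMeasurable (Eventually.of_forall fun t => ?_)
    rw [Real.norm_of_nonneg (hw0 n t)]
    exact (le_mul_of_one_le_left (hw0 n t) (hρ1 t)).trans (hρw n t)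
  have hnorm := tendsto_lintegral_mul_enorm_div_integral_sub (c := π z₀ * c₀)
    (C := ∫⁻ t, ENNReal.ofReal (G t)) hρm.ennreal_ofReal
    (fun t => by simpa using hρ1 t) hum hwm hwi (by positivity)
    (fun n => by
      simp only [hw]
      rw [integral_const_mul]
      gcongr
      exact hW n)
    (fun n => lintegral_mono fun t => by
      simp only
      rw [Real.enorm_eq_ofReal (hw0 n t), ← ENNReal.ofReal_mul (hρ0 t)]
      exact ENNReal.ofReal_le_ofReal (hρw n t)) hGfin hconv'
  refine hnorm.congr' ?_
  filter_upwards [hQ.pos] with n hn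
  refine lintegral_congr fun t => ?_
  congr 2
  -- The constants `ℓ n (zhat n)` and `π z₀` cancel between numerator and normalizer.
  have h1 : ∀ t, u n t = (ℓ n (zhat n))⁻¹ * (ℓ n (z n t) * π (z n t)) := fun t => by
    simp only [hu]; ring
  congr 1
  · simp only [h1]
    rw [integral_const_mul, mul_div_mul_left _ _ (inv_ne_zero hn.ne')]
  · simp only [hw]
    rw [integral_const_mul, mul_div_mul_left _ _ hπp.ne']

end IsLocallyQuadratic

/-! ### Stacked vectors -/

section Join

variable {ι κ : Type*} [Fintype ι] [Fintype κ]

theorem measurable_join : Measurable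
    (fun q : EuclideanSpace ℝ ι × EuclideanSpace ℝ κ => join q.1 q.2) := by
  refine (Continuous.measurable ?_)
  refine (PiLp.continuous_toLp 2 _).comp (continuous_pi fun i => ?_)
  rcases i with i | i
  · simp only [Sum.elim_inl]; fun_prop
  · simp only [Sum.elim_inr]; fun_prop

theorem continuous_subvec {ι κ : Type*} [Fintype ι] [Fintype κ] (s : κ → ι) :
    Continuous (subvec s) := by
  unfold subvec
  fun_prop

theorem norm_join_sq (η : EuclideanSpace ℝ ι) (ζ : EuclideanSpace ℝ κ) :
    ‖join η ζ‖ ^ 2 = ‖η‖ ^ 2 + ‖ζ‖ ^ 2 := by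
  simp [EuclideanSpace.norm_sq_eq, join]

theorem norm_le_norm_join (η : EuclideanSpace ℝ ι) (ζ : EuclideanSpace ℝ κ) :
    ‖η‖ ≤ ‖join η ζ‖ := by
  refine le_of_sq_le_sq ?_ (norm_nonneg _)
  rw [norm_join_sq]
  nlinarith [sq_nonneg ‖ζ‖]

theorem norm_join_le (η : EuclideanSpace ℝ ι) (ζ : EuclideanSpace ℝ κ) :
    ‖join η ζ‖ ≤ ‖η‖ + ‖ζ‖ := by
  refine le_of_sq_le_sq ?_ (by positivity)
  rw [norm_join_sq]
  nlinarith [norm_nonneg η, norm_nonneg ζ, mul_nonneg (norm_nonneg η) (norm_nonneg ζ)]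

theorem join_sub_join (η : EuclideanSpace ℝ ι) (ζ ζ' : EuclideanSpace ℝ κ) :
    join η ζ - join η ζ' = join 0 (ζ - ζ') := by
  ext i
  rcases i with i | i <;> simp [join]

theorem join_subvec_add (z : EuclideanSpace ℝ (ι ⊕ κ)) (a : ℝ) (t : EuclideanSpace ℝ ι)
    (r : EuclideanSpace ℝ κ) :
    join (subvec Sum.inl z + a • t) (subvec Sum.inr z + a • r) = z + a • join t r := by
  ext i
  rcases i with i | i <;> simp [join, subvec]

theorem subvec_inr_join (η : EuclideanSpace ℝ ι) (ζ : EuclideanSpace ℝ κ) :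
    subvec Sum.inr (join η ζ) = ζ := rfl

/-- The Jacobian cancels against the change of variables in the normalizer, so a rescaled posterior
is again a normalized function. -/
theorem rescaled_div_integral (N : EuclideanSpace ℝ ι → ℝ) (c t : EuclideanSpace ℝ ι) {n : ℕ}
    (hn : 0 < n) :
    rescaled n c (fun η => N η / ∫ η', N η') t =
      N (c + (Real.sqrt n)⁻¹ • t) / ∫ t', N (c + (Real.sqrt n)⁻¹ • t') := by
  have hs : 0 < Real.sqrt n := Real.sqrt_pos.2 (by exact_mod_cast hn)
  rw [integral_comp_add_inv_smul N c hs, rescaled, smul_eq_mul]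
  field_simp

end Join

/-! ### Measurability of the posteriors -/

section Measurability

variable {Ω Y ι κ : Type*} [MeasurableSpace Ω] [MeasurableSpace Y] [Fintype ι] [Fintype κ]
  {x : ℕ → Ω → Y}

theorem measurable_lik {f : EuclideanSpace ℝ ι → Y → ℝ} (hf : Measurable (Function.uncurry f))
    (hx : ∀ i, Measurable (x i)) (n : ℕ) :
    Measurable (fun q : Ω × EuclideanSpace ℝ ι => lik f (fun i => x i q.1) n q.2) :=
  Finset.measurable_fun_prod _ fun l _ =>
    hf.comp (measurable_snd.prodMk ((hx l).comp measurable_fst))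

theorem measurable_knotPosterior {f : EuclideanSpace ℝ κ → Y → ℝ}
    (hf : Measurable (Function.uncurry f)) (hx : ∀ i, Measurable (x i))
    {π : EuclideanSpace ℝ κ → ℝ} (hπ : Measurable π) (n : ℕ) :
    Measurable (fun q : Ω × EuclideanSpace ℝ κ =>
      knotPosterior f π (fun i => x i q.1) n q.2) := by
  have h1 : Measurable (fun q : Ω × EuclideanSpace ℝ κ =>
      lik f (fun i => x i q.1) n q.2 * π q.2) :=
    (measurable_lik hf hx n).mul (hπ.comp measurable_snd)
  have h2 : Measurable (fun ω => ∫ ζ, lik f (fun i => x i ω) n ζ * π ζ) :=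
    (h1.stronglyMeasurable.integral_prod_right' (ν := volume)).measurable
  exact h1.div (h2.comp measurable_fst)

theorem measurable_knotPosteriorMean {f : EuclideanSpace ℝ κ → Y → ℝ}
    (hf : Measurable (Function.uncurry f)) (hx : ∀ i, Measurable (x i))
    {π : EuclideanSpace ℝ κ → ℝ} (hπ : Measurable π) (n : ℕ) :
    Measurable (fun ω => knotPosteriorMean f π (fun i => x i ω) n) := by
  have h1 : Measurable (fun q : Ω × EuclideanSpace ℝ κ =>
      knotPosterior f π (fun i => x i q.1) n q.2 • q.2) :=
    (measurable_knotPosterior hf hx hπ n).smul measurable_snd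
  exact (h1.stronglyMeasurable.integral_prod_right' (ν := volume)).measurable

theorem measurable_tileConditional {f : EuclideanSpace ℝ (ι ⊕ κ) → Y → ℝ}
    (hf : Measurable (Function.uncurry f)) (hx : ∀ i, Measurable (x i))
    {π : EuclideanSpace ℝ (ι ⊕ κ) → ℝ} (hπ : Measurable π) (n : ℕ) :
    Measurable (fun q : Ω × (EuclideanSpace ℝ ι × EuclideanSpace ℝ κ) =>
      tileConditional f π (fun i => x i q.1) n q.2.1 q.2.2) := by
  have h0 : Measurable (fun q : Ω × (EuclideanSpace ℝ ι × EuclideanSpace ℝ κ) =>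
      lik f (fun i => x i q.1) n (join q.2.1 q.2.2) * π (join q.2.1 q.2.2)) :=
    ((measurable_lik hf hx n).comp
      (measurable_fst.prodMk (measurable_join.comp measurable_snd))).mul
      (hπ.comp (measurable_join.comp measurable_snd))
  have h1 : Measurable (fun q : (Ω × EuclideanSpace ℝ κ) × EuclideanSpace ℝ ι =>
      lik f (fun i => x i q.1.1) n (join q.2 q.1.2) * π (join q.2 q.1.2)) :=
    h0.comp ((measurable_fst.comp measurable_fst).prodMk
      (measurable_snd.prodMk (measurable_snd.comp measurable_fst)))
  have h2 := (h1.stronglyMeasurable.integral_prod_right' (ν := volume)).measurable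
  exact h0.div (h2.comp (measurable_fst.prodMk (measurable_snd.comp measurable_snd)))

end Measurability

/-! ### Posteriors of tiles and knots for a fixed sample -/

section Tile

variable {ι κ Y : Type*} [Fintype ι] [Fintype κ] [DecidableEq ι] [DecidableEq κ]
  {Θ₁ : Set (EuclideanSpace ℝ κ)} {Θ₂ : Set (EuclideanSpace ℝ (ι ⊕ κ))}
  {z₀ : EuclideanSpace ℝ (ι ⊕ κ)} {J : Matrix (ι ⊕ κ) (ι ⊕ κ) ℝ}
  {f : EuclideanSpace ℝ (ι ⊕ κ) → Y → ℝ} {x : ℕ → Y} {zhat : ℕ → EuclideanSpace ℝ (ι ⊕ κ)}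
  {π : EuclideanSpace ℝ (ι ⊕ κ) → ℝ}

/-- The conditional posterior of the tiles, given knots at distance `O(n^(-1/2))` of the maximum
likelihood estimator, is asymptotically Gaussian. -/
theorem tendsto_tileConditional (hQ : IsLocallyQuadratic Θ₂ z₀ J (lik f x) zhat)
    (hπ : IsConditionalPrior Θ₁ Θ₂ z₀ π) (hΘ₁ : Θ₁ ∈ 𝓝 (subvec Sum.inr z₀))
    {r s : ℕ → EuclideanSpace ℝ κ} {B : ℝ} (hr : ∀ n, ‖r n‖ ≤ B) (hs : ∀ n, ‖s n‖ ≤ B)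
    (hrs : Tendsto (fun n => r n - s n) atTop (𝓝 0)) :
    Tendsto (fun n : ℕ => l1Dist
      (rescaled n (subvec Sum.inl (zhat n)) (fun η =>
        tileConditional f π x n η (subvec Sum.inr (zhat n) + (Real.sqrt n)⁻¹ • r n)))
      (gaussianDensity (tileMean J (s n)) J.toBlocks₁₁⁻¹)) atTop (𝓝 0) := by
  have hB : 0 ≤ B := (norm_nonneg _).trans (hr 0)
  have h11 := posDef_toBlocks₁₁ hQ.posDef
  set Sc := J.toBlocks₂₂ - J.toBlocks₂₁ * J.toBlocks₁₁⁻¹ * J.toBlocks₁₂ with hSc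
  -- The minimum of the `r`-factor over a compact ball is positive and bounds the slice normalizers
  -- from below, uniformly in `n`.
  obtain ⟨s₀, -, hs₀⟩ := (isCompact_closedBall (0 : EuclideanSpace ℝ κ) B).exists_isMinOn
    ⟨0, by simpa using hB⟩ (continuous_gaussianKernel Sc).continuousOn
  have hW : ∀ n, ∫ t, gaussianKernel J (join t (s n)) =
      (∫ t, gaussianKernel J.toBlocks₁₁ t) * gaussianKernel Sc (s n) := fun n => by
    simp only [gaussianKernel_join hQ.posDef]
    rw [integral_mul_const, integral_gaussianKernel_sub]
  have hmj : ∀ v : EuclideanSpace ℝ κ, Measurable (fun t : EuclideanSpace ℝ ι => join t v) :=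
    fun v => measurable_join.comp measurable_prodMk_right
  -- The conditional prior is known to integrate to one only for knots in `Θ₁`; this gives the prior
  -- mass needed for the tail.
  have hζ : ∀ᶠ n in atTop, subvec Sum.inr (zhat n) + (Real.sqrt n)⁻¹ • r n ∈ Θ₁ := by
    have h1 := (hQ.tendsto_ratio_sub (g := fun n => join 0 (r n)) (h := fun n => join 0 (r n))
      (B := B) (fun n => (norm_join_le _ _).trans (by simpa using hr n))
      (fun n => (norm_join_le _ _).trans (by simpa using hr n)) (by simp)).2
    have h2 := ((continuous_subvec (Sum.inr : κ → ι ⊕ κ)).tendsto z₀).comp h1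
    filter_upwards [h2 hΘ₁] with n hn
    simpa only [Set.mem_preimage, Function.comp_apply, ← join_subvec_add, subvec_inr_join] using hn
  have key := hQ.tendsto_posterior hπ.measurable hπ.nonneg hπ.eq_zero_of_notMem hπ.continuousAt
    hπ.pos (p := fun n t => join t (r n)) (g := fun n t => join t (s n)) (fun n => hmj _)
    (fun n => hmj _) (fun n t => norm_le_norm_join _ _) (fun n t => norm_le_norm_join _ _)
    (fun t => ⟨‖t‖ + B, fun n => ⟨(norm_join_le _ _).trans (by gcongr; exact hr n),
      (norm_join_le _ _).trans (by gcongr; exact hs n)⟩⟩)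
    (fun t => by
      rw [tendsto_zero_iff_norm_tendsto_zero] at hrs ⊢
      refine squeeze_zero (fun n => norm_nonneg _) (fun n => ?_) hrs
      rw [join_sub_join]
      exact (norm_join_le _ _).trans (by simp))
    (ρ := fun _ => 1) measurable_const (fun _ => le_rfl) (fun t => by simp)
    (c₀ := (∫ t, gaussianKernel J.toBlocks₁₁ t) * gaussianKernel Sc s₀)
    (mul_pos (integral_gaussianKernel_pos h11) (gaussianKernel_pos _ _))
    (fun n => by
      rw [hW n]
      have := (integral_gaussianKernel_pos h11).le
      gcongr
      exact hs₀ (by simpa using hs n))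
    (k := Fintype.card ι) (D := 1) (by
      filter_upwards [hζ, eventually_gt_atTop 0] with n hn hn0
      have hsq : 0 < Real.sqrt n := Real.sqrt_pos.2 (by exact_mod_cast hn0)
      simp only [one_mul, ← join_subvec_add]
      rw [lintegral_comp_add_inv_smul (fun η => ENNReal.ofReal (π (join η
        (subvec Sum.inr (zhat n) + (Real.sqrt n)⁻¹ • r n)))) _ hsq]
      have h1 := hπ.integral_eq_one _ hn
      rw [← ofReal_integral_eq_lintegral_ofReal
        (Integrable.of_integral_ne_zero (by rw [h1]; exact one_ne_zero))
        (Eventually.of_forall fun η => hπ.nonneg _), h1, ENNReal.ofReal_one, mul_one]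
      exact ENNReal.ofReal_le_ofReal (pow_le_pow_left₀ hsq.le (by linarith) _))
  refine key.congr' ?_
  filter_upwards [eventually_gt_atTop 0] with n hn0
  refine lintegral_congr fun t => ?_
  simp only [ENNReal.ofReal_one, one_mul]
  congr 2
  · symm
    refine (rescaled_div_integral (fun η => lik f x n (join η _) * π (join η _)) _ t hn0).trans ?_
    simp only [join_subvec_add]
  · rw [hW n, gaussianKernel_join hQ.posDef, gaussianDensity_inv_eq h11,
      mul_div_mul_right _ _ (gaussianKernel_pos _ _).ne']

end Tile

section Knot

variable {κ Y : Type*} [Fintype κ] [DecidableEq κ]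
  {Θ : Set (EuclideanSpace ℝ κ)} {ζ₀ : EuclideanSpace ℝ κ} {K : Matrix κ κ ℝ}
  {f : EuclideanSpace ℝ κ → Y → ℝ} {x : ℕ → Y} {ζt : ℕ → EuclideanSpace ℝ κ}
  {π : EuclideanSpace ℝ κ → ℝ}

/-- The posterior of the knots is asymptotically Gaussian, in total variation weighted by
`1 + ‖h‖`. -/
theorem tendsto_knotPosterior (hQ : IsLocallyQuadratic Θ ζ₀ K (lik f x) ζt)
    (hπ : IsPrior Θ ζ₀ π) (hmean : Integrable (fun ζ => π ζ • ζ)) :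
    Tendsto (fun n : ℕ => ∫⁻ h, ENNReal.ofReal (1 + ‖h‖) *
      ‖rescaled n (ζt n) (knotPosterior f π x n) h - gaussianDensity 0 K⁻¹ h‖ₑ) atTop (𝓝 0) := by
  have hπi : Integrable π := Integrable.of_integral_ne_zero (by rw [hπ.integral_eq_one]; simp)
  have hπi2 : Integrable (fun z => (1 + ‖z‖) * π z) := by
    refine (hπi.add hmean.norm).congr (Eventually.of_forall fun z => ?_)
    simp [norm_smul, abs_of_nonneg (hπ.nonneg z)]; ring
  have hnt : ∀ᶠ n in atTop, ‖ζt n‖ ≤ ‖ζ₀‖ + 1 :=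
    hQ.tendsto.norm.eventually_le_const (by linarith)
  set b := ‖ζ₀‖ + 1 with hb
  have hb0 : 0 ≤ b := by positivity
  have key := hQ.tendsto_posterior hπ.measurable hπ.nonneg hπ.eq_zero_of_notMem hπ.continuousAt
    hπ.pos (p := fun _ h => h) (g := fun _ h => h) (fun n => measurable_id)
    (fun n => measurable_id) (fun n t => le_rfl) (fun n t => le_rfl)
    (fun t => ⟨‖t‖, fun n => ⟨le_rfl, le_rfl⟩⟩) (fun t => by simp)
    (ρ := fun h => 1 + ‖h‖) (by fun_prop) (fun h => by simp) (fun h => le_rfl)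
    (c₀ := ∫ t, gaussianKernel K t)
    (integral_gaussianKernel_pos hQ.posDef) (fun n => le_rfl)
    -- The Jacobian contributes `card κ` powers of `√n`, and the weight `1 + √n * ‖z - ζt n‖` one
    -- more; its integral is finite because the prior has a mean.
    (k := Fintype.card κ + 1) (D := (1 + b) * ∫ z, (1 + ‖z‖) * π z) (by
      filter_upwards [hnt, eventually_gt_atTop 0] with n hn hn0
      have hsq : 0 < Real.sqrt n := Real.sqrt_pos.2 (by exact_mod_cast hn0)
      obtain ⟨F, hF⟩ : ∃ F : EuclideanSpace ℝ κ → ℝ≥0∞,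
        F = fun z => ENNReal.ofReal ((1 + ‖Real.sqrt n • (z - ζt n)‖) * π z) := ⟨_, rfl⟩
      have h1 : ∀ h : EuclideanSpace ℝ κ,
          ENNReal.ofReal ((1 + ‖h‖) * π (ζt n + (Real.sqrt n)⁻¹ • h)) =
          F (ζt n + (Real.sqrt n)⁻¹ • h) := by
        intro h
        simp only [hF, add_sub_cancel_left, smul_smul, mul_inv_cancel₀ hsq.ne', one_smul]
      simp only [h1]
      rw [lintegral_comp_add_inv_smul _ _ hsq]
      have h2 : ∫⁻ z, F z ≤
          ENNReal.ofReal ((1 + Real.sqrt n) * ((1 + b) * ∫ z, (1 + ‖z‖) * π z)) := by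
        rw [hF, ← integral_const_mul, ← integral_const_mul, ofReal_integral_eq_lintegral_ofReal
          ((hπi2.const_mul _).const_mul _) (Eventually.of_forall fun z => by
            have := hπ.nonneg z
            positivity)]
        refine lintegral_mono fun z => ENNReal.ofReal_le_ofReal ?_
        rw [← mul_assoc, ← mul_assoc]
        have h3 := hπ.nonneg z
        gcongr
        rw [norm_smul, Real.norm_of_nonneg hsq.le]
        have h4 : ‖z - ζt n‖ ≤ (1 + b) * (1 + ‖z‖) := by
          have := norm_sub_le z (ζt n)
          nlinarith [norm_nonneg z, mul_nonneg hb0 (norm_nonneg z)]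
        have h5 : 1 ≤ (1 + b) * (1 + ‖z‖) := by
          nlinarith [norm_nonneg z, mul_nonneg hb0 (norm_nonneg z)]
        nlinarith
      refine (mul_le_mul_right h2 _).trans ?_
      rw [← ENNReal.ofReal_mul (by positivity)]
      refine ENNReal.ofReal_le_ofReal ?_
      have h3 : 0 ≤ ∫ z, (1 + ‖z‖) * π z := integral_nonneg fun z =>
        mul_nonneg (by positivity) (hπ.nonneg z)
      calc Real.sqrt n ^ Fintype.card κ * ((1 + Real.sqrt n) * ((1 + b) * ∫ z, (1 + ‖z‖) * π z))
          ≤ (1 + Real.sqrt n) ^ Fintype.card κ *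
            ((1 + Real.sqrt n) * ((1 + b) * ∫ z, (1 + ‖z‖) * π z)) := by
            gcongr; linarith
        _ = _ := by rw [pow_succ]; ring)
  refine key.congr' ?_
  filter_upwards [eventually_gt_atTop 0] with n hn0
  refine lintegral_congr fun t => ?_
  congr 3
  · exact (rescaled_div_integral (fun ζ => lik f x n ζ * π ζ) _ t hn0).symm
  · rw [gaussianDensity_inv_eq hQ.posDef, sub_zero]

theorem lik_mul_prior_nonneg (hQ : IsLocallyQuadratic Θ ζ₀ K (lik f x) ζt)
    (hπ : IsPrior Θ ζ₀ π) (n : ℕ) (ζ : EuclideanSpace ℝ κ) : 0 ≤ lik f x n ζ * π ζ := by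
  by_cases h : ζ ∈ Θ
  · exact mul_nonneg (hQ.nonneg n ζ h) (hπ.nonneg ζ)
  · simp [hπ.eq_zero_of_notMem ζ h]

theorem lintegral_rescaled_knotPosterior_le_one (hQ : IsLocallyQuadratic Θ ζ₀ K (lik f x) ζt)
    (hπ : IsPrior Θ ζ₀ π) (c : EuclideanSpace ℝ κ) {n : ℕ} (hn : 0 < n) :
    ∫⁻ r, ‖rescaled n c (knotPosterior f π x n) r‖ₑ ≤ 1 := by
  have h1 : ∀ r, rescaled n c (knotPosterior f π x n) r = _ := fun r =>
    rescaled_div_integral (fun ζ => lik f x n ζ * π ζ) c r hn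
  simp only [h1]
  exact lintegral_enorm_div_integral_le_one fun r => lik_mul_prior_nonneg hQ hπ n _

theorem lintegral_gaussianDensity_inv (hK : K.PosDef) (m : EuclideanSpace ℝ κ) :
    ∫⁻ r, ‖gaussianDensity m K⁻¹ r‖ₑ = 1 := by
  have hp := integral_gaussianKernel_pos hK
  simp only [gaussianDensity_inv_eq hK]
  have h0 : ∀ r, 0 ≤ gaussianKernel K (r - m) / ∫ h, gaussianKernel K h := fun r =>
    div_nonneg (gaussianKernel_pos _ _).le hp.le
  rw [lintegral_congr fun r => Real.enorm_eq_ofReal (h0 r),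
    ← ofReal_integral_eq_lintegral_ofReal
      (((integrable_gaussianKernel hK).comp_sub_right m).div_const _)
      (Eventually.of_forall h0), integral_div, integral_gaussianKernel_sub, div_self hp.ne',
    ENNReal.ofReal_one]

/-- The posterior mean of the knots is asymptotically equivalent to the maximizer of the
likelihood. -/
theorem tendsto_sqrt_smul_knotPosteriorMean_sub
    (hQ : IsLocallyQuadratic Θ ζ₀ K (lik f x) ζt)
    (hπ : IsPrior Θ ζ₀ π) (hmean : Integrable (fun ζ => π ζ • ζ)) :
    Tendsto (fun n : ℕ => Real.sqrt n • (knotPosteriorMean f π x n - ζt n)) atTop (𝓝 0) := by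
  have hD := tendsto_knotPosterior hQ hπ hmean
  rw [tendsto_zero_iff_enorm_tendsto_zero]
  refine tendsto_of_tendsto_of_tendsto_of_le_of_le' tendsto_const_nhds hD
    (Eventually.of_forall fun n => zero_le) ?_
  filter_upwards [hD.eventually_lt_const one_pos, eventually_gt_atTop 0, hQ.le_max]
    with n hn hn0 hmax
  have hsq : 0 < Real.sqrt n := Real.sqrt_pos.2 (by exact_mod_cast hn0)
  have hπi : Integrable π := Integrable.of_integral_ne_zero (by rw [hπ.integral_eq_one]; simp)
  set N : EuclideanSpace ℝ κ → ℝ := fun ζ => lik f x n ζ * π ζ with hN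
  have hNm : Measurable N := (hQ.measurable n).mul hπ.measurable
  -- The likelihood is bounded by its maximum, so the posterior inherits integrability and a first
  -- moment from the prior.
  have hNb : ∀ ζ, ‖N ζ‖ ≤ lik f x n (ζt n) * π ζ := by
    intro ζ
    rw [Real.norm_of_nonneg (lik_mul_prior_nonneg hQ hπ n ζ)]
    by_cases h : ζ ∈ Θ
    · exact mul_le_mul_of_nonneg_right (hmax ζ h) (hπ.nonneg ζ)
    · simp [hπ.eq_zero_of_notMem ζ h]
  have hNi : Integrable N := (hπi.const_mul _).mono' hNm.aestronglyMeasurable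
    (Eventually.of_forall hNb)
  have hNzi : Integrable (fun ζ => N ζ • ζ) := by
    refine (hmean.norm.const_mul (lik f x n (ζt n))).mono'
      (hNm.smul measurable_id).aestronglyMeasurable (Eventually.of_forall fun ζ => ?_)
    rw [norm_smul, norm_smul, Real.norm_of_nonneg (hπ.nonneg ζ), ← mul_assoc]
    have := hNb ζ
    gcongr
  -- With a zero normalizer the posterior would be identically zero by convention, at weighted
  -- distance at least one from a probability density; the distance is already below one.
  have hI : ∫ ζ, N ζ ≠ 0 := by
    intro h0
    refine absurd hn (not_lt.2 ?_)
    have h1 : ∀ h, rescaled n (ζt n) (knotPosterior f π x n) h = 0 := fun h => by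
      have : knotPosterior f π x n (ζt n + (Real.sqrt n)⁻¹ • h) = 0 := by
        rw [knotPosterior]
        change _ / (∫ ζ, N ζ) = 0
        rw [h0, div_zero]
      rw [rescaled, this, mul_zero]
    rw [← lintegral_gaussianDensity_inv hQ.posDef (0 : EuclideanSpace ℝ κ)]
    refine lintegral_mono fun h => ?_
    rw [h1, zero_sub, enorm_neg]
    refine le_mul_of_one_le_left' ?_
    simp
  set k := knotPosterior f π x n with hk
  have hkN : ∀ ζ, k ζ = N ζ / ∫ ζ, N ζ := fun ζ => rfl
  have hki : Integrable k := hNi.div_const _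
  have hk1 : ∫ ζ, k ζ = 1 := by
    simp only [hkN]; rw [integral_div, div_self hI]
  have hkzi : Integrable (fun ζ => k ζ • ζ) := by
    refine (hNzi.smul (∫ ζ, N ζ)⁻¹).congr (Eventually.of_forall fun ζ => ?_)
    simp only [hkN, Pi.smul_apply, smul_smul]
    congr 1; ring
  have hcm : ∫ ζ, k ζ • (ζ - ζt n) = knotPosteriorMean f π x n - ζt n := by
    simp only [smul_sub]
    rw [integral_sub hkzi (hki.smul_const _), integral_smul_const, hk1, one_smul]
    rfl
  set q := rescaled n (ζt n) k with hq
  obtain ⟨F, hF⟩ : ∃ F : EuclideanSpace ℝ κ → EuclideanSpace ℝ κ,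
    F = fun z => (Real.sqrt n ^ Fintype.card κ)⁻¹ • (Real.sqrt n • (k z • (z - ζt n))) := ⟨_, rfl⟩
  have hqF : ∀ h, q h • h = F (ζt n + (Real.sqrt n)⁻¹ • h) := by
    intro h
    simp only [hF, hq, rescaled, add_sub_cancel_left, smul_smul]
    congr 1
    field_simp
  have hqint : ∫ h, q h • h = Real.sqrt n • (knotPosteriorMean f π x n - ζt n) := by
    simp only [hqF]
    rw [integral_comp_add_inv_smul _ _ hsq, hF, integral_smul, integral_smul, hcm, smul_smul,
      mul_inv_cancel₀ (by positivity), one_smul]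
  have hqi : Integrable (fun h => q h • h) := by
    simp only [hqF]
    have h1 : Integrable F := by
      have h2 : Integrable (fun z => k z • (z - ζt n)) := by
        simp only [smul_sub]
        exact hkzi.sub (hki.smul_const _)
      rw [hF]
      exact (h2.smul (Real.sqrt n)).smul ((Real.sqrt n ^ Fintype.card κ)⁻¹)
    exact (h1.comp_add_left (ζt n)).comp_smul (inv_ne_zero hsq.ne')
  have hqm : Measurable q := by
    have : Measurable k := hNm.div_const _
    unfold q rescaled
    fun_prop
  have hgm : Measurable (gaussianDensity (0 : EuclideanSpace ℝ κ) K⁻¹) := by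
    have : gaussianDensity (0 : EuclideanSpace ℝ κ) K⁻¹ =
      fun h => gaussianKernel K h / ∫ h, gaussianKernel K h := by
      ext h; rw [gaussianDensity_inv_eq hQ.posDef, sub_zero]
    rw [this]
    exact (continuous_gaussianKernel K).measurable.div_const _
  have hbound : ∫⁻ h, ‖(q h - gaussianDensity 0 K⁻¹ h) • h‖ₑ ≤
      ∫⁻ h, ENNReal.ofReal (1 + ‖h‖) * ‖q h - gaussianDensity 0 K⁻¹ h‖ₑ := by
    refine lintegral_mono fun h => ?_
    rw [enorm_smul, mul_comm]
    gcongr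
    rw [← ofReal_norm]
    exact ENNReal.ofReal_le_ofReal (by linarith)
  have hdi : Integrable (fun h => (q h - gaussianDensity 0 K⁻¹ h) • h) :=
    ⟨((hqm.sub hgm).smul measurable_id).aestronglyMeasurable,
      (hbound.trans_lt hn).trans ENNReal.one_lt_top⟩
  have hgi : Integrable (fun h => gaussianDensity (0 : EuclideanSpace ℝ κ) K⁻¹ h • h) := by
    refine (hqi.sub hdi).congr (Eventually.of_forall fun h => ?_)
    simp only [Pi.sub_apply, sub_smul, sub_sub_cancel]
  have hg0 : ∫ h, gaussianDensity (0 : EuclideanSpace ℝ κ) K⁻¹ h • h = 0 := by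
    have : ∀ h, gaussianDensity (0 : EuclideanSpace ℝ κ) K⁻¹ h • h =
        (∫ h, gaussianKernel K h)⁻¹ • (gaussianKernel K h • h) := fun h => by
      rw [gaussianDensity_inv_eq hQ.posDef, sub_zero, smul_smul, div_eq_inv_mul]
    simp only [this]
    rw [integral_smul, integral_gaussianKernel_smul_self, smul_zero]
  -- The Gaussian is centred, so the rescaled mean is a first moment of the difference of the
  -- densities, which the weight `1 + ‖h‖` controls.
  have hfin : Real.sqrt n • (knotPosteriorMean f π x n - ζt n) =
      ∫ h, (q h - gaussianDensity 0 K⁻¹ h) • h := by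
    simp only [sub_smul]
    rw [integral_sub hqi hgi, hg0, sub_zero, hqint]
  rw [hfin]
  exact (enorm_integral_le_lintegral_enorm _).trans hbound

end Knot

/-! ### Plug-in and exact tile posteriors for a fixed sample -/

section Mixture

variable {ι κ : Type*} [Fintype ι] [Fintype κ]

/-- Write `a b - a' b' = a (b - b') + b' (a - a')` and apply Tonelli: the kernels `a` have mass at
most one, so the first part costs only the distance of the mixing densities. -/
theorem l1Dist_integral_mul_le {a a' : EuclideanSpace ℝ ι → EuclideanSpace ℝ κ → ℝ}
    {b b' : EuclideanSpace ℝ κ → ℝ} (ha : Measurable (Function.uncurry a))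
    (ha' : Measurable (Function.uncurry a')) (hb : Measurable b) (hb' : Measurable b')
    (ha1 : ∀ r, ∫⁻ t, ‖a t r‖ₑ ≤ 1) (ha1' : ∀ r, ∫⁻ t, ‖a' t r‖ₑ ≤ 1)
    (hb1 : ∫⁻ r, ‖b r‖ₑ ≠ ∞) (hb1' : ∫⁻ r, ‖b' r‖ₑ ≠ ∞) :
    l1Dist (fun t => ∫ r, a t r * b r) (fun t => ∫ r, a' t r * b' r) ≤
      (∫⁻ r, ‖b r - b' r‖ₑ) + ∫⁻ r, ‖b' r‖ₑ * ∫⁻ t, ‖a t r - a' t r‖ₑ := by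
  have hint : ∀ {a : EuclideanSpace ℝ ι → EuclideanSpace ℝ κ → ℝ} {b : EuclideanSpace ℝ κ → ℝ},
      Measurable (Function.uncurry a) → Measurable b → (∀ r, ∫⁻ t, ‖a t r‖ₑ ≤ 1) →
      ∫⁻ r, ‖b r‖ₑ ≠ ∞ → ∀ᵐ t, Integrable (fun r => a t r * b r) := by
    intro a b ha hb ha1 hb1
    have hm : Measurable (fun q : EuclideanSpace ℝ ι × EuclideanSpace ℝ κ => ‖a q.1 q.2 * b q.2‖ₑ) :=
      (ha.mul (hb.comp measurable_snd)).enorm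
    have hfin : ∫⁻ t, ∫⁻ r, ‖a t r * b r‖ₑ ≠ ∞ := by
      rw [lintegral_lintegral_swap hm.aemeasurable]
      refine ne_top_of_le_ne_top hb1 (lintegral_mono fun r => ?_)
      simp only [enorm_mul]
      rw [lintegral_mul_const' _ _ enorm_ne_top]
      exact mul_le_of_le_one_left' (ha1 r)
    filter_upwards [ae_lt_top hm.lintegral_prod_right' hfin] with t ht
    exact ⟨((ha.comp measurable_prodMk_left).mul hb).aestronglyMeasurable, ht⟩
  have hmA : Measurable (fun q : EuclideanSpace ℝ ι × EuclideanSpace ℝ κ =>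
      ‖a q.1 q.2‖ₑ * ‖b q.2 - b' q.2‖ₑ) :=
    ha.enorm.mul ((hb.sub hb').comp measurable_snd).enorm
  have hmB : Measurable (fun q : EuclideanSpace ℝ ι × EuclideanSpace ℝ κ =>
      ‖b' q.2‖ₑ * ‖a q.1 q.2 - a' q.1 q.2‖ₑ) :=
    (hb'.comp measurable_snd).enorm.mul (ha.sub ha').enorm
  calc l1Dist (fun t => ∫ r, a t r * b r) (fun t => ∫ r, a' t r * b' r)
      ≤ ∫⁻ t, ∫⁻ r, (‖a t r‖ₑ * ‖b r - b' r‖ₑ + ‖b' r‖ₑ * ‖a t r - a' t r‖ₑ) := by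
        refine lintegral_mono_ae ?_
        filter_upwards [hint ha hb ha1 hb1, hint ha' hb' ha1' hb1'] with t h1 h2
        rw [← integral_sub h1 h2]
        refine (enorm_integral_le_lintegral_enorm _).trans (lintegral_mono fun r => ?_)
        have : a t r * b r - a' t r * b' r = a t r * (b r - b' r) + b' r * (a t r - a' t r) := by
          ring
        simp only
        rw [this, ← enorm_mul, ← enorm_mul]
        exact enorm_add_le _ _
    _ = ∫⁻ r, ∫⁻ t, (‖a t r‖ₑ * ‖b r - b' r‖ₑ + ‖b' r‖ₑ * ‖a t r - a' t r‖ₑ) :=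
        lintegral_lintegral_swap (hmA.add hmB).aemeasurable
    _ = ∫⁻ r, ((∫⁻ t, ‖a t r‖ₑ) * ‖b r - b' r‖ₑ + ‖b' r‖ₑ * ∫⁻ t, ‖a t r - a' t r‖ₑ) := by
        refine lintegral_congr fun r => ?_
        have hm : Measurable (fun t => ‖a t r‖ₑ * ‖b r - b' r‖ₑ) :=
          hmA.comp measurable_prodMk_right
        rw [lintegral_add_left hm, lintegral_mul_const' _ _ enorm_ne_top, lintegral_const_mul' _ _ enorm_ne_top]
    _ ≤ ∫⁻ r, (‖b r - b' r‖ₑ + ‖b' r‖ₑ * ∫⁻ t, ‖a t r - a' t r‖ₑ) := by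
        refine lintegral_mono fun r => ?_
        gcongr
        exact mul_le_of_le_one_left' (ha1 r)
    _ = _ := lintegral_add_left (hb.sub hb').enorm _

theorem continuous_gaussianDensity [DecidableEq ι] (S : Matrix ι ι ℝ) :
    Continuous (fun q : EuclideanSpace ℝ ι × EuclideanSpace ℝ ι => gaussianDensity q.1 S q.2) := by
  unfold gaussianDensity dotProduct Matrix.mulVec dotProduct
  fun_prop

theorem measurable_gaussianDensity [DecidableEq ι] (S : Matrix ι ι ℝ) {α : Type*}
    [MeasurableSpace α] {m g : α → EuclideanSpace ℝ ι} (hm : Measurable m) (hg : Measurable g) :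
    Measurable (fun a => gaussianDensity (m a) S (g a)) := by
  have h := (continuous_gaussianDensity S).measurable.comp (hm.prodMk hg)
  exact h

theorem measurable_l1Dist {Ω : Type*} [MeasurableSpace Ω] {G H : Ω → EuclideanSpace ℝ ι → ℝ}
    (hG : Measurable (Function.uncurry G)) (hH : Measurable (Function.uncurry H)) :
    Measurable (fun ω => l1Dist (G ω) (H ω)) :=
  (hG.sub hH).enorm.lintegral_prod_right'

end Mixture

/-! ### Joint measurability of the densities in sample and argument -/

section MeasurableDist

variable {Ω Y ι κ : Type*} [MeasurableSpace Ω] [MeasurableSpace Y] [Fintype ι] [Fintype κ]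
  [DecidableEq ι] {x : ℕ → Ω → Y}
  {f₁ : EuclideanSpace ℝ κ → Y → ℝ} {f₂ : EuclideanSpace ℝ (ι ⊕ κ) → Y → ℝ}
  {π₁ : EuclideanSpace ℝ κ → ℝ} {π₂ : EuclideanSpace ℝ (ι ⊕ κ) → ℝ}

theorem measurable_plugInTile (hf₁ : Measurable (Function.uncurry f₁))
    (hf₂ : Measurable (Function.uncurry f₂)) (hx : ∀ i, Measurable (x i)) (hπ₁ : Measurable π₁)
    (hπ₂ : Measurable π₂) (n : ℕ) {z : Ω → EuclideanSpace ℝ (ι ⊕ κ)} (hz : Measurable z) :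
    Measurable (fun q : Ω × EuclideanSpace ℝ ι =>
      plugInTile f₁ π₁ f₂ π₂ (fun i => x i q.1) n (z q.1) q.2) := by
  have h1 := measurable_tileConditional hf₂ hx hπ₂ n
  have h2 := measurable_knotPosteriorMean hf₁ hx hπ₁ n
  have h3 : Measurable (fun q : Ω × EuclideanSpace ℝ ι =>
      subvec Sum.inl (z q.1) + (Real.sqrt n)⁻¹ • q.2) :=
    ((continuous_subvec Sum.inl).measurable.comp (hz.comp measurable_fst)).add
      (measurable_snd.const_smul (Real.sqrt n)⁻¹)
  have h4 := h1.comp (measurable_fst.prodMk (h3.prodMk (h2.comp measurable_fst)))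
  exact h4.const_mul _

theorem measurable_exactTile (hf₁ : Measurable (Function.uncurry f₁))
    (hf₂ : Measurable (Function.uncurry f₂)) (hx : ∀ i, Measurable (x i)) (hπ₁ : Measurable π₁)
    (hπ₂ : Measurable π₂) (n : ℕ) {z : Ω → EuclideanSpace ℝ (ι ⊕ κ)} (hz : Measurable z) :
    Measurable (fun q : Ω × EuclideanSpace ℝ ι =>
      exactTile f₁ π₁ f₂ π₂ (fun i => x i q.1) n (z q.1) q.2) := by
  have h1 := measurable_tileConditional hf₂ hx hπ₂ n
  have h2 := measurable_knotPosterior hf₁ hx hπ₁ n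
  have hω : Measurable (fun q : (Ω × EuclideanSpace ℝ ι) × EuclideanSpace ℝ κ => q.1.1) :=
    measurable_fst.comp measurable_fst
  have h3 : Measurable (fun q : (Ω × EuclideanSpace ℝ ι) × EuclideanSpace ℝ κ =>
      subvec Sum.inl (z q.1.1) + (Real.sqrt n)⁻¹ • q.1.2) :=
    ((continuous_subvec Sum.inl).measurable.comp (hz.comp hω)).add
      ((measurable_snd.comp measurable_fst).const_smul (Real.sqrt n)⁻¹)
  have h4 : Measurable (fun q : (Ω × EuclideanSpace ℝ ι) × EuclideanSpace ℝ κ =>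
      subvec Sum.inr (z q.1.1) + (Real.sqrt n)⁻¹ • q.2) :=
    ((continuous_subvec Sum.inr).measurable.comp (hz.comp hω)).add
      (measurable_snd.const_smul (Real.sqrt n)⁻¹)
  have h5 := ((h1.comp (hω.prodMk (h3.prodMk h4))).const_mul
      ((Real.sqrt n ^ Fintype.card ι)⁻¹)).mul
    ((h2.comp (hω.prodMk h4)).const_mul ((Real.sqrt n ^ Fintype.card κ)⁻¹))
  exact (h5.stronglyMeasurable.integral_prod_right' (ν := volume)).measurable

theorem measurable_gaussianDensity_tileMean (J : Matrix (ι ⊕ κ) (ι ⊕ κ) ℝ) (S : Matrix ι ι ℝ)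
    {m : Ω → EuclideanSpace ℝ κ} (hm : Measurable m) :
    Measurable (fun q : Ω × EuclideanSpace ℝ ι => gaussianDensity (tileMean J (m q.1)) S q.2) := by
  have h : Measurable (fun q : Ω × EuclideanSpace ℝ ι => tileMean J (m q.1)) :=
    (continuous_tileMean J).measurable.comp (hm.comp measurable_fst)
  exact measurable_gaussianDensity S h measurable_snd

end MeasurableDist

/-! ### Approximation of both tile posteriors along one sample -/

section FixedSample

variable {ι κ Y : Type*} [Fintype ι] [Fintype κ] [DecidableEq ι] [DecidableEq κ]
  [MeasurableSpace Y]
  {Θ₁ : Set (EuclideanSpace ℝ κ)} {Θ₂ : Set (EuclideanSpace ℝ (ι ⊕ κ))}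
  {z₀ : EuclideanSpace ℝ (ι ⊕ κ)} {J : Matrix (ι ⊕ κ) (ι ⊕ κ) ℝ} {K : Matrix κ κ ℝ}
  {f₁ : EuclideanSpace ℝ κ → Y → ℝ} {f₂ : EuclideanSpace ℝ (ι ⊕ κ) → Y → ℝ} {x : ℕ → Y}
  {ζt : ℕ → EuclideanSpace ℝ κ} {zhat : ℕ → EuclideanSpace ℝ (ι ⊕ κ)}
  {π₁ : EuclideanSpace ℝ κ → ℝ} {π₂ : EuclideanSpace ℝ (ι ⊕ κ) → ℝ}

/-- `μ n` may be unbounded along the sample, so the claim concerns only those `n` with `‖μ n‖ ≤ M`;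
setting the other terms to zero gives a bounded sequence to which the slice theorem applies. -/
theorem eventually_l1Dist_plugInTile_le
    (hQ₁ : IsLocallyQuadratic Θ₁ (subvec Sum.inr z₀) K (lik f₁ x) ζt)
    (hQ₂ : IsLocallyQuadratic Θ₂ z₀ J (lik f₂ x) zhat)
    (hπ₁ : IsPrior Θ₁ (subvec Sum.inr z₀) π₁) (hmean : Integrable (fun ζ => π₁ ζ • ζ))
    (hπ₂ : IsConditionalPrior Θ₁ Θ₂ z₀ π₂) (hΘ₁ : Θ₁ ∈ 𝓝 (subvec Sum.inr z₀))
    (M : ℝ) {ε : ℝ≥0∞} (hε : 0 < ε) :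
    ∀ᶠ n : ℕ in atTop, ‖Real.sqrt n • (ζt n - subvec Sum.inr (zhat n))‖ ≤ M →
      l1Dist (plugInTile f₁ π₁ f₂ π₂ x n (zhat n))
        (gaussianDensity (tileMean J (Real.sqrt n • (ζt n - subvec Sum.inr (zhat n))))
          J.toBlocks₁₁⁻¹) ≤ ε := by
  set μ : ℕ → EuclideanSpace ℝ κ :=
    fun n => Real.sqrt n • (ζt n - subvec Sum.inr (zhat n)) with hμ
  have hd := tendsto_sqrt_smul_knotPosteriorMean_sub hQ₁ hπ₁ hmean
  set d : ℕ → EuclideanSpace ℝ κ :=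
    fun n => Real.sqrt n • (knotPosteriorMean f₁ π₁ x n - ζt n) with hdd
  obtain ⟨B, hB⟩ := (Metric.isBounded_range_of_tendsto _ hd).exists_norm_le
  have hB0 : 0 ≤ B := (norm_nonneg _).trans (hB _ ⟨0, rfl⟩)
  set s : ℕ → EuclideanSpace ℝ κ := fun n => if ‖μ n‖ ≤ M then μ n else 0 with hs
  have hsb : ∀ n, ‖s n‖ ≤ max M 0 := by
    intro n
    simp only [hs]
    split_ifs with h
    · exact h.trans (le_max_left _ _)
    · simp
  -- The posterior mean of the knots has rescaled coordinate `μ n + d n` around `ζ̂ₙ`, with `d n →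
  -- 0`.
  have key := tendsto_tileConditional hQ₂ hπ₂ hΘ₁ (r := fun n => s n + d n) (s := s)
    (B := max M 0 + B)
    (fun n => (norm_add_le _ _).trans (add_le_add (hsb n) (hB _ ⟨n, rfl⟩)))
    (fun n => (hsb n).trans (by linarith)) (by simpa using hd)
  filter_upwards [key.eventually_le_const hε, eventually_gt_atTop 0] with n hn hn0 hM
  have hsq : 0 < Real.sqrt n := Real.sqrt_pos.2 (by exact_mod_cast hn0)
  have h1 : s n = μ n := if_pos hM
  have h2 : subvec Sum.inr (zhat n) + (Real.sqrt n)⁻¹ • (s n + d n) =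
      knotPosteriorMean f₁ π₁ x n := by
    rw [h1]
    simp only [hμ, hdd, ← smul_add, smul_smul, inv_mul_cancel₀ hsq.ne', one_smul]
    abel
  rw [h2, h1] at hn
  exact hn

/-- Unweighted `L¹` distance is translation invariant, so the centre can be moved from the knot
maximizer to any `c n`, in particular to `ζ̂ₙ`. -/
theorem tendsto_l1Dist_rescaled_knotPosterior
    {ζ₀ : EuclideanSpace ℝ κ} (hQ₁ : IsLocallyQuadratic Θ₁ ζ₀ K (lik f₁ x) ζt)
    (hπ₁ : IsPrior Θ₁ ζ₀ π₁) (hmean : Integrable (fun ζ => π₁ ζ • ζ))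
    (c : ℕ → EuclideanSpace ℝ κ) :
    Tendsto (fun n : ℕ => ∫⁻ r, ‖rescaled n (c n) (knotPosterior f₁ π₁ x n) r -
      gaussianDensity (Real.sqrt n • (ζt n - c n)) K⁻¹ r‖ₑ) atTop (𝓝 0) := by
  refine tendsto_of_tendsto_of_tendsto_of_le_of_le' tendsto_const_nhds
    (tendsto_knotPosterior hQ₁ hπ₁ hmean) (Eventually.of_forall fun n => zero_le) ?_
  filter_upwards [eventually_gt_atTop 0] with n hn0
  have hsq : 0 < Real.sqrt n := Real.sqrt_pos.2 (by exact_mod_cast hn0)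
  rw [← lintegral_add_right_eq_self _ (Real.sqrt n • (ζt n - c n))]
  refine lintegral_mono fun h => ?_
  have h1 : rescaled n (c n) (knotPosterior f₁ π₁ x n) (h + Real.sqrt n • (ζt n - c n)) =
      rescaled n (ζt n) (knotPosterior f₁ π₁ x n) h := by
    rw [rescaled, rescaled, smul_add, smul_smul, inv_mul_cancel₀ hsq.ne', one_smul]
    congr 2
    abel
  simp only
  rw [h1, gaussianDensity_inv_eq hQ₁.posDef, gaussianDensity_inv_eq hQ₁.posDef,
    add_sub_cancel_right, sub_zero]
  exact le_mul_of_one_le_left' (by simp)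

theorem lintegral_rescaled_tileConditional_le_one
    (hQ₂ : IsLocallyQuadratic Θ₂ z₀ J (lik f₂ x) zhat)
    (hπ₂ : IsConditionalPrior Θ₁ Θ₂ z₀ π₂) (c : EuclideanSpace ℝ ι) (ζ : EuclideanSpace ℝ κ)
    {n : ℕ} (hn : 0 < n) :
    ∫⁻ t, ‖rescaled n c (fun η => tileConditional f₂ π₂ x n η ζ) t‖ₑ ≤ 1 := by
  have h1 : ∀ t, rescaled n c (fun η => tileConditional f₂ π₂ x n η ζ) t = _ := fun t =>
    rescaled_div_integral (fun η => lik f₂ x n (join η ζ) * π₂ (join η ζ)) c t hn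
  simp only [h1]
  refine lintegral_enorm_div_integral_le_one fun t => ?_
  by_cases h : join (c + (Real.sqrt n)⁻¹ • t) ζ ∈ Θ₂
  · exact mul_nonneg (hQ₂.nonneg n _ h) (hπ₂.nonneg _)
  · simp [hπ₂.eq_zero_of_notMem _ h]

/-- One integrable envelope serves all means in a ball, as dominated convergence requires when the
mean moves with `n`. -/
theorem exists_gaussianDensity_le (hK : K.PosDef) (M : ℝ) :
    ∃ G : EuclideanSpace ℝ κ → ℝ, Integrable G ∧ Measurable G ∧
      ∀ m, ‖m‖ ≤ M → ∀ r, ‖gaussianDensity m K⁻¹ r‖ ≤ G r := by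
  obtain ⟨c, hc, hq⟩ := exists_pos_mul_sq_norm_le_quadForm hK
  have hp := integral_gaussianKernel_pos hK
  refine ⟨fun r => Real.exp (c / 2 * M ^ 2) / (∫ h, gaussianKernel K h) *
    Real.exp (-(c / 4) * ‖r‖ ^ 2),
    (integrable_exp_neg_mul_sq_norm (by positivity)).const_mul _, by fun_prop, ?_⟩
  intro m hm r
  rw [gaussianDensity_inv_eq hK, norm_div, Real.norm_of_nonneg (gaussianKernel_pos _ _).le,
    Real.norm_of_nonneg hp.le]
  simp only
  rw [div_mul_eq_mul_div]
  refine (div_le_div_iff_of_pos_right hp).2 ?_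
  rw [gaussianKernel, ← Real.exp_add]
  refine Real.exp_le_exp.2 ?_
  have h1 := hq (r - m)
  -- Multiplied by `c / 4`, this produces the two constants of the envelope.
  have h2 : ‖r‖ ^ 2 ≤ 2 * ‖r - m‖ ^ 2 + 2 * M ^ 2 := by
    have h3 : ‖r‖ ≤ ‖r - m‖ + ‖m‖ := norm_le_norm_sub_add r m
    have h4 := norm_nonneg m
    nlinarith [norm_nonneg r, norm_nonneg (r - m), sq_nonneg (‖r - m‖ - M)]
  nlinarith

/-- The mixture inequality separates the knot error from the tile error, and the Gaussian mixture of
the limits has a closed form. The truncation to `‖μ n‖ ≤ M` is the one used for the plug-in. -/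
theorem eventually_l1Dist_exactTile_le (hf₁ : Measurable (Function.uncurry f₁))
    (hf₂ : Measurable (Function.uncurry f₂))
    (hQ₁ : IsLocallyQuadratic Θ₁ (subvec Sum.inr z₀) K (lik f₁ x) ζt)
    (hQ₂ : IsLocallyQuadratic Θ₂ z₀ J (lik f₂ x) zhat)
    (hπ₁ : IsPrior Θ₁ (subvec Sum.inr z₀) π₁) (hmean : Integrable (fun ζ => π₁ ζ • ζ))
    (hπ₂ : IsConditionalPrior Θ₁ Θ₂ z₀ π₂) (hΘ₁ : Θ₁ ∈ 𝓝 (subvec Sum.inr z₀))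
    (M : ℝ) {ε : ℝ≥0∞} (hε : 0 < ε) :
    ∀ᶠ n : ℕ in atTop, ‖Real.sqrt n • (ζt n - subvec Sum.inr (zhat n))‖ ≤ M →
      l1Dist (exactTile f₁ π₁ f₂ π₂ x n (zhat n))
        (gaussianDensity (tileMean J (Real.sqrt n • (ζt n - subvec Sum.inr (zhat n))))
          (J.toBlocks₁₁⁻¹ + covInflation J K)) ≤ ε := by
  have h11 := posDef_toBlocks₁₁ hQ₂.posDef
  set μ : ℕ → EuclideanSpace ℝ κ :=
    fun n => Real.sqrt n • (ζt n - subvec Sum.inr (zhat n)) with hμ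
  set s : ℕ → EuclideanSpace ℝ κ := fun n => if ‖μ n‖ ≤ M then μ n else 0 with hs
  have hsb : ∀ n, ‖s n‖ ≤ max M 0 := by
    intro n
    simp only [hs]
    split_ifs with h
    · exact h.trans (le_max_left _ _)
    · simp
  set a : ℕ → EuclideanSpace ℝ ι → EuclideanSpace ℝ κ → ℝ := fun n t r =>
    rescaled n (subvec Sum.inl (zhat n)) (fun η => tileConditional f₂ π₂ x n η
        (subvec Sum.inr (zhat n) + (Real.sqrt n)⁻¹ • r)) t with ha
  set a' : EuclideanSpace ℝ ι → EuclideanSpace ℝ κ → ℝ := fun t r =>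
    gaussianDensity (tileMean J r) J.toBlocks₁₁⁻¹ t with ha'
  set b : ℕ → EuclideanSpace ℝ κ → ℝ := fun n r =>
    rescaled n (subvec Sum.inr (zhat n)) (knotPosterior f₁ π₁ x n) r with hb
  have ham : ∀ n, Measurable (Function.uncurry (a n)) := by
    intro n
    have h1 := measurable_tileConditional (Ω := Unit) (x := fun i _ => x i) hf₂
      (fun i => measurable_const) hπ₂.measurable n
    have h3 : Measurable (fun q : EuclideanSpace ℝ ι × EuclideanSpace ℝ κ =>
      subvec Sum.inl (zhat n) + (Real.sqrt n)⁻¹ • q.1) := by fun_prop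
    have h4 : Measurable (fun q : EuclideanSpace ℝ ι × EuclideanSpace ℝ κ =>
      subvec Sum.inr (zhat n) + (Real.sqrt n)⁻¹ • q.2) := by fun_prop
    have h5 := h1.comp ((measurable_const (a := ())).prodMk (h3.prodMk h4))
    exact h5.const_mul _
  have ham' : Measurable (Function.uncurry a') := by
    have h1 : Measurable (fun q : EuclideanSpace ℝ ι × EuclideanSpace ℝ κ => tileMean J q.2) :=
      (continuous_tileMean J).measurable.comp measurable_snd
    exact measurable_gaussianDensity _ h1 measurable_fst
  have hbm : ∀ n, Measurable (b n) := by
    intro n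
    have h1 := measurable_knotPosterior (Ω := Unit) (x := fun i _ => x i) hf₁
      (fun i => measurable_const) hπ₁.measurable n
    have h4 : Measurable (fun r : EuclideanSpace ℝ κ =>
      subvec Sum.inr (zhat n) + (Real.sqrt n)⁻¹ • r) := by fun_prop
    have h5 := h1.comp ((measurable_const (a := ())).prodMk h4)
    exact h5.const_mul _
  have hbm' : ∀ m : EuclideanSpace ℝ κ, Measurable (gaussianDensity m K⁻¹) := fun m =>
    measurable_gaussianDensity K⁻¹ measurable_const measurable_id
  have ha1' : ∀ r, ∫⁻ t, ‖a' t r‖ₑ ≤ 1 := fun r => (lintegral_gaussianDensity_inv h11 _).le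
  have hknot := tendsto_l1Dist_rescaled_knotPosterior hQ₁ hπ₁ hmean
    (fun n => subvec Sum.inr (zhat n))
  obtain ⟨G, hGi, hGm, hG⟩ := exists_gaussianDensity_le hQ₁.posDef (max M 0)
  -- For each fixed `r` the tile distance tends to zero, and it never exceeds two for `n > 0`;
  -- dominated convergence in `r` averages it over the knots.
  have htv : Tendsto (fun n : ℕ => ∫⁻ r, ‖gaussianDensity (s n) K⁻¹ r‖ₑ *
      ∫⁻ t, ‖a n t r - a' t r‖ₑ) atTop (𝓝 0) := by
    have := tendsto_lintegral_filter_of_dominated_convergence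
      (μ := (volume : Measure (EuclideanSpace ℝ κ))) (l := atTop)
      (F := fun (n : ℕ) r => ‖gaussianDensity (s n) K⁻¹ r‖ₑ * ∫⁻ t, ‖a n t r - a' t r‖ₑ)
      (f := fun _ => 0) (fun r => ENNReal.ofReal (G r) * 2)
      (Eventually.of_forall fun n =>
        (hbm' (s n)).enorm.mul ((ham n).sub ham').enorm.lintegral_prod_left')
      (by
        filter_upwards [eventually_gt_atTop 0] with n hn0
        refine Eventually.of_forall fun r => ?_
        gcongr
        · rw [← ofReal_norm]
          exact ENNReal.ofReal_le_ofReal (hG _ (hsb n) r)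
        · calc ∫⁻ t, ‖a n t r - a' t r‖ₑ ≤ ∫⁻ t, (‖a n t r‖ₑ + ‖a' t r‖ₑ) :=
                lintegral_mono fun t => enorm_sub_le
            _ = (∫⁻ t, ‖a n t r‖ₑ) + ∫⁻ t, ‖a' t r‖ₑ :=
                lintegral_add_left ((ham n).comp measurable_prodMk_right).enorm _
            _ ≤ 1 + 1 := add_le_add
                (lintegral_rescaled_tileConditional_le_one hQ₂ hπ₂ _ _ hn0) (ha1' r)
            _ = 2 := one_add_one_eq_two)
      (by
        rw [lintegral_mul_const' _ _ (by simp)]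
        exact ENNReal.mul_ne_top hGi.lintegral_lt_top.ne (by simp))
      (Eventually.of_forall fun r => by
        have h1 : Tendsto (fun n : ℕ => ∫⁻ t, ‖a n t r - a' t r‖ₑ) atTop (𝓝 0) :=
          tendsto_tileConditional hQ₂ hπ₂ hΘ₁ (r := fun _ => r) (s := fun _ => r)
            (B := ‖r‖) (fun n => le_rfl) (fun n => le_rfl) (by simp)
        have h2 := ENNReal.Tendsto.const_mul (a := ENNReal.ofReal (G r)) h1
          (Or.inr ENNReal.ofReal_ne_top)
        rw [mul_zero] at h2
        refine tendsto_of_tendsto_of_tendsto_of_le_of_le tendsto_const_nhds h2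
          (fun n => zero_le) (fun n => ?_)
        simp only
        gcongr
        rw [← ofReal_norm]
        exact ENNReal.ofReal_le_ofReal (hG _ (hsb n) r))
    simpa using this
  have htot := hknot.add htv
  rw [add_zero] at htot
  filter_upwards [htot.eventually_le_const hε, eventually_gt_atTop 0] with n hn hn0 hM
  have h1 : s n = μ n := if_pos hM
  rw [h1] at hn
  refine le_trans (le_of_eq ?_) ((l1Dist_integral_mul_le (ham n) ham' (hbm n) (hbm' (μ n))
    (fun r => lintegral_rescaled_tileConditional_le_one hQ₂ hπ₂ _ _ hn0) ha1'
    (ne_top_of_le_ne_top ENNReal.one_ne_top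
      (lintegral_rescaled_knotPosterior_le_one hQ₁ hπ₁ _ hn0))
    (by rw [lintegral_gaussianDensity_inv hQ₁.posDef]; exact ENNReal.one_ne_top)).trans hn)
  congr 1
  ext t
  exact (integral_gaussianDensity_tileMean_mul hQ₂.posDef hQ₁.posDef (μ n) t).symm

end FixedSample

/-! ### Convergence in probability -/

/-- A sequence that vanishes almost surely in the limit as long as `T n` stays bounded converges
to zero in probability if the `T n` are bounded in expectation. -/
theorem tendstoInMeasure_of_eventually_le {Ω : Type*} [MeasurableSpace Ω] {Pr : Measure Ω}
    [IsFiniteMeasure Pr] {D : ℕ → Ω → ℝ≥0∞} {T : ℕ → Ω → ℝ} {V : ℝ≥0∞}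
    (hD : ∀ n, Measurable (D n)) (hT : ∀ n, AEMeasurable (T n) Pr) (hV : V ≠ ∞)
    (hTV : ∀ n, ∫⁻ ω, ENNReal.ofReal (T n ω) ∂Pr ≤ V)
    (h : ∀ᵐ ω ∂Pr, ∀ M : ℝ, ∀ ε > 0, ∀ᶠ n in atTop, T n ω ≤ M → D n ω ≤ ε) :
    TendstoInMeasure Pr D atTop (fun _ => 0) := by
  intro ε hε
  have hed : ∀ a : ℝ≥0∞, edist a 0 = a := by
    intro a
    cases a
    · exact (ENNReal.edist_eq_top_iff _ _).2 ⟨ENNReal.top_ne_zero, Or.inl rfl⟩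
    · change edist ((_ : NNReal) : WithTop NNReal) ((0 : NNReal) : WithTop NNReal) = _
      rename_i a
      change ((edist a 0 : ℝ≥0∞)) = a
      simp [edist_nndist, NNReal.nndist_zero_eq_val']
  simp only [hed]
  -- A level strictly below `ε` makes `D n ω ≤ ε'` incompatible with `ε ≤ D n ω`.
  obtain ⟨ε', hε', hlt⟩ := exists_between hε
  rw [ENNReal.tendsto_atTop_zero]
  intro δ hδ
  have hδ2 : δ / 2 ≠ 0 := (ENNReal.half_pos hδ.ne').ne'
  -- The threshold for Markov's inequality: `T n` exceeds it with probability at most `δ / 2`.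
  obtain ⟨M, hM⟩ : ∃ M : ℕ, V / (M + 1 : ℕ) ≤ δ / 2 := by
    have h1 : Tendsto (fun M : ℕ => V / (M + 1 : ℕ)) atTop (𝓝 0) := by
      have := ENNReal.tendsto_inv_nat_nhds_zero.comp (tendsto_add_atTop_nat 1)
      have h2 := ENNReal.Tendsto.const_mul (a := V) this (Or.inr hV)
      simpa [div_eq_mul_inv, Function.comp_def] using h2
    exact (h1.eventually_le_const (pos_iff_ne_zero.2 hδ2)).exists
  -- Almost every sample lies in only finitely many of these events, so their indicators tend to
  -- zero almost surely, hence in measure.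
  set A : ℕ → Set Ω := fun n => {ω | T n ω ≤ (M + 1 : ℕ)} ∩ {ω | ε ≤ D n ω} with hA
  have hAm : ∀ n, NullMeasurableSet (A n) Pr := fun n =>
    (nullMeasurableSet_le (hT n) aemeasurable_const).inter
      (measurableSet_le measurable_const (hD n)).nullMeasurableSet
  have hA0 : TendstoInMeasure Pr (fun n => (A n).indicator (fun _ => (1 : ℝ))) atTop
      (fun _ => 0) := by
    refine tendstoInMeasure_of_tendsto_ae
      (fun n => aestronglyMeasurable_const.indicator₀ (hAm n)) ?_
    filter_upwards [h] with ω hω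
    refine tendsto_const_nhds.congr' ?_
    filter_upwards [hω (M + 1 : ℕ) ε' hε'] with n hn
    rw [Set.indicator_of_notMem]
    rintro ⟨h1, h2⟩
    exact absurd (hn h1) (not_le.2 (hlt.trans_le h2))
  have hA1 := hA0 1 one_pos
  rw [ENNReal.tendsto_atTop_zero] at hA1
  obtain ⟨N, hN⟩ := hA1 (δ / 2) (pos_iff_ne_zero.2 hδ2)
  refine ⟨N, fun n hn => ?_⟩
  have hsub : {ω | ε ≤ D n ω} ⊆ {ω | ((M + 1 : ℕ) : ℝ≥0∞) ≤ ENNReal.ofReal (T n ω)} ∪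
      {ω | 1 ≤ edist ((A n).indicator (fun _ => (1 : ℝ)) ω) 0} := by
    intro ω hω
    by_cases h1 : T n ω ≤ (M + 1 : ℕ)
    · right
      have : ω ∈ A n := ⟨h1, hω⟩
      simp [this, edist_dist]
    · left
      rw [Set.mem_ofPred_eq, ← ENNReal.ofReal_natCast]
      exact ENNReal.ofReal_le_ofReal (not_le.1 h1).le
  calc Pr {ω | ε ≤ D n ω} ≤ Pr {ω | ((M + 1 : ℕ) : ℝ≥0∞) ≤ ENNReal.ofReal (T n ω)} +
        Pr {ω | 1 ≤ edist ((A n).indicator (fun _ => (1 : ℝ)) ω) 0} :=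
        (measure_mono hsub).trans (measure_union_le _ _)
    _ ≤ δ / 2 + δ / 2 := by
        refine add_le_add (le_trans ?_ hM) (hN n hn)
        rw [ENNReal.le_div_iff_mul_le (Or.inl (by simp)) (Or.inl (by simp)), mul_comm]
        exact (mul_meas_ge_le_lintegral₀ (hT n).ennreal_ofReal _).trans (hTV n)
    _ = δ := ENNReal.add_halves δ

theorem norm_subvec_inr_sub_le {ι κ : Type*} [Fintype ι] [Fintype κ]
    (z z' : EuclideanSpace ℝ (ι ⊕ κ)) :
    ‖subvec (Sum.inr : κ → ι ⊕ κ) z - subvec Sum.inr z'‖ ≤ ‖z - z'‖ := by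
  have h : z - z' = join (subvec Sum.inl (z - z')) (subvec Sum.inr (z - z')) := by
    ext i
    rcases i with i | i <;> rfl
  have h2 : subvec (Sum.inr : κ → ι ⊕ κ) z - subvec Sum.inr z' = subvec Sum.inr (z - z') := rfl
  refine le_of_sq_le_sq ?_ (norm_nonneg _)
  rw [h2, h, norm_join_sq, ← h]
  nlinarith [sq_nonneg ‖subvec (Sum.inl : ι → ι ⊕ κ) (z - z')‖]

/-- If the maximizers are controlled by the scores, so is their rescaled difference. -/
theorem norm_sqrt_smul_sub_le {ι κ : Type*} [Fintype ι] [Fintype κ] {n : ℕ}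
    {ζt : EuclideanSpace ℝ κ} {z z₀ : EuclideanSpace ℝ (ι ⊕ κ)} {D₁ D₂ s₁ s₂ M : ℝ}
    (hD₁ : 0 ≤ D₁) (hD₂ : 0 ≤ D₂) (hs₁ : 0 ≤ s₁) (hs₂ : 0 ≤ s₂)
    (h₁ : n * ‖ζt - subvec Sum.inr z₀‖ ^ 2 ≤ D₁ * s₁) (h₂ : n * ‖z - z₀‖ ^ 2 ≤ D₂ * s₂)
    (hM : s₁ + s₂ ≤ M) :
    ‖Real.sqrt n • (ζt - subvec Sum.inr z)‖ ≤ Real.sqrt (2 * (D₁ + D₂) * M) := by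
  refine Real.le_sqrt_of_sq_le ?_
  rw [norm_smul, mul_pow, Real.norm_of_nonneg (Real.sqrt_nonneg _), Real.sq_sqrt (by positivity)]
  have h3 : ‖ζt - subvec Sum.inr z‖ ≤ ‖ζt - subvec Sum.inr z₀‖ + ‖z - z₀‖ := by
    have h4 := norm_sub_le (ζt - subvec Sum.inr z₀) (subvec Sum.inr z - subvec Sum.inr z₀)
    rw [sub_sub_sub_cancel_right] at h4
    exact h4.trans (by gcongr; exact norm_subvec_inr_sub_le _ _)
  have h5 : ‖ζt - subvec Sum.inr z‖ ^ 2 ≤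
      2 * ‖ζt - subvec Sum.inr z₀‖ ^ 2 + 2 * ‖z - z₀‖ ^ 2 := by
    have h6 : ‖ζt - subvec Sum.inr z‖ ^ 2 ≤ (‖ζt - subvec Sum.inr z₀‖ + ‖z - z₀‖) ^ 2 := by gcongr
    nlinarith [sq_nonneg (‖ζt - subvec Sum.inr z₀‖ - ‖z - z₀‖)]
  calc n * ‖ζt - subvec Sum.inr z‖ ^ 2
      ≤ n * (2 * ‖ζt - subvec Sum.inr z₀‖ ^ 2 + 2 * ‖z - z₀‖ ^ 2) := by gcongr
    _ = 2 * (n * ‖ζt - subvec Sum.inr z₀‖ ^ 2 + n * ‖z - z₀‖ ^ 2) := by ring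
    _ ≤ 2 * (D₁ * s₁ + D₂ * s₂) := by gcongr
    _ ≤ 2 * ((D₁ + D₂) * (s₁ + s₂)) := by
        nlinarith [mul_nonneg hD₁ hs₂, mul_nonneg hD₂ hs₁]
    _ ≤ 2 * ((D₁ + D₂) * M) := by gcongr
    _ = _ := by ring

theorem scoreSq_nonneg {ι Y : Type*} [Fintype ι] [DecidableEq ι]
    (f : EuclideanSpace ℝ ι → Y → ℝ) (z₀ : EuclideanSpace ℝ ι) (x : ℕ → Y) (n : ℕ) :
    0 ≤ scoreSq f z₀ x n := by
  unfold scoreSq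
  positivity

end

end BayesMosaic

/-! ### Proof of the theorem -/

open BayesMosaic
theorem theorem2 {p d dη dζ : ℕ}
    -- the model: densities `f θ` with respect to `ν`, `θ ∈ T`, and the true value `θ₀`
    (ν : Measure (EuclideanSpace ℝ (Fin p))) [SigmaFinite ν]
    (T : Set (EuclideanSpace ℝ (Fin d)))
    (f : EuclideanSpace ℝ (Fin d) → EuclideanSpace ℝ (Fin p) → ℝ)
    (hf : IsDensityFamily ν T f)
    (θ₀ : EuclideanSpace ℝ (Fin d)) (hθ₀ : θ₀ ∈ interior T)
    -- the i.i.d. observations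
    {Ω : Type*} [MeasurableSpace Ω] (Pr : Measure Ω) [IsProbabilityMeasure Pr]
    (y : ℕ → Ω → EuclideanSpace ℝ (Fin p))
    (hy_meas : ∀ i, Measurable (y i))
    (hy_indep : iIndepFun y Pr)
    (hy_law : ∀ i, Measure.map (y i) Pr = lawOf ν (f θ₀))
    -- the non-overlapping sub-vectors `η` (tiles) and `ζ` (knots) of `θ`
    (s : Fin dη ⊕ Fin dζ ↪ Fin d)
    -- the pseudo densities, with their maximum likelihood estimators
    (f₁ : EuclideanSpace ℝ (Fin dζ) → EuclideanSpace ℝ (Fin p) → ℝ)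
    (f₂ : EuclideanSpace ℝ (Fin dη ⊕ Fin dζ) → EuclideanSpace ℝ (Fin p) → ℝ)
    (ζtilde : ℕ → Ω → EuclideanSpace ℝ (Fin dζ))
    (zhat : ℕ → Ω → EuclideanSpace ℝ (Fin dη ⊕ Fin dζ))
    (hf₁ : Regular Pr (lawOf ν (f θ₀)) y (subvec (fun j => s (Sum.inr j)) '' T) f₁
      (subvec (fun j => s (Sum.inr j)) θ₀) ζtilde)
    (hf₂ : Regular Pr (lawOf ν (f θ₀)) y (subvec s '' T) f₂ (subvec s θ₀) zhat)
    -- the priors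
    (π₁ : EuclideanSpace ℝ (Fin dζ) → ℝ)
    (hπ₁ : IsPrior (subvec (fun j => s (Sum.inr j)) '' T)
      (subvec (fun j => s (Sum.inr j)) θ₀) π₁)
    (hπ₁_mean : Integrable (fun ζ => π₁ ζ • ζ))
    (π₂ : EuclideanSpace ℝ (Fin dη ⊕ Fin dζ) → ℝ)
    (hπ₂ : IsConditionalPrior (subvec (fun j => s (Sum.inr j)) '' T) (subvec s '' T)
      (subvec s θ₀) π₂)
    -- the information matrices and `μₙ`
    (I₀ : Matrix (Fin dη ⊕ Fin dζ) (Fin dη ⊕ Fin dζ) ℝ)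
    (hI₀ : I₀ = infoMatrix (lawOf ν (f θ₀)) f₂ (subvec s θ₀))
    (Itilde₀ : Matrix (Fin dζ) (Fin dζ) ℝ)
    (hItilde₀ : Itilde₀ = infoMatrix (lawOf ν (f θ₀)) f₁ (subvec (fun j => s (Sum.inr j)) θ₀))
    (μ : ℕ → Ω → EuclideanSpace ℝ (Fin dζ))
    (hμ : ∀ n ω, μ n ω = Real.sqrt n • (ζtilde n ω - subvec Sum.inr (zhat n ω))) :
    TendstoInMeasure Pr
      (fun n ω => l1Dist (plugInTile f₁ π₁ f₂ π₂ (fun i => y i ω) n (zhat n ω))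
        (gaussianDensity (tileMean I₀ (μ n ω)) (I₀.toBlocks₁₁)⁻¹))
      atTop (fun _ => 0) ∧
    -- comparison with the exact mosaic, whose covariance is larger
    TendstoInMeasure Pr
      (fun n ω => l1Dist (exactTile f₁ π₁ f₂ π₂ (fun i => y i ω) n (zhat n ω))
        (gaussianDensity (tileMean I₀ (μ n ω))
          ((I₀.toBlocks₁₁)⁻¹ + covInflation I₀ Itilde₀)))
      atTop (fun _ => 0) ∧
    (covInflation I₀ Itilde₀).PosSemidef := by
  have hx : IsIIDSample Pr (lawOf ν (f θ₀)) y := ⟨hy_meas, hy_indep, hy_law⟩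
  have hsub : subvec (fun j => s (Sum.inr j)) θ₀ =
      subvec (Sum.inr : Fin dζ → Fin dη ⊕ Fin dζ) (subvec s θ₀) := rfl
  rw [hsub] at hf₁ hπ₁ hItilde₀
  set P := lawOf ν (f θ₀)
  set z₀ := subvec s θ₀
  set Θ₁ := subvec (fun j => s (Sum.inr j)) '' T
  set Θ₂ := subvec s '' T
  have hΘ₁ : Θ₁ ∈ 𝓝 (subvec (Sum.inr : Fin dζ → Fin dη ⊕ Fin dζ) z₀) := by
    obtain ⟨δ, hδ, hb, -⟩ := hf₁.smooth
    exact Filter.mem_of_superset (Metric.ball_mem_nhds _ hδ) hb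
  have hμm : ∀ n, Measurable (μ n) := by
    intro n
    have h1 : μ n = fun ω => Real.sqrt n • (ζtilde n ω - subvec Sum.inr (zhat n ω)) :=
      funext (hμ n)
    rw [h1]
    have h2 : Measurable (fun ω => ζtilde n ω - subvec Sum.inr (zhat n ω)) :=
      (hf₁.est_measurable n).sub
        ((continuous_subvec Sum.inr).measurable.comp (hf₂.est_measurable n))
    exact h2.const_smul (Real.sqrt n)
  obtain ⟨V₁, hV₁, hs₁⟩ := hf₁.exists_lintegral_scoreSq_le hx
  obtain ⟨V₂, hV₂, hs₂⟩ := hf₂.exists_lintegral_scoreSq_le hx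
  obtain ⟨D₁, hD₁, hb₁⟩ := hf₁.ae_sq_norm_sub_le hx
  obtain ⟨D₂, hD₂, hb₂⟩ := hf₂.ae_sq_norm_sub_le hx
  have hq₁ := hf₁.ae_isLocallyQuadratic hx
  have hq₂ := hf₂.ae_isLocallyQuadratic hx
  rw [← hItilde₀] at hq₁
  rw [← hI₀] at hq₂
  have hI : I₀.PosDef := hI₀ ▸ hf₂.information_posDef
  have hK : Itilde₀.PosDef := hItilde₀ ▸ hf₁.information_posDef
  -- The sum of the two squared normalized scores serves as the control variable `T n`.
  have hTm : ∀ n, AEMeasurable (fun ω => scoreSq f₁ (subvec Sum.inr z₀) (fun i => y i ω) n +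
      scoreSq f₂ z₀ (fun i => y i ω) n) Pr := fun n =>
    (hf₁.aemeasurable_scoreSq hx n).add (hf₂.aemeasurable_scoreSq hx n)
  have hTV : ∀ n, ∫⁻ ω, ENNReal.ofReal (scoreSq f₁ (subvec Sum.inr z₀) (fun i => y i ω) n +
      scoreSq f₂ z₀ (fun i => y i ω) n) ∂Pr ≤ V₁ + V₂ := by
    intro n
    simp only [ENNReal.ofReal_add (scoreSq_nonneg _ _ _ _) (scoreSq_nonneg _ _ _ _)]
    rw [lintegral_add_left' (hf₁.aemeasurable_scoreSq hx n).ennreal_ofReal]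
    exact add_le_add (hs₁ n) (hs₂ n)
  have hV : V₁ + V₂ ≠ ⊤ := ENNReal.add_ne_top.2 ⟨hV₁, hV₂⟩
  refine ⟨?_, ?_, posSemidef_covInflation hI hK⟩
  · refine tendstoInMeasure_of_eventually_le (fun n => ?_) hTm hV hTV ?_
    · exact measurable_l1Dist
        (measurable_plugInTile hf₁.measurable hf₂.measurable hy_meas hπ₁.measurable
          hπ₂.measurable n (hf₂.est_measurable n))
        (measurable_gaussianDensity_tileMean I₀ _ (hμm n))
    · filter_upwards [hq₁, hq₂, hb₁, hb₂] with ω h1 h2 h3 h4 M ε hε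
      -- A bound `M` on the scores bounds `‖μ n‖` by this square root, the level at which the
      -- fixed-sample result is applied.
      filter_upwards [eventually_l1Dist_plugInTile_le h1 h2 hπ₁ hπ₁_mean hπ₂ hΘ₁
        (Real.sqrt (2 * (D₁ + D₂) * M)) hε, h3, h4] with n h5 h6 h7 hM
      rw [hμ]
      exact h5 (norm_sqrt_smul_sub_le hD₁ hD₂ (scoreSq_nonneg _ _ _ _) (scoreSq_nonneg _ _ _ _)
        h6 h7 hM)
  · refine tendstoInMeasure_of_eventually_le (fun n => ?_) hTm hV hTV ?_
    · exact measurable_l1Dist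
        (measurable_exactTile hf₁.measurable hf₂.measurable hy_meas hπ₁.measurable
          hπ₂.measurable n (hf₂.est_measurable n))
        (measurable_gaussianDensity_tileMean I₀ _ (hμm n))
    · filter_upwards [hq₁, hq₂, hb₁, hb₂] with ω h1 h2 h3 h4 M ε hε
      filter_upwards [eventually_l1Dist_exactTile_le hf₁.measurable hf₂.measurable h1 h2 hπ₁
        hπ₁_mean hπ₂ hΘ₁ (Real.sqrt (2 * (D₁ + D₂) * M)) hε, h3, h4] with n h5 h6 h7 hM
      rw [hμ]
      exact h5 (norm_sqrt_smul_sub_le hD₁ hD₂ (scoreSq_nonneg _ _ _ _) (scoreSq_nonneg _ _ _ _)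
        h6 h7 hM)
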